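/- **Setting.** Let $\mu(z)=(1+e^{-z})^{-1}$. In each round $t=1,\dots,T$ an agent observes $\mathcal X_t=(x_{t,a})_{a\in[K]}$ with $x_{t,a}\in\mathbb R^d$ ($d,K\ge 1$, $T\ge 4$), chooses $a_t\in[K]$ and receives $r_t\in\{0,1\}$ which, given $\mathcal F_t=\sigma(\mathcal X_1,a_1,\dots,\mathcal X_t,a_t,r_1,\dots,r_{t-1})$, is Bernoulli with mean $\mu(x_{t,a_t}^{\mathsf T}\theta^*)$. The regret is $R_T=\sum_{t=1}^T\big[\mu(\max_a x_{t,a}^{\mathsf T}\theta^*)-\mu(x_{t,a_t}^{\mathsf T}\theta^*)\big]$. Assume: 1. almost surely $\|x_{t,a}\|_2\le 1$ for all $t,a$; and $\theta^*\in\Theta=\{\theta:\|\theta\|_2\le B\}$, where $B>0$; 2. for some $\kappa,L_\mu>0$, almost surely $1/\kappa\le\dot\mu(x_{t,a}^{\mathsf T}\theta)\le L_\mu$ for all $t,a$ and all $\theta\in\Theta$; 3. the contexts are generated independently of past actions and rewards: for every $t$, $(\mathcal X_1,\dots,\mathcal X_T)$ is conditionally independent of $(a_1,r_1,\dots,a_t,r_t)$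 given $(\mathcal X_1,\dots,\mathcal X_t)$. **Parameters.** Let $0<\delta<1$, let the regularization satisfy $\lambda\ge 1/\kappa$ (for instance $\lambda=1$), and put $S=\lfloor 0.5\log_2T\rfloor$, $\ell=\log(1+T/(\kappa\lambda d))$, $$\alpha=2\Big(\sqrt{2L_\mu\kappa^2\log(4TSK/\delta)}+\sqrt{\kappa/(9\lambda)}\,\log(4TSK/\delta)+B\sqrt{\kappa\lambda}\Big),$$ $$\beta=\kappa\sqrt{0.5\,d\,\ell+0.5\log(2S/\delta)}+B\sqrt{\kappa\lambda},\qquad \tau^{(s)}=\frac1{\beta^2}\min\Big\{1,\frac{2^{-s}}{\sqrt{32L_\mu\kappa d\,\ell}}\Big\}.$$ **Algorithm (SupSplitLog).** For every level $s\ge 1$ keep two sets of rounds $P^{(s)},E^{(s)}$, initially empty. For their current values let $V_P^{(s)}=\kappa\lambda I+\sum_{i\in P^{(s)}}x_{i,a_i}x_{i,a_i}^{\mathsf T}$, let $V_E^{(s)}$ be defined likewise with $E^{(s)}$, let $\bar\theta^{(s)}$ be the minimizer over $\Theta$ of $\sum_{i\in P^{(s)}}[-r_i\log\mu(x_{i,a_i}^{\mathsf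 T}\theta)-(1-r_i)\log(1-\mu(x_{i,a_i}^{\mathsf T}\theta))]+\frac\lambda2\|\theta\|_2^2$, and let $\hat\theta^{(s)}=\bar\theta^{(s)}+H^{-1}g$ with $g=\sum_{i\in E^{(s)}}(r_i-\mu(x_{i,a_i}^{\mathsf T}\bar\theta^{(s)}))x_{i,a_i}-\lambda\bar\theta^{(s)}$ and $H=\lambda I+\sum_{i\in E^{(s)}}\dot\mu(x_{i,a_i}^{\mathsf T}\bar\theta^{(s)})x_{i,a_i}x_{i,a_i}^{\mathsf T}$. In round $t$ start with $A^{(1)}=[K]$, $s=1$ and, with $m_a^{(s)}=x_{t,a}^{\mathsf T}\hat\theta^{(s)}$ and $w_a^{(s)}=\alpha\|x_{t,a}\|_{(V_E^{(s)})^{-1}}$, repeat: - (a) if $w_a^{(s)}>2^{-s}$ for some $a\in A^{(s)}$, choose $a_t\in\arg\max_{a\in A^{(s)}}w_a^{(s)}$, add $t$ to $P^{(s)}$ if $\|x_{t,a_t}\|^2_{(V_P^{(s)})^{-1}}>\tau^{(s)}$ and to $E^{(s)}$ otherwise, and end the round; - (b) otherwise, if $w_a^{(s)}\le 1/\sqrt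 T$ for all $a\in A^{(s)}$, choose $a_t\in\arg\max_{a\in A^{(s)}}m_a^{(s)}$ and end the round; - (c) otherwise let $A^{(s+1)}=\{a\in A^{(s)}: m_a^{(s)}\ge\max_{b\in A^{(s)}}m_b^{(s)}-2\cdot2^{-s}\}$ and increase $s$ by one. Ties in the $\arg\max$ are broken by a fixed deterministic rule, which sees only the round and the set of maximizers. **Theorem.** With probability at least $1-\delta$, $$R_T\le 16L_\mu d\,\ell\,\beta^2\Big(1+S\sqrt{32L_\mu\kappa d\,\ell}\Big)+8L_\mu\alpha\sqrt{2STd\,\ell}+2L_\mu\sqrt T .$$ The right-hand side is of order $\tilde O(\kappa\sqrt{dT}+\kappa^{2.5}d^{2.5})$: there is an absolute $n\in\mathbb N$, and for all $B,\lambda,L_\mu>0$ a constant $C>0$ depending only on them, such that for all $d,K\ge1$, $T\ge4$, $\kappa\ge1$ with $\kappa\lambda\ge1$ and $\delta\in(0,1)$ it is at most $C\,\log^n(TK/\delta)\,(\kappa\sqrt{dT}+\kappa^{2.5}d^{2.5})$. No context-diversity assumption is made. -/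

import Mathlib

open MeasureTheory

noncomputable section

namespace SupSplitLog

/-- Number of arms, dimension, horizon, and the real parameters of the algorithm. The logistic
function is `μ = Real.sigmoid`, and `Lμ` is an upper bound for its derivative. -/
structure Params where
  /-- dimension of the feature vectors -/
  d : ℕ
  /-- horizon -/
  T : ℕ
  /-- number of arms -/
  K : ℕ
  /-- bound on the norm of the unknown parameter -/
  B : ℝ
  /-- inverse of the lower curvature bound -/
  κ : ℝ
  /-- regularization parameter -/
  lam : ℝ
  /-- confidence parameter -/
  δ : ℝ
  /-- upper curvature bound -/
  Lμ : ℝ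

/-- Feature vectors and parameters live in `ℝ^d` with the Euclidean norm. -/
abbrev Vec (d : ℕ) : Type := EuclideanSpace ℝ (Fin d)

namespace Params

variable (p : Params)

/-- `S = ⌊0.5 log₂ T⌋`. -/
def S : ℕ := ⌊(0.5 : ℝ) * Real.logb 2 p.T⌋₊

/-- `log (1 + T / (κ λ d))`. -/
def logTerm : ℝ := Real.log (1 + p.T / (p.κ * p.lam * p.d))

/-- `α₁ = √(2 L_μ κ² log(4TSK/δ)) + √(κ/(9λ)) log(4TSK/δ)`. -/
def α₁ : ℝ :=
  √(2 * p.Lμ * p.κ ^ 2 * Real.log (4 * p.T * p.S * p.K / p.δ)) +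
    √(p.κ / (9 * p.lam)) * Real.log (4 * p.T * p.S * p.K / p.δ)

/-- `α₂ = B √(κλ)`. -/
def α₂ : ℝ := p.B * √(p.κ * p.lam)

/-- `α = 2 (α₁ + α₂)`. -/
def α : ℝ := 2 * (p.α₁ + p.α₂)

/-- `β = κ √(0.5 d log(1 + T/(κλd)) + 0.5 log(2S/δ)) + B √(κλ)`. -/
def β : ℝ :=
  p.κ * √(0.5 * p.d * p.logTerm + 0.5 * Real.log (2 * p.S / p.δ)) + p.B * √(p.κ * p.lam)

/-- The threshold `τ^(s) = β⁻² min {1, 2⁻ˢ / √(32 L_μ κ d log(1 + T/(κλd)))}`. -/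
def τ (s : ℕ) : ℝ :=
  1 / p.β ^ 2 * min 1 ((1 / 2) ^ s / √(32 * p.Lμ * p.κ * p.d * p.logTerm))

/-- The feasible set `Θ = {θ : ‖θ‖₂ ≤ B}`. -/
def Θ : Set (Vec p.d) := Metric.closedBall 0 p.B

/-- The regret bound. -/
def regretBound : ℝ :=
  16 * p.Lμ * p.d * p.logTerm * p.β ^ 2 *
      (1 + p.S * √(32 * p.Lμ * p.κ * p.d * p.logTerm)) +
    8 * p.Lμ * p.α * √(2 * p.S * p.T * p.d * p.logTerm) +
    2 * p.Lμ * √p.T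

end Params

/-! ### Linear algebra and estimators -/

/-- The matrix `c I + ∑_{i ∈ I} w_i z_i z_iᵀ`. -/
def design {d : ℕ} (c : ℝ) (I : Finset ℕ) (w : ℕ → ℝ) (z : ℕ → Vec d) :
    Matrix (Fin d) (Fin d) ℝ :=
  c • (1 : Matrix (Fin d) (Fin d) ℝ) +
    ∑ i ∈ I, w i • Matrix.vecMulVec (z i).ofLp (z i).ofLp

/-- `‖v‖²_{V⁻¹} = vᵀ V⁻¹ v`. -/
def invNormSq {d : ℕ} (V : Matrix (Fin d) (Fin d) ℝ) (v : Vec d) : ℝ :=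
  v.ofLp ⬝ᵥ (V⁻¹.mulVec v.ofLp)

/-- Regularized logistic loss of the samples `(z_i, r_i)`, `i ∈ I`. -/
def logisticLoss {d : ℕ} (lam : ℝ) (I : Finset ℕ) (z : ℕ → Vec d) (r : ℕ → ℝ) (θ : Vec d) : ℝ :=
  ∑ i ∈ I, (-(r i * Real.log (Real.sigmoid (inner ℝ (z i) θ))) -
      (1 - r i) * Real.log (1 - Real.sigmoid (inner ℝ (z i) θ))) +
    lam / 2 * ‖θ‖ ^ 2

open Classical in
/-- The initial-point estimator: the minimizer of the regularized logistic loss over `Θ`. For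
`B ≥ 0` a minimizer exists (`pilot_spec`), and for `λ > 0` and rewards in `[0, 1]` it is unique,
by strict convexity. -/
def pilot (p : Params) (I : Finset ℕ) (z : ℕ → Vec p.d) (r : ℕ → ℝ) : Vec p.d :=
  Classical.epsilon fun θ => θ ∈ p.Θ ∧ IsMinOn (logisticLoss p.lam I z r) p.Θ θ

theorem pilot_spec (p : Params) (hB : 0 ≤ p.B) (I : Finset ℕ) (z : ℕ → Vec p.d) (r : ℕ → ℝ) :
    pilot p I z r ∈ p.Θ ∧ IsMinOn (logisticLoss p.lam I z r) p.Θ (pilot p I z r) := by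
  have hex : ∃ θ, θ ∈ p.Θ ∧ IsMinOn (logisticLoss p.lam I z r) p.Θ θ := by
    have hc : Continuous (logisticLoss p.lam I z r) := by
      unfold logisticLoss
      have h1 : ∀ i, Continuous fun θ : Vec p.d => Real.sigmoid (inner ℝ (z i) θ) := fun i =>
        continuous_sigmoid.comp (continuous_const.inner continuous_id)
      refine Continuous.add (continuous_finsetSum _ fun i _ => ?_) (by fun_prop)
      refine Continuous.sub (Continuous.neg (continuous_const.mul ?_)) (continuous_const.mul ?_)
      · exact (h1 i).log fun θ => (Real.sigmoid_pos _).ne'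
      · exact (continuous_const.sub (h1 i)).log fun θ =>
          (sub_pos.2 (Real.sigmoid_lt_one _)).ne'
    obtain ⟨θ, h, h'⟩ := (isCompact_closedBall (0 : Vec p.d) p.B).exists_isMinOn
      ⟨0, by simpa using hB⟩ hc.continuousOn
    exact ⟨θ, h, h'⟩
  exact Classical.epsilon_spec hex

/-- The gradient `g(θ) = ∑_{i ∈ I} (r_i - μ(z_iᵀ θ)) z_i - λ θ`. -/
def grad {d : ℕ} (lam : ℝ) (I : Finset ℕ) (z : ℕ → Vec d) (r : ℕ → ℝ) (θ : Vec d) : Vec d :=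
  ∑ i ∈ I, (r i - Real.sigmoid (inner ℝ (z i) θ)) • z i - lam • θ

/-- The Hessian `H(θ) = λ I + ∑_{i ∈ I} μ'(z_iᵀ θ) z_i z_iᵀ`. -/
def hess {d : ℕ} (lam : ℝ) (I : Finset ℕ) (z : ℕ → Vec d) (θ : Vec d) :
    Matrix (Fin d) (Fin d) ℝ :=
  design lam I (fun i => deriv Real.sigmoid (inner ℝ (z i) θ)) z

/-- The one-step corrected estimator `θ̂ = θ̄ + H(θ̄)⁻¹ g(θ̄)`, where the initial point `θ̄` uses the
samples in `IP`, and `H`, `g` use the samples in `IE`. -/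
def oneStep (p : Params) (IP IE : Finset ℕ) (z : ℕ → Vec p.d) (r : ℕ → ℝ) : Vec p.d :=
  pilot p IP z r + WithLp.toLp 2
    ((hess p.lam IE z (pilot p IP z r))⁻¹.mulVec (grad p.lam IE z r (pilot p IP z r)).ofLp)

/-! ### The algorithm -/

/-- What the algorithm remembers after some number of rounds: the chosen arms `a_i`, and for every
level `s` the pilot set `P^(s)` and the estimation set `E^(s)` (the bucket `Ψ^(s)` is their
union). -/
structure State (K : ℕ) where
  /-- chosen arms -/
  arm : ℕ → Fin K
  /-- pilot sets -/
  P : ℕ → Finset ℕ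
  /-- estimation sets -/
  E : ℕ → Finset ℕ

section Round

variable (p : Params) (x : ℕ → Fin p.K → Vec p.d) (r : ℕ → ℝ) (σ : State p.K) (t : ℕ)

/-- The features `x_{i, a_i}` of the chosen arms. -/
def chosen (i : ℕ) : Vec p.d := x i (σ.arm i)

/-- `V_P^(s) = κλ I + ∑_{i ∈ P^(s)} x_{i,a_i} x_{i,a_i}ᵀ`. -/
def VP (s : ℕ) : Matrix (Fin p.d) (Fin p.d) ℝ :=
  design (p.κ * p.lam) (σ.P s) (fun _ => 1) (chosen p x σ)

/-- `V_E^(s) = κλ I + ∑_{i ∈ E^(s)} x_{i,a_i} x_{i,a_i}ᵀ`. -/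
def VE (s : ℕ) : Matrix (Fin p.d) (Fin p.d) ℝ :=
  design (p.κ * p.lam) (σ.E s) (fun _ => 1) (chosen p x σ)

/-- `m_{t,a}^(s) = x_{t,a}ᵀ θ̂^(s)`. -/
def score (s : ℕ) (a : Fin p.K) : ℝ :=
  inner ℝ (x t a) (oneStep p (σ.P s) (σ.E s) (chosen p x σ) r)

/-- `w_{t,a}^(s) = α ‖x_{t,a}‖_{(V_E^(s))⁻¹}`. -/
def width (s : ℕ) (a : Fin p.K) : ℝ := p.α * √(invNormSq (VE p x σ s) (x t a))

open Classical in
/-- The candidate arms `A^(s)`: all arms for `s = 1`, and `A^(s+1)` is obtained from `A^(s)` by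
the elimination step (condition (c)). The value at `s = 0` is not used. -/
def active : ℕ → Finset (Fin p.K)
  | 0 => Finset.univ
  | 1 => Finset.univ
  | s + 2 => (active (s + 1)).filter fun a =>
      ∀ b ∈ active (s + 1), score p x r σ t (s + 1) b - 2 * (1 / 2) ^ (s + 1)
        ≤ score p x r σ t (s + 1) a

/-- Condition (a) at level `s`. -/
def condA (s : ℕ) : Prop := ∃ a ∈ active p x r σ t s, (1 / 2 : ℝ) ^ s < width p x σ t s a

/-- Condition (b) at level `s`. -/
def condB (s : ℕ) : Prop := ∀ a ∈ active p x r σ t s, width p x σ t s a ≤ 1 / √p.T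

/-- The level at which the while-loop of the round stops: the first `s ≥ 1` at which condition (a)
or condition (b) holds. For `T ≥ 1` there is one (`exists_stopLevel`). -/
def stopLevel : ℕ := sInf {s | 1 ≤ s ∧ (condA p x r σ t s ∨ condB p x r σ t s)}

theorem exists_stopLevel (hT : 1 ≤ p.T) :
    {s | 1 ≤ s ∧ (condA p x r σ t s ∨ condB p x r σ t s)}.Nonempty := by
  have hpos : (0 : ℝ) < 1 / √p.T := by
    have : (0 : ℝ) < p.T := by exact_mod_cast hT
    positivity
  obtain ⟨n, hn⟩ := exists_pow_lt_of_lt_one hpos (by norm_num : (1 / 2 : ℝ) < 1)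
  refine ⟨n + 1, by omega, or_iff_not_imp_left.2 fun hA a ha => ?_⟩
  have h1 : width p x σ t (n + 1) a ≤ (1 / 2 : ℝ) ^ (n + 1) := by
    by_contra hlt
    exact hA ⟨a, ha, not_le.1 hlt⟩
  have h2 : (1 / 2 : ℝ) ^ (n + 1) ≤ (1 / 2) ^ n :=
    pow_le_pow_of_le_one (by norm_num) (by norm_num) (Nat.le_succ n)
  linarith

open Classical in
/-- The maximizers of `f` over `A`. -/
def argmaxSet {K : ℕ} (A : Finset (Fin K)) (f : Fin K → ℝ) : Finset (Fin K) :=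
  A.filter fun a => ∀ b ∈ A, f b ≤ f a

open Classical in
/-- The arm chosen in round `t`. The map `tie` picks one of the maximizers. -/
def choice (tie : ℕ → Finset (Fin p.K) → Fin p.K) : Fin p.K :=
  if condA p x r σ t (stopLevel p x r σ t) then
    tie t (argmaxSet (active p x r σ t (stopLevel p x r σ t))
      (width p x σ t (stopLevel p x r σ t)))
  else
    tie t (argmaxSet (active p x r σ t (stopLevel p x r σ t))
      (score p x r σ t (stopLevel p x r σ t)))

open Classical in
/-- One round of the algorithm: `σ` is the state after round `t - 1`, the result is the state after
round `t`. If the round stops by condition (a) at level `s`, then `t` is added to `P^(s)`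
(condition (a1)) or to `E^(s)` (condition (a2)). -/
def step (tie : ℕ → Finset (Fin p.K) → Fin p.K) : State p.K :=
  let s := stopLevel p x r σ t
  let a := choice p x r σ t tie
  let arm := Function.update σ.arm t a
  if condA p x r σ t s then
    if p.τ s < invNormSq (VP p x σ s) (x t a) then
      { arm := arm, P := Function.update σ.P s (insert t (σ.P s)), E := σ.E }
    else
      { arm := arm, P := σ.P, E := Function.update σ.E s (insert t (σ.E s)) }
  else
    { arm := arm, P := σ.P, E := σ.E }

end Round

/-- The state after rounds `1, …, n`. All sets are empty at the beginning (the initial values of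
`arm` are never used). -/
def run (p : Params) (tie : ℕ → Finset (Fin p.K) → Fin p.K)
    (x : ℕ → Fin p.K → Vec p.d) (r : ℕ → ℝ) : ℕ → State p.K
  | 0 => { arm := fun i => tie i Finset.univ, P := fun _ => ∅, E := fun _ => ∅ }
  | n + 1 => step p x r (run p tie x r n) (n + 1) tie

/-- The arm `a_t` chosen by the algorithm in round `t` on contexts `x` and rewards `r`. It depends
on `x_1, …, x_t` and `r_1, …, r_{t-1}` only. -/
def action (p : Params) (tie : ℕ → Finset (Fin p.K) → Fin p.K)
    (x : ℕ → Fin p.K → Vec p.d) (r : ℕ → ℝ) (t : ℕ) : Fin p.K :=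
  (run p tie x r t).arm t

/-- The regret `R_T = ∑_{t=1}^T [μ(max_a x_{t,a}ᵀ θ*) - μ(x_{t,a_t}ᵀ θ*)]`. -/
def regret (p : Params) (θstar : Vec p.d) (x : ℕ → Fin p.K → Vec p.d) (a : ℕ → Fin p.K) : ℝ :=
  ∑ t ∈ Finset.Icc 1 p.T,
    (Real.sigmoid (⨆ b, inner ℝ (x t b) θstar) - Real.sigmoid (inner ℝ (x t (a t)) θstar))

/-! ### The probabilistic environment -/

section Environment

variable {Ω : Type*}

/-- `σ(f_1, …, f_n)`. -/
abbrev sigmaUpTo {γ : Type*} [MeasurableSpace γ] (f : ℕ → Ω → γ) (n : ℕ) : MeasurableSpace Ω :=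
  ⨆ i ∈ Finset.Icc 1 n, MeasurableSpace.comap (f i) inferInstance

/-- `m₁` and `m₂` are conditionally independent given `m`. (Mathlib's
`ProbabilityTheory.CondIndep` says the same on standard Borel spaces.) -/
def CondIndepGiven (m m₁ m₂ : MeasurableSpace Ω) {mΩ : MeasurableSpace Ω} (Pr : Measure Ω) : Prop :=
  ∀ C D : Set Ω, MeasurableSet[m₁] C → MeasurableSet[m₂] D →
    Pr[(C ∩ D).indicator (fun _ => (1 : ℝ)) | m] =ᵐ[Pr]
      Pr[C.indicator (fun _ => (1 : ℝ)) | m] * Pr[D.indicator (fun _ => (1 : ℝ)) | m]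

variable (p : Params) (x : ℕ → Ω → Fin p.K → Vec p.d) (a : ℕ → Ω → Fin p.K) (r : ℕ → Ω → ℝ)

/-- `F_t = σ(X_1, a_1, …, X_t, a_t, r_1, …, r_{t-1})`. -/
abbrev history (t : ℕ) : MeasurableSpace Ω :=
  sigmaUpTo x t ⊔ sigmaUpTo a t ⊔ sigmaUpTo r (t - 1)

/-- Rewards are `{0,1}`-valued, and `r_t` is Bernoulli with mean `μ(x_{t,a_t}ᵀ θ*)` given `F_t`. -/
def BernoulliRewards [MeasurableSpace Ω] (Pr : Measure Ω) (θstar : Vec p.d) : Prop :=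
  (∀ t ω, r t ω = 0 ∨ r t ω = 1) ∧
  ∀ t ∈ Finset.Icc 1 p.T,
    Pr[r t | history p x a r t] =ᵐ[Pr]
      fun ω => Real.sigmoid (inner ℝ (x t ω (a t ω)) θstar)

/-- All feature vectors have norm at most one, and `‖θ*‖ ≤ B`. -/
def BoundedFeatures [MeasurableSpace Ω] (Pr : Measure Ω) (θstar : Vec p.d) : Prop :=
  (∀ᵐ ω ∂Pr, ∀ t ∈ Finset.Icc 1 p.T, ∀ b, ‖x t ω b‖ ≤ 1) ∧ θstar ∈ p.Θ

/-- `1/κ ≤ μ'(x_{t,b}ᵀ θ) ≤ L_μ` for all feature vectors and all `θ ∈ Θ`. -/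
def CurvatureBounds [MeasurableSpace Ω] (Pr : Measure Ω) : Prop :=
  ∀ᵐ ω ∂Pr, ∀ t ∈ Finset.Icc 1 p.T, ∀ b, ∀ θ ∈ p.Θ,
    1 / p.κ ≤ deriv Real.sigmoid (inner ℝ (x t ω b) θ) ∧
      deriv Real.sigmoid (inner ℝ (x t ω b) θ) ≤ p.Lμ

/-- The contexts are generated independently of past actions and rewards: for every `t`, the
context sequence `(X_1, …, X_T)` is independent of `(a_1, r_1, …, a_t, r_t)` given
`(X_1, …, X_t)`. -/
def ExogenousContexts [MeasurableSpace Ω] (Pr : Measure Ω) : Prop :=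
  ∀ t ∈ Finset.Icc 1 p.T,
    CondIndepGiven (sigmaUpTo x t) (sigmaUpTo x p.T) (sigmaUpTo a t ⊔ sigmaUpTo r t) Pr

end Environment

end SupSplitLog

end

/-! The proof has a probabilistic reduction, two concentration bounds and a deterministic regret
count.

Reduction. Because the contexts are exogenous, they can be frozen: given all of them, the rewards
run through a binary tree whose branching probabilities are `rewardProb`.
`Interaction.integral_eq_integral_treeExp` makes this exact, so the probability of large regret is
the average over contexts of a finite sum `treeExp`. It is then enough to bound the failure
probability by δ on the tree of each sequence in `Admissible`.

Pilot sets. Membership in P^(s) is predictable, so exp(2‖noise‖²_{V⁻¹}) times a determinant ratio is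
a supermartingale (`pilotSupermartingale_step`), and Ville's inequality bounds the noise for all
rounds at once. Strong monotonicity of the gradient turns this into the radius β for the pilot
estimator (`pilot_error_le`).

Estimation sets. The weights H⁻¹v of the one-step estimator use the final pilot estimate and the
final design, so they are not predictable. However, condition (a) and the resulting arm at level s
depend only on widths at level s and on scores of lower levels. Hence P^(s), E^(s), their features
and the pilot estimate are functions of the `observed` rewards: those of levels below s and of
P^(s). Conditionally on these, the rewards of E^(s) are independent Bernoulli variables
(`treeExp_prod_le_of_observed`), and Bernstein's inequality applies with frozen weights
(`treeExp_estNoise_le`).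

Deterministic part. On `NoiseBounds` the error of the one-step estimator consists of noise (α₁),
regularization (α₂) and a second-order Taylor remainder. By self-concordance the remainder is
governed by squared pilot errors on E^(s), which are at most τβ². The threshold τ is calibrated
against the elliptical-potential bound on |E^(s)| so that the remainder costs at most α/4; thus the
widths are valid confidence radii (`abs_score_sub_le`). The best arm then survives every elimination
up to level S, and an arm played at level s loses at most 8 L_μ 2⁻ˢ. The pilot sets give the first
term of the bound, Cauchy-Schwarz over the estimation sets the second, and rounds stopped by (b) the
third. Rounds reaching level S+1 are absorbed into the second term (`sum_card_run_E_le`). -/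

open MeasureTheory

noncomputable section

namespace SupSplitLog

/-! ### Linear algebra of positive definite quadratic forms. -/

open Matrix in
/-- Cauchy-Schwarz for the dual norms given by a positive definite matrix and its inverse. -/
theorem dotProduct_sq_le_of_posDef {ι : Type*} [Fintype ι] [DecidableEq ι] {V : Matrix ι ι ℝ}
    (hV : V.PosDef) (x y : ι → ℝ) :
    (x ⬝ᵥ y) ^ 2 ≤ (x ⬝ᵥ V⁻¹ *ᵥ x) * (y ⬝ᵥ V *ᵥ y) := by
  have hu : IsUnit V.det := (Matrix.isUnit_iff_isUnit_det _).1 hV.isUnit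
  have hVx : V *ᵥ (V⁻¹ *ᵥ x) = x := by
    rw [mulVec_mulVec, mul_nonsing_inv _ hu, one_mulVec]
  have hsymm : Vᵀ = V := by
    have h := hV.isHermitian
    rwa [IsHermitian, conjTranspose_eq_transpose_of_trivial] at h
  have hsymm' : ∀ u w : ι → ℝ, u ⬝ᵥ V *ᵥ w = w ⬝ᵥ V *ᵥ u := by
    intro u w
    rw [dotProduct_mulVec, ← mulVec_transpose, hsymm, dotProduct_comm]
  -- This polynomial is the form of `V` at V⁻¹x + t y. It is nonnegative for all t, so its
  -- discriminant is at most zero, which is the claim.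
  have hq : ∀ t : ℝ, 0 ≤ (y ⬝ᵥ V *ᵥ y) * (t * t) + (2 * (x ⬝ᵥ y)) * t + x ⬝ᵥ V⁻¹ *ᵥ x := by
    intro t
    have h := hV.posSemidef.dotProduct_mulVec_nonneg (V⁻¹ *ᵥ x + t • y)
    have e : star (V⁻¹ *ᵥ x + t • y) ⬝ᵥ V *ᵥ (V⁻¹ *ᵥ x + t • y) =
        (y ⬝ᵥ V *ᵥ y) * (t * t) + (2 * (x ⬝ᵥ y)) * t + x ⬝ᵥ V⁻¹ *ᵥ x := by
      simp only [star_trivial, mulVec_add, mulVec_smul, dotProduct_add, add_dotProduct,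
        smul_dotProduct, dotProduct_smul, hVx, smul_eq_mul]
      rw [hsymm' (V⁻¹ *ᵥ x) y, hVx, dotProduct_comm (V⁻¹ *ᵥ x) x, dotProduct_comm y x]
      ring
    rwa [e] at h
  have h := discrim_le_zero hq
  unfold discrim at h
  nlinarith

open Matrix in
theorem inv_quadForm_nonneg {ι : Type*} [Fintype ι] [DecidableEq ι] {V : Matrix ι ι ℝ}
    (hV : V.PosDef) (x : ι → ℝ) : 0 ≤ x ⬝ᵥ V⁻¹ *ᵥ x := by
  simpa using hV.inv.posSemidef.dotProduct_mulVec_nonneg x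

open Matrix in
theorem inv_quadForm_symm {ι : Type*} [Fintype ι] [DecidableEq ι] {V : Matrix ι ι ℝ}
    (hV : V.PosDef) (x y : ι → ℝ) : x ⬝ᵥ V⁻¹ *ᵥ y = y ⬝ᵥ V⁻¹ *ᵥ x := by
  have hsymm : (V⁻¹)ᵀ = V⁻¹ := by
    have h := hV.inv.isHermitian
    rwa [IsHermitian, conjTranspose_eq_transpose_of_trivial] at h
  rw [dotProduct_mulVec, ← mulVec_transpose, hsymm, dotProduct_comm]

open Matrix in
theorem mulVec_inv_mulVec {ι : Type*} [Fintype ι] [DecidableEq ι] {V : Matrix ι ι ℝ}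
    (hV : V.PosDef) (x : ι → ℝ) : V *ᵥ (V⁻¹ *ᵥ x) = x := by
  have hu : IsUnit V.det := (Matrix.isUnit_iff_isUnit_det _).1 hV.isUnit
  rw [mulVec_mulVec, mul_nonsing_inv _ hu, one_mulVec]

-- Inversion reverses the order V ≤ cW. Cauchy-Schwarz for V applied to x and W⁻¹x gives (xᵀW⁻¹x)² ≤
-- (xᵀV⁻¹x) · c (xᵀW⁻¹x), and one factor cancels unless it is zero.
open Matrix in
theorem inv_quadForm_le_of_le {ι : Type*} [Fintype ι] [DecidableEq ι] {V W : Matrix ι ι ℝ}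
    (hV : V.PosDef) (hW : W.PosDef) {c : ℝ} (hc : 0 ≤ c)
    (h : ∀ y : ι → ℝ, y ⬝ᵥ V *ᵥ y ≤ c * (y ⬝ᵥ W *ᵥ y)) (x : ι → ℝ) :
    x ⬝ᵥ W⁻¹ *ᵥ x ≤ c * (x ⬝ᵥ V⁻¹ *ᵥ x) := by
  have h1 := dotProduct_sq_le_of_posDef hV x (W⁻¹ *ᵥ x)
  have h2 := h (W⁻¹ *ᵥ x)
  rw [mulVec_inv_mulVec hW, dotProduct_comm (W⁻¹ *ᵥ x) x] at h2
  have ha := inv_quadForm_nonneg hV x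
  have hb := inv_quadForm_nonneg hW x
  rcases hb.eq_or_lt with h0 | h0
  · rw [← h0]; positivity
  · have h3 := mul_le_mul_of_nonneg_left h2 ha
    nlinarith

open Matrix in
theorem abs_dotProduct_le_sqrt_mul_sqrt {ι : Type*} [Fintype ι] [DecidableEq ι] {V : Matrix ι ι ℝ}
    (hV : V.PosDef) (x y : ι → ℝ) :
    |x ⬝ᵥ y| ≤ √(x ⬝ᵥ V⁻¹ *ᵥ x) * √(y ⬝ᵥ V *ᵥ y) := by
  rw [← Real.sqrt_mul (inv_quadForm_nonneg hV x)]
  exact Real.abs_le_sqrt (dotProduct_sq_le_of_posDef hV x y)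

open Matrix in
theorem det_add_vecMulVec_self {ι : Type*} [Fintype ι] [DecidableEq ι] {V : Matrix ι ι ℝ}
    (hV : V.PosDef) (z : ι → ℝ) :
    (V + vecMulVec z z).det = V.det * (1 + z ⬝ᵥ V⁻¹ *ᵥ z) := by
  have hu : IsUnit V.det := (Matrix.isUnit_iff_isUnit_det _).1 hV.isUnit
  rw [vecMulVec_eq Unit, det_add_replicateCol_mul_replicateRow hu]
  congr 1
  rw [Matrix.mul_assoc]
  simp [dotProduct, mulVec, Matrix.mul_apply]

open Matrix in
/-- The quadratic form of the inverse after a rank one update. -/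
theorem inv_quadForm_rankOne {ι : Type*} [Fintype ι] [DecidableEq ι] {V : Matrix ι ι ℝ}
    (hV : V.PosDef) (z s : ι → ℝ) (hV' : (V + vecMulVec z z).PosDef) (e : ℝ) :
    (s + e • z) ⬝ᵥ (V + vecMulVec z z)⁻¹ *ᵥ (s + e • z) =
      s ⬝ᵥ V⁻¹ *ᵥ s + (2 * e * (z ⬝ᵥ V⁻¹ *ᵥ s) + e ^ 2 * (z ⬝ᵥ V⁻¹ *ᵥ z) - (z ⬝ᵥ V⁻¹ *ᵥ s) ^ 2) /
        (1 + z ⬝ᵥ V⁻¹ *ᵥ z) := by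
  set q := z ⬝ᵥ V⁻¹ *ᵥ z with hq
  set b := z ⬝ᵥ V⁻¹ *ᵥ s with hb
  have hq0 : 0 ≤ q := inv_quadForm_nonneg hV z
  have hq1 : (1 + q) ≠ 0 := by positivity
  -- Sherman-Morrison: the preimage of s + ez is sought as V⁻¹s + k V⁻¹z, and comparing coefficients
  -- of z forces b + k(1 + q) = e.
  set k := (e - b) / (1 + q) with hk
  have hu : IsUnit (V + vecMulVec z z).det := (Matrix.isUnit_iff_isUnit_det _).1 hV'.isUnit
  have key : (V + vecMulVec z z)⁻¹ *ᵥ (s + e • z) = V⁻¹ *ᵥ s + k • (V⁻¹ *ᵥ z) := by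
    have h1 : (V + vecMulVec z z) *ᵥ (V⁻¹ *ᵥ s + k • (V⁻¹ *ᵥ z)) = s + e • z := by
      rw [mulVec_add, mulVec_smul, add_mulVec, add_mulVec, mulVec_inv_mulVec hV,
        mulVec_inv_mulVec hV, vecMulVec_mulVec, vecMulVec_mulVec, ← hb, ← hq]
      have : e = b + k * (1 + q) := by rw [hk]; field_simp; ring
      rw [this]
      ext i
      simp
      ring
    rw [← h1, mulVec_mulVec, nonsing_inv_mul _ hu, one_mulVec]
  rw [key]
  simp only [add_dotProduct, dotProduct_add, smul_dotProduct, dotProduct_smul, smul_eq_mul]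
  rw [inv_quadForm_symm hV s z, ← hb, ← hq, hk]
  field_simp
  ring

-- The AM-GM inequality for the eigenvalues, obtained from the tangent of log at their mean `m`.
open Matrix in
theorem log_det_le_card_mul_log_trace {ι : Type*} [Fintype ι] [DecidableEq ι] [Nonempty ι]
    {V : Matrix ι ι ℝ} (hV : V.PosDef) :
    Real.log V.det ≤ Fintype.card ι * Real.log (V.trace / Fintype.card ι) := by
  have hcard : (0 : ℝ) < Fintype.card ι := by exact_mod_cast Fintype.card_pos
  have htr : 0 < V.trace := hV.trace_pos
  set m := V.trace / Fintype.card ι with hm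
  have hm0 : 0 < m := by positivity
  have hdet : V.det = ∏ i, hV.isHermitian.eigenvalues i := by
    simpa using hV.isHermitian.det_eq_prod_eigenvalues
  have htrace : V.trace = ∑ i, hV.isHermitian.eigenvalues i := by
    simpa using hV.isHermitian.trace_eq_sum_eigenvalues
  rw [hdet, Real.log_prod (fun i _ => (hV.eigenvalues_pos i).ne')]
  have h1 : ∀ i, Real.log (hV.isHermitian.eigenvalues i) ≤
      Real.log m + (hV.isHermitian.eigenvalues i / m - 1) := by
    intro i
    have h := Real.log_le_sub_one_of_pos (div_pos (hV.eigenvalues_pos i) hm0)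
    rw [Real.log_div (hV.eigenvalues_pos i).ne' hm0.ne'] at h
    linarith
  refine (Finset.sum_le_sum fun i _ => h1 i).trans (le_of_eq ?_)
  rw [Finset.sum_add_distrib, Finset.sum_sub_distrib, ← Finset.sum_div, ← htrace]
  simp only [Finset.sum_const, Finset.card_univ, nsmul_eq_mul, mul_one]
  rw [hm]
  field_simp
  ring

/-! ### Design matrices and their dual norms. -/

section Design

variable {d : ℕ}

theorem inner_eq_dotProduct (x y : Vec d) : inner ℝ x y = x.ofLp ⬝ᵥ y.ofLp := by
  rw [EuclideanSpace.inner_eq_star_dotProduct, dotProduct_comm]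
  simp

open Matrix in
theorem quadForm_design (c : ℝ) (I : Finset ℕ) (w : ℕ → ℝ) (z : ℕ → Vec d) (y : Vec d) :
    y.ofLp ⬝ᵥ design c I w z *ᵥ y.ofLp = c * ‖y‖ ^ 2 + ∑ i ∈ I, w i * inner ℝ (z i) y ^ 2 := by
  have h1 : ‖y‖ ^ 2 = y.ofLp ⬝ᵥ y.ofLp := by
    rw [← inner_eq_dotProduct, real_inner_self_eq_norm_sq]
  unfold design
  rw [add_mulVec, dotProduct_add, smul_mulVec, one_mulVec, dotProduct_smul, h1, smul_eq_mul,
    sum_mulVec, dotProduct_sum]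
  congr 1
  refine Finset.sum_congr rfl fun i _ => ?_
  rw [smul_mulVec, vecMulVec_mulVec, dotProduct_smul, inner_eq_dotProduct]
  rw [op_smul_eq_smul, dotProduct_comm y.ofLp, smul_dotProduct, smul_eq_mul, smul_eq_mul, sq]

open Matrix in
theorem posDef_design {c : ℝ} (hc : 0 < c) (I : Finset ℕ) {w : ℕ → ℝ} (hw : ∀ i ∈ I, 0 ≤ w i)
    (z : ℕ → Vec d) : (design c I w z).PosDef := by
  apply Matrix.PosDef.of_dotProduct_mulVec_pos
  · unfold design
    refine IsHermitian.add ?_ ?_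
    · simp [IsHermitian]
    · refine isSelfAdjoint_sum _ fun i _ => ?_
      change (w i • vecMulVec (z i).ofLp (z i).ofLp)ᴴ = _
      simp
  · intro y hy
    have h := quadForm_design c I w z (WithLp.toLp 2 y)
    simp only at h
    rw [star_trivial, h]
    have : 0 < ‖(WithLp.toLp 2 y : Vec d)‖ := by
      rw [norm_pos_iff]
      simpa using hy
    have h2 : 0 ≤ ∑ i ∈ I, w i * inner ℝ (z i) (WithLp.toLp 2 y : Vec d) ^ 2 :=
      Finset.sum_nonneg fun i hi => mul_nonneg (hw i hi) (sq_nonneg _)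
    positivity

theorem design_congr {c : ℝ} {I : Finset ℕ} {w w' : ℕ → ℝ} {z z' : ℕ → Vec d}
    (hw : ∀ i ∈ I, w i = w' i) (hz : ∀ i ∈ I, z i = z' i) : design c I w z = design c I w' z' := by
  unfold design
  congr 1
  exact Finset.sum_congr rfl fun i hi => by rw [hw i hi, hz i hi]

open Matrix in
theorem trace_design (c : ℝ) (I : Finset ℕ) (z : ℕ → Vec d) :
    (design c I (fun _ => 1) z).trace = c * d + ∑ i ∈ I, ‖z i‖ ^ 2 := by
  unfold design
  rw [trace_add, trace_smul, trace_one, trace_sum]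
  simp only [one_smul, trace_vecMulVec, Fintype.card_fin, smul_eq_mul]
  congr 1
  exact Finset.sum_congr rfl fun i _ => by
    rw [← inner_eq_dotProduct, real_inner_self_eq_norm_sq]

theorem det_design_empty (c : ℝ) (w : ℕ → ℝ) (z : ℕ → Vec d) :
    (design c ∅ w z).det = c ^ d := by
  simp [design]

/-- With features of norm at most one the trace is at most cd + n. For c = κλ and n = T the right
side is `d * logTerm`, the total budget of the elliptical potential argument. -/
theorem log_det_design_le (hd : 1 ≤ d) {c : ℝ} (hc : 0 < c) {I : Finset ℕ} {z : ℕ → Vec d}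
    (hz : ∀ i ∈ I, ‖z i‖ ≤ 1) {n : ℕ} (hI : I.card ≤ n) :
    Real.log (design c I (fun _ => 1) z).det - Real.log (c ^ d) ≤
      d * Real.log (1 + n / (c * d)) := by
  have : Nonempty (Fin d) := ⟨⟨0, hd⟩⟩
  have hd' : (0 : ℝ) < d := by exact_mod_cast hd
  have h := log_det_le_card_mul_log_trace (posDef_design hc I (w := fun _ => 1) (by simp) z)
  rw [trace_design, Fintype.card_fin] at h
  have hs : ∑ i ∈ I, ‖z i‖ ^ 2 ≤ n := by
    calc ∑ i ∈ I, ‖z i‖ ^ 2 ≤ ∑ i ∈ I, (1 : ℝ) :=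
          Finset.sum_le_sum fun i hi => pow_le_one₀ (norm_nonneg _) (hz i hi)
      _ = I.card := by simp
      _ ≤ n := by exact_mod_cast hI
  have hs0 : 0 ≤ ∑ i ∈ I, ‖z i‖ ^ 2 := Finset.sum_nonneg fun i _ => sq_nonneg _
  have h2 : Real.log ((c * d + ∑ i ∈ I, ‖z i‖ ^ 2) / d) ≤
      Real.log c + Real.log (1 + n / (c * d)) := by
    rw [← Real.log_mul hc.ne' (by positivity)]
    apply Real.log_le_log (by positivity)
    rw [div_le_iff₀ hd']
    field_simp
    linarith
  rw [Real.log_pow]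
  nlinarith

open Matrix in
theorem invNormSq_nonneg_of_posDef {V : Matrix (Fin d) (Fin d) ℝ} (hV : V.PosDef) (v : Vec d) :
    0 ≤ invNormSq V v := inv_quadForm_nonneg hV _

theorem invNormSq_design_le_of_subset {c : ℝ} (hc : 0 < c) {I J : Finset ℕ} (hIJ : I ⊆ J)
    (z : ℕ → Vec d) (v : Vec d) :
    invNormSq (design c J (fun _ => 1) z) v ≤ invNormSq (design c I (fun _ => 1) z) v := by
  have h := inv_quadForm_le_of_le (posDef_design hc I (w := fun _ => 1) (by simp) z)
    (posDef_design hc J (w := fun _ => 1) (by simp) z) (c := 1) zero_le_one ?_ v.ofLp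
  · simpa [invNormSq] using h
  · intro y
    have h1 := quadForm_design c I (fun _ => 1) z (WithLp.toLp 2 y)
    have h2 := quadForm_design c J (fun _ => 1) z (WithLp.toLp 2 y)
    simp only at h1 h2
    rw [h1, h2, one_mul]
    gcongr

/-- Comparison with cI, the design of the empty set. For c = κλ ≥ 1 it keeps the squared dual norm
of a feature at most one, and it caps every width by α/√(κλ). -/
theorem invNormSq_design_le {c : ℝ} (hc : 0 < c) (I : Finset ℕ) (z : ℕ → Vec d) {w : ℕ → ℝ}
    (hw : ∀ i ∈ I, 0 ≤ w i) (v : Vec d) :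
    invNormSq (design c I w z) v ≤ ‖v‖ ^ 2 / c := by
  have h := inv_quadForm_le_of_le (posDef_design (d := d) hc ∅ (w := fun _ => 1) (by simp) z)
    (posDef_design hc I hw z) (c := 1) zero_le_one ?_ v.ofLp
  · have e : (design c ∅ (fun _ => 1) z)⁻¹ = c⁻¹ • (1 : Matrix (Fin d) (Fin d) ℝ) := by
      apply Matrix.inv_eq_left_inv
      simp [design, smul_smul, hc.ne']
    rw [e, Matrix.smul_mulVec, Matrix.one_mulVec, dotProduct_smul, one_mul, smul_eq_mul] at h
    rwa [div_eq_inv_mul, ← real_inner_self_eq_norm_sq, inner_eq_dotProduct]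
  · intro y
    have h1 := quadForm_design c ∅ (fun _ => 1) z (WithLp.toLp 2 y)
    have h2 := quadForm_design c I w z (WithLp.toLp 2 y)
    simp only at h1 h2
    rw [h1, h2, one_mul]
    have : 0 ≤ ∑ i ∈ I, w i * inner ℝ (z i) (WithLp.toLp 2 y : Vec d) ^ 2 :=
      Finset.sum_nonneg fun i hi => mul_nonneg (hw i hi) (sq_nonneg _)
    simpa using this

end Design

/-! ### Exponential moments of Bernoulli variables. -/

/-- Hoeffding's lemma for a centered Bernoulli variable. -/
theorem bernoulli_mgf_le {p : ℝ} (hp0 : 0 ≤ p) (hp1 : p ≤ 1) (t : ℝ) :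
    (1 - p) * Real.exp (t * (0 - p)) + p * Real.exp (t * (1 - p)) ≤ Real.exp (t ^ 2 / 8) := by
  -- A two-point probability space on which the general form of Hoeffding's lemma applies; an
  -- interval of length one has variance proxy 1/4.
  let ν : Measure Bool :=
    ENNReal.ofReal (1 - p) • Measure.dirac false + ENNReal.ofReal p • Measure.dirac true
  have hν : IsProbabilityMeasure ν := ⟨by
    simp only [ν, Measure.add_apply, Measure.smul_apply, measure_univ, smul_eq_mul, mul_one]
    rw [← ENNReal.ofReal_add (by linarith) hp0]
    simp⟩
  have hint : ∀ f : Bool → ℝ, ∫ b, f b ∂ν = (1 - p) * f false + p * f true := by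
    intro f
    have i1 : IsFiniteMeasure (ENNReal.ofReal (1 - p) • Measure.dirac false) :=
      Measure.smul_finite _ ENNReal.ofReal_ne_top
    have i2 : IsFiniteMeasure (ENNReal.ofReal p • Measure.dirac true) :=
      Measure.smul_finite _ ENNReal.ofReal_ne_top
    rw [integral_add_measure (Integrable.of_finite) (Integrable.of_finite),
      integral_smul_measure, integral_smul_measure, integral_dirac, integral_dirac,
      ENNReal.toReal_ofReal (by linarith), ENNReal.toReal_ofReal hp0]
    simp
  let X : Bool → ℝ := fun b => (if b then 1 else 0) - p
  have h := (ProbabilityTheory.hasSubgaussianMGF_of_mem_Icc_of_integral_eq_zero (μ := ν) (X := X)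
    (a := -p) (b := 1 - p) (Measurable.of_discrete.aemeasurable)
    (Filter.Eventually.of_forall fun b => by cases b <;> simp [X])
    (by rw [hint]; simp [X]; ring)).mgf_le t
  rw [ProbabilityTheory.mgf, hint] at h
  simp only [X] at h
  refine (le_of_eq (by simp)).trans (h.trans (le_of_eq ?_))
  congr 1
  simp
  ring

/-- One step of the self-normalized supermartingale: `q` is the squared dual norm of the new
feature and `b` its dual inner product with the current sum of noise terms. -/
theorem bernoulli_selfNormalized_step {p q : ℝ} (hp0 : 0 ≤ p) (hp1 : p ≤ 1) (hq : 0 ≤ q) (b : ℝ) :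
    (1 - p) * Real.exp (2 * ((2 * (0 - p) * b + (0 - p) ^ 2 * q - b ^ 2) / (1 + q))) +
      p * Real.exp (2 * ((2 * (1 - p) * b + (1 - p) ^ 2 * q - b ^ 2) / (1 + q))) ≤ 1 + q := by
  have h1q : (0 : ℝ) < 1 + q := by linarith
  -- For e ∈ {-p, 1-p} one has e² = (1-2p)e + p(1-p), so the exponent is the affine function C + te
  -- and Hoeffding's lemma applies.
  set t := (4 * b + 2 * q * (1 - 2 * p)) / (1 + q) with ht
  set C := (2 * q * (p * (1 - p)) - 2 * b ^ 2) / (1 + q) with hC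
  have e0 : 2 * ((2 * (0 - p) * b + (0 - p) ^ 2 * q - b ^ 2) / (1 + q)) = C + t * (0 - p) := by
    rw [hC, ht]; field_simp; ring
  have e1 : 2 * ((2 * (1 - p) * b + (1 - p) ^ 2 * q - b ^ 2) / (1 + q)) = C + t * (1 - p) := by
    rw [hC, ht]; field_simp; ring
  rw [e0, e1, Real.exp_add, Real.exp_add]
  -- After completing the square the left side is even at most q/(2(1+q)). The weaker bound suffices
  -- because the process is normalized by the full determinant ratio and not by its square root.
  have hle : C + t ^ 2 / 8 ≤ q / (1 + q) := by
    have : C + t ^ 2 / 8 = (q / 2 * (1 + q) - q / 2 * (2 * b - (1 - 2 * p)) ^ 2) / (1 + q) ^ 2 := by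
      rw [hC, ht]; field_simp; ring
    rw [this, div_le_div_iff₀ (by positivity) h1q]
    nlinarith [mul_nonneg hq (sq_nonneg (2 * b - (1 - 2 * p))), mul_nonneg hq h1q.le,
      mul_nonneg (mul_nonneg hq (sq_nonneg (2 * b - (1 - 2 * p)))) h1q.le,
      mul_nonneg (mul_nonneg hq h1q.le) h1q.le]
  have hexp : Real.exp (q / (1 + q)) ≤ 1 + q := by
    have h := Real.add_one_le_exp (-(q / (1 + q)))
    have h2 : -(q / (1 + q)) + 1 = (1 + q)⁻¹ := by field_simp; ring
    rw [h2, Real.exp_neg] at h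
    exact (inv_le_inv₀ h1q (Real.exp_pos _)).1 h
  calc (1 - p) * (Real.exp C * Real.exp (t * (0 - p))) + p * (Real.exp C * Real.exp (t * (1 - p)))
      = Real.exp C * ((1 - p) * Real.exp (t * (0 - p)) + p * Real.exp (t * (1 - p))) := by ring
    _ ≤ Real.exp C * Real.exp (t ^ 2 / 8) := by
        gcongr; exact bernoulli_mgf_le hp0 hp1 t
    _ = Real.exp (C + t ^ 2 / 8) := (Real.exp_add _ _).symm
    _ ≤ Real.exp (q / (1 + q)) := Real.exp_le_exp.2 hle
    _ ≤ 1 + q := hexp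

/-- The estimate (n+2)! ≥ 2·3ⁿ dominates the tail of the exponential series by a geometric series of
ratio m/3. This is the source of the 1/3 in Bernstein's inequality. -/
theorem exp_le_one_add_add_sq {y m : ℝ} (hy : |y| ≤ m) (hm : m < 3) :
    Real.exp y ≤ 1 + y + y ^ 2 / (2 * (1 - m / 3)) := by
  have hm0 : 0 ≤ m := (abs_nonneg y).trans hy
  have hs := (Real.summable_pow_div_factorial y)
  have h1 : Real.exp y = 1 + y + ∑' n : ℕ, y ^ (n + 2) / (n + 2).factorial := by
    rw [Real.exp_eq_exp_ℝ, NormedSpace.exp_eq_tsum_div]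
    have := hs.sum_add_tsum_nat_add 2
    simp only [Finset.sum_range_succ, Finset.sum_range_zero] at this
    refine (this.symm).trans ?_
    simp
  have hfac : ∀ n : ℕ, (2 : ℝ) * 3 ^ n ≤ (n + 2).factorial := by
    intro n
    induction n with
    | zero => norm_num
    | succ k ih =>
      have : ((k + 1 + 2).factorial : ℝ) = (k + 3) * (k + 2).factorial := by
        rw [show k + 1 + 2 = (k + 2) + 1 by ring, Nat.factorial_succ]
        push_cast
        ring
      rw [this, pow_succ]
      have hk : (0 : ℝ) ≤ k := Nat.cast_nonneg k
      have : (0 : ℝ) < 3 ^ k := by positivity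
      nlinarith
  have hg : HasSum (fun n : ℕ => y ^ 2 / 2 * (m / 3) ^ n) (y ^ 2 / 2 * (1 - m / 3)⁻¹) :=
    (hasSum_geometric_of_lt_one (by positivity) (by linarith)).mul_left _
  have h2 : ∑' n : ℕ, y ^ (n + 2) / (n + 2).factorial ≤ y ^ 2 / 2 * (1 - m / 3)⁻¹ := by
    rw [← hg.tsum_eq]
    refine Summable.tsum_le_tsum (fun n => ?_) ((summable_nat_add_iff 2).2 hs) hg.summable
    calc y ^ (n + 2) / (n + 2).factorial ≤ |y| ^ (n + 2) / (n + 2).factorial := by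
          refine div_le_div_of_nonneg_right ?_ (by positivity)
          rw [← abs_pow]
          exact le_abs_self _
      _ ≤ |y| ^ (n + 2) / (2 * 3 ^ n) := by
          gcongr
          exact hfac n
      _ = y ^ 2 / 2 * (|y| / 3) ^ n := by
          rw [pow_add, sq_abs, div_pow]
          field_simp
      _ ≤ y ^ 2 / 2 * (m / 3) ^ n := by gcongr
  rw [h1]
  have : y ^ 2 / (2 * (1 - m / 3)) = y ^ 2 / 2 * (1 - m / 3)⁻¹ := by
    rw [div_mul_eq_div_div, div_eq_mul_inv]
  linarith

/-- Bernstein's bound for the moment generating function of a centered Bernoulli variable. -/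
theorem bernoulli_bernstein_mgf {p c m : ℝ} (hp0 : 0 ≤ p) (hp1 : p ≤ 1) (hc : |c| ≤ m)
    (hm : m < 3) :
    (1 - p) * Real.exp (c * (0 - p)) + p * Real.exp (c * (1 - p)) ≤
      Real.exp (c ^ 2 * (p * (1 - p)) / (2 * (1 - m / 3))) := by
  have hb : ∀ b : ℝ, |b| ≤ 1 → |c * b| ≤ m := by
    intro b hb
    rw [abs_mul]
    nlinarith [abs_nonneg c, abs_nonneg b]
  have h0 := exp_le_one_add_add_sq (hb (0 - p) (by rw [abs_le]; constructor <;> linarith)) hm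
  have h1 := exp_le_one_add_add_sq (hb (1 - p) (by rw [abs_le]; constructor <;> linarith)) hm
  have hp1' : 0 ≤ 1 - p := by linarith
  have hm3 : 0 < 2 * (1 - m / 3) := by linarith
  calc _ ≤ (1 - p) * (1 + c * (0 - p) + (c * (0 - p)) ^ 2 / (2 * (1 - m / 3))) +
        p * (1 + c * (1 - p) + (c * (1 - p)) ^ 2 / (2 * (1 - m / 3))) := by gcongr
    _ = c ^ 2 * (p * (1 - p)) / (2 * (1 - m / 3)) + 1 := by field_simp; ring
    _ ≤ _ := Real.add_one_le_exp _

/-! ### The logistic function: monotonicity and self-concordance. -/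

theorem deriv_sigmoid_apply (u : ℝ) :
    deriv Real.sigmoid u = Real.sigmoid u * (1 - Real.sigmoid u) := by
  rw [Real.deriv_sigmoid]

theorem deriv_sigmoid_pos (u : ℝ) : 0 < deriv Real.sigmoid u := by
  rw [deriv_sigmoid_apply]
  exact mul_pos (Real.sigmoid_pos u) (by linarith [Real.sigmoid_lt_one u])

theorem deriv_sigmoid_le (u : ℝ) : deriv Real.sigmoid u ≤ 1 / 4 := by
  rw [deriv_sigmoid_apply]
  nlinarith [sq_nonneg (Real.sigmoid u - 1 / 2)]

theorem deriv_sigmoid_zero : deriv Real.sigmoid 0 = 1 / 4 := by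
  rw [deriv_sigmoid_apply, Real.sigmoid_zero]
  norm_num

/-- Self-concordance of the logistic function: the second-order remainder is controlled by the
derivative at the base point. -/
theorem abs_sigmoid_remainder_le {u v : ℝ} (h : |v - u| ≤ 1) :
    |Real.sigmoid v - Real.sigmoid u - deriv Real.sigmoid u * (v - u)| ≤
      deriv Real.sigmoid u * (v - u) ^ 2 := by
  set x := v - u with hx
  set w := Real.exp (-u) with hw
  set g := Real.exp x with hg
  have hw0 : 0 < w := Real.exp_pos _
  have hg0 : 0 < g := Real.exp_pos _
  have hu : Real.sigmoid u = 1 / (1 + w) := by rw [Real.sigmoid_def, one_div]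
  have hv : Real.sigmoid v = g / (g + w) := by
    rw [Real.sigmoid_def, show -v = -u - x by rw [hx]; ring, Real.exp_sub, ← hw, ← hg]
    field_simp
  have hd := deriv_sigmoid_pos u
  -- `ρ` is the exact quotient of μ(v) - μ(u) by μ'(u). It lies between 1 - e⁻ˣ and eˣ - 1, and both
  -- are within x² of x when |x| ≤ 1.
  set ρ := (g - 1) * (1 + w) / (g + w) with hρ
  have e : Real.sigmoid v - Real.sigmoid u - deriv Real.sigmoid u * x =
      deriv Real.sigmoid u * (ρ - x) := by
    have : Real.sigmoid v - Real.sigmoid u = deriv Real.sigmoid u * ρ := by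
      rw [deriv_sigmoid_apply, hu, hv, hρ]; field_simp; ring
    rw [this]; ring
  rw [e, abs_mul, abs_of_pos hd]
  gcongr
  have h1 : ρ ≤ g - 1 := by
    have : g - 1 - ρ = (g - 1) ^ 2 / (g + w) := by rw [hρ]; field_simp; ring
    have h2 : 0 ≤ (g - 1) ^ 2 / (g + w) := by positivity
    linarith
  have h2 : 1 - Real.exp (-x) ≤ ρ := by
    have : ρ - (1 - Real.exp (-x)) = (g - 1) ^ 2 * w / (g * (g + w)) := by
      rw [hρ, Real.exp_neg, ← hg]; field_simp; ring
    have h2 : 0 ≤ (g - 1) ^ 2 * w / (g * (g + w)) := by positivity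
    linarith
  have h3 := abs_le.1 (Real.abs_exp_sub_one_sub_id_le h)
  have h4 := abs_le.1 (Real.abs_exp_sub_one_sub_id_le (x := -x) (by rwa [abs_neg]))
  rw [abs_le]
  constructor
  · nlinarith [h4.2]
  · linarith [h3.2]

theorem sigmoid_sub_mul_sub_ge {u v m : ℝ}
    (hm : ∀ ξ ∈ Set.uIcc u v, m ≤ deriv Real.sigmoid ξ) :
    m * (v - u) ^ 2 ≤ (Real.sigmoid v - Real.sigmoid u) * (v - u) := by
  wlog huv : u ≤ v generalizing u v
  · have := this (u := v) (v := u) (by rwa [Set.uIcc_comm]) (le_of_not_ge huv)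
    nlinarith
  rw [Set.uIcc_of_le huv] at hm
  have h := (convex_Icc u v).mul_sub_le_image_sub_of_le_deriv
    (continuous_sigmoid.continuousOn) (differentiable_sigmoid.differentiableOn)
    (C := m) (fun ξ hξ => hm ξ (interior_subset hξ)) u (Set.left_mem_Icc.2 huv) v
    (Set.right_mem_Icc.2 huv) huv
  nlinarith

/-- Since μ' ≤ 1/4 everywhere, no curvature information about intermediate points is needed. -/
theorem sigmoid_sub_le {u v L : ℝ} (hL : 1 / 4 ≤ L) (huv : u ≤ v) :
    Real.sigmoid v - Real.sigmoid u ≤ L * (v - u) := by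
  exact (convex_univ).image_sub_le_mul_sub_of_deriv_le
    (continuous_sigmoid.continuousOn) (differentiable_sigmoid.differentiableOn)
    (C := L) (fun ξ _ => (deriv_sigmoid_le ξ).trans hL) u trivial v trivial huv

/-! ### Finite reward trees and maximal inequalities. -/

/-- Expectation over `{0,1}`-valued rewards `r_1, …, r_n` that are generated sequentially, where
`q i r` is the probability of `r_i = 1` given the past rewards. -/
def treeExp (q : ℕ → (ℕ → ℝ) → ℝ) : ℕ → ((ℕ → ℝ) → ℝ) → ℝ
  | 0, f => f 0
  | n + 1, f => treeExp q n fun r =>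
      (1 - q (n + 1) r) * f (Function.update r (n + 1) 0) +
        q (n + 1) r * f (Function.update r (n + 1) 1)

/-- Reward sequences with values in `{0,1}` that vanish outside of rounds `1, …, n`. -/
def RewardPath (n : ℕ) (r : ℕ → ℝ) : Prop :=
  ∀ i, r i = 0 ∨ (i ∈ Finset.Icc 1 n ∧ r i = 1)

theorem RewardPath.zero (n : ℕ) : RewardPath n 0 := fun _ => Or.inl rfl

theorem RewardPath.update {n : ℕ} {r : ℕ → ℝ} (hr : RewardPath n r) {b : ℝ}
    (hb : b = 0 ∨ b = 1) : RewardPath (n + 1) (Function.update r (n + 1) b) := by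
  intro i
  by_cases hi : i = n + 1
  · subst hi
    simpa using hb
  · rw [Function.update_of_ne hi]
    refine (hr i).imp_right fun h => ⟨?_, h.2⟩
    have := Finset.mem_Icc.1 h.1
    exact Finset.mem_Icc.2 ⟨this.1, by omega⟩

theorem RewardPath.eq_zero {n : ℕ} {r : ℕ → ℝ} (hr : RewardPath n r) {i : ℕ} (hi : n < i) :
    r i = 0 := by
  rcases hr i with h | h
  · exact h
  · have := Finset.mem_Icc.1 h.1
    omega

/-- Finiteness lets events and expectations be split over the values of a reward path; both the
decoupling and the passage from Ω to the tree use this. -/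
theorem finite_rewardPath (n : ℕ) : {r | RewardPath n r}.Finite := by
  have : {r : ℕ → ℝ | RewardPath n r} ⊆
      Set.range fun s : (Finset.Icc 1 n).powerset => fun i => if i ∈ s.1 then (1 : ℝ) else 0 := by
    classical
    intro r hr
    refine ⟨⟨(Finset.Icc 1 n).filter fun i => r i = 1, by simp⟩, ?_⟩
    funext i
    rcases hr i with h | h
    · simp [h]
    · simp only [Finset.mem_filter, h, if_true, and_self]
  exact (Set.finite_range _).subset this

variable {q : ℕ → (ℕ → ℝ) → ℝ}

theorem treeExp_add (n : ℕ) (f g : (ℕ → ℝ) → ℝ) :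
    treeExp q n (fun r => f r + g r) = treeExp q n f + treeExp q n g := by
  induction n generalizing f g with
  | zero => rfl
  | succ n ih =>
    simp only [treeExp]
    rw [← ih]
    congr 1
    funext r
    ring

theorem treeExp_const_mul (n : ℕ) (c : ℝ) (f : (ℕ → ℝ) → ℝ) :
    treeExp q n (fun r => c * f r) = c * treeExp q n f := by
  induction n generalizing f with
  | zero => rfl
  | succ n ih =>
    simp only [treeExp]
    rw [← ih]
    congr 1
    funext r
    ring

theorem treeExp_const (n : ℕ) (c : ℝ) : treeExp q n (fun _ => c) = c := by
  induction n with
  | zero => rfl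
  | succ n ih =>
    simp only [treeExp]
    conv_rhs => rw [← ih]
    congr 1
    funext r
    ring

theorem treeExp_sum {ι : Type*} (s : Finset ι) (n : ℕ) (f : ι → (ℕ → ℝ) → ℝ) :
    treeExp q n (fun r => ∑ i ∈ s, f i r) = ∑ i ∈ s, treeExp q n (f i) := by
  classical
  induction s using Finset.induction_on with
  | empty => simp [treeExp_const]
  | insert i s hi ih => simp only [Finset.sum_insert hi, treeExp_add, ih]

theorem treeExp_congr {n : ℕ} {f g : (ℕ → ℝ) → ℝ} (h : ∀ r, RewardPath n r → f r = g r) :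
    treeExp q n f = treeExp q n g := by
  induction n generalizing f g with
  | zero => exact h 0 (RewardPath.zero 0)
  | succ n ih =>
    simp only [treeExp]
    refine ih fun r hr => ?_
    rw [h _ (hr.update (Or.inl rfl)), h _ (hr.update (Or.inr rfl))]

theorem treeExp_mono (hq0 : ∀ n r, 0 ≤ q n r) (hq1 : ∀ n r, q n r ≤ 1) {n : ℕ}
    {f g : (ℕ → ℝ) → ℝ} (h : ∀ r, RewardPath n r → f r ≤ g r) :
    treeExp q n f ≤ treeExp q n g := by
  induction n generalizing f g with
  | zero => exact h 0 (RewardPath.zero 0)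
  | succ n ih =>
    simp only [treeExp]
    refine ih fun r hr => ?_
    have h0 := h _ (hr.update (Or.inl rfl))
    have h1 := h _ (hr.update (Or.inr rfl))
    have := hq0 (n + 1) r
    have := sub_nonneg.2 (hq1 (n + 1) r)
    gcongr

/-- A function of the first `n` rewards has the same expectation over longer sequences. -/
theorem treeExp_of_le {n m : ℕ} (hnm : n ≤ m) {f : (ℕ → ℝ) → ℝ}
    (hf : ∀ r k b, n < k → f (Function.update r k b) = f r) :
    treeExp q m f = treeExp q n f := by
  induction m, hnm using Nat.le_induction with
  | base => rfl
  | succ m hm ih =>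
    simp only [treeExp]
    rw [← ih]
    congr 1
    funext r
    rw [hf r (m + 1) 0 (by omega), hf r (m + 1) 1 (by omega)]
    ring

theorem treeExp_le_of_supermartingale (hq0 : ∀ n r, 0 ≤ q n r) (hq1 : ∀ n r, q n r ≤ 1)
    {Y : ℕ → (ℕ → ℝ) → ℝ} {n : ℕ}
    (hY : ∀ k < n, ∀ r, RewardPath k r →
      (1 - q (k + 1) r) * Y (k + 1) (Function.update r (k + 1) 0) +
        q (k + 1) r * Y (k + 1) (Function.update r (k + 1) 1) ≤ Y k r) :
    treeExp q n (Y n) ≤ Y 0 0 := by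
  induction n with
  | zero => exact le_rfl
  | succ n ih =>
    exact (treeExp_mono hq0 hq1 (hY n (Nat.lt_succ_self n))).trans
      (ih fun k hk => hY k (Nat.lt_succ_of_lt hk))

open Classical in
/-- Ville's maximal inequality. -/
theorem treeExp_maximal (hq0 : ∀ n r, 0 ≤ q n r) (hq1 : ∀ n r, q n r ≤ 1)
    {Y : ℕ → (ℕ → ℝ) → ℝ} {n : ℕ} (hpos : ∀ k r, 0 ≤ Y k r)
    (hdep : ∀ k r m b, k < m → Y k (Function.update r m b) = Y k r)
    (hY : ∀ k < n, ∀ r, RewardPath k r →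
      (1 - q (k + 1) r) * Y (k + 1) (Function.update r (k + 1) 0) +
        q (k + 1) r * Y (k + 1) (Function.update r (k + 1) 1) ≤ Y k r) {c : ℝ} (hc : 0 < c) :
    treeExp q n (fun r => if ∃ k ≤ n, c ≤ Y k r then 1 else 0) ≤ Y 0 0 / c := by
  -- `M` is `Y` frozen at the value c from its first visit to [c, ∞). Replacing the value at the
  -- visit by c only lowers it, so `M` remains a supermartingale, and it dominates c times the
  -- indicator of a visit.
  let M : ℕ → (ℕ → ℝ) → ℝ := fun k r => if ∃ j ≤ k, c ≤ Y j r then c else Y k r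
  have hM : treeExp q n (M n) ≤ M 0 0 := by
    apply treeExp_le_of_supermartingale hq0 hq1
    intro k hk r hr
    by_cases hex : ∃ j ≤ k, c ≤ Y j r
    · have h1 : ∀ b, M (k + 1) (Function.update r (k + 1) b) = c := by
        intro b
        obtain ⟨j, hj, hjc⟩ := hex
        have : ∃ j ≤ k + 1, c ≤ Y j (Function.update r (k + 1) b) :=
          ⟨j, by omega, by rwa [hdep j r (k + 1) b (by omega)]⟩
        simp only [M, if_pos this]
      rw [h1, h1]
      simp only [M, if_pos hex]
      linarith
    · have h1 : ∀ b, M (k + 1) (Function.update r (k + 1) b) ≤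
          Y (k + 1) (Function.update r (k + 1) b) := by
        intro b
        simp only [M]
        split_ifs with h
        · obtain ⟨j, hj, hjc⟩ := h
          rcases Nat.lt_or_ge k j with hkj | hkj
          · obtain rfl : j = k + 1 := by omega
            exact hjc
          · exact absurd ⟨j, hkj, by rwa [hdep j r (k + 1) b (by omega)] at hjc⟩ hex
        · exact le_rfl
      have h2 : M k r = Y k r := by simp only [M, if_neg hex]
      rw [h2]
      refine le_trans ?_ (hY k hk r hr)
      have := hq0 (k + 1) r
      have := sub_nonneg.2 (hq1 (k + 1) r)
      gcongr
      · exact h1 0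
      · exact h1 1
  have h0 : M 0 0 ≤ Y 0 0 := by
    simp only [M]
    split_ifs with h
    · obtain ⟨j, hj, hjc⟩ := h
      obtain rfl : j = 0 := by omega
      exact hjc
    · exact le_rfl
  rw [le_div_iff₀' hc, ← treeExp_const_mul]
  refine le_trans (treeExp_mono hq0 hq1 fun r _ => ?_) (hM.trans h0)
  simp only [M]
  split_ifs
  · simp
  · simpa using hpos n r

/-! ### Decoupling of estimation rewards from observed rewards. -/

/-- The sequence `h` with all entries after position `n` replaced by zero. -/
def trunc (n : ℕ) (h : ℕ → ℝ) : ℕ → ℝ := fun i => if i ≤ n then h i else 0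

/-- The sequence `r` with all entries outside of `I` replaced by zero. -/
def mask (I : Finset ℕ) (r : ℕ → ℝ) : ℕ → ℝ := fun i => if i ∈ I then r i else 0

theorem RewardPath.mask {n : ℕ} {r : ℕ → ℝ} (hr : RewardPath n r) (I : Finset ℕ) :
    RewardPath n (mask I r) := by
  intro i
  unfold SupSplitLog.mask
  split_ifs
  · exact hr i
  · exact Or.inl rfl

open Classical in
/-- Decoupling for a fixed value `h` of the observed rewards. The sets `obs n r` and `est n r` of
observed and of estimation rounds are built sequentially and depend on observed rewards only. Given
the observed rewards, the rewards of the estimation rounds behave like independent ones. -/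
theorem treeExp_prod_le_of_observed (hq0 : ∀ n r, 0 ≤ q n r) (hq1 : ∀ n r, q n r ≤ 1)
    {obs est : ℕ → (ℕ → ℝ) → Finset ℕ} {o e : ℕ → (ℕ → ℝ) → Prop}
    (hobs0 : ∀ r, obs 0 r = ∅) (hest0 : ∀ r, est 0 r = ∅)
    (hobs : ∀ n r b, obs (n + 1) (Function.update r (n + 1) b) =
      if o n r then insert (n + 1) (obs n r) else obs n r)
    (hest : ∀ n r b, est (n + 1) (Function.update r (n + 1) b) =
      if e n r then insert (n + 1) (est n r) else est n r)
    (hobsI : ∀ n r, obs n r ⊆ Finset.Icc 1 n) (hestI : ∀ n r, est n r ⊆ Finset.Icc 1 n)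
    (hoe : ∀ n r, o n r → ¬ e n r)
    (ho : ∀ n r, o n (mask (obs n r) r) ↔ o n r)
    (he : ∀ n r, e n (mask (obs n r) r) ↔ e n r)
    (hq : ∀ n r, o n r ∨ e n r → q (n + 1) (mask (obs n r) r) = q (n + 1) r)
    (φ : ℕ → ℝ → ℝ) (hφ : ∀ i b, 0 ≤ φ i b) (N : ℕ) (h : ℕ → ℝ) (hh : RewardPath N h)
    (hmean : ∀ k < N, e k (trunc k h) →
      (1 - q (k + 1) (trunc k h)) * φ (k + 1) 0 + q (k + 1) (trunc k h) * φ (k + 1) 1 ≤ 1) :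
    treeExp q N (fun r => if mask (obs N r) r = h then ∏ i ∈ est N r, φ i (r i) else 0) ≤
      treeExp q N (fun r => if mask (obs N r) r = h then 1 else 0) := by
  induction N generalizing h with
  | zero => simp [treeExp, hobs0, hest0]
  | succ n ih =>
    -- `h'` is the part of `h` belonging to the first n rounds; the induction hypothesis is applied
    -- to it.
    set h' := Function.update h (n + 1) 0 with hh'
    have htr : trunc n h = h' := by
      funext i
      unfold trunc
      by_cases hi : i = n + 1
      · subst hi; simp [h']
      · rw [hh', Function.update_of_ne hi]
        split_ifs with h2
        · rfl
        · exact (hh.eq_zero (by omega)).symm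
    have hpath : RewardPath n h' := by
      intro i
      rw [← htr]
      unfold trunc
      split_ifs with h2
      · refine (hh i).imp_right fun h3 => ⟨?_, h3.2⟩
        have := Finset.mem_Icc.1 h3.1
        exact Finset.mem_Icc.2 ⟨this.1, h2⟩
      · exact Or.inl rfl
    have htr' : ∀ k < n, trunc k h' = trunc k h := by
      intro k hk
      funext i
      unfold trunc
      split_ifs with h2
      · rw [hh', Function.update_of_ne (by omega)]
      · rfl
    have IH := ih h' hpath fun k hk hek => by
      rw [htr' k hk] at hek ⊢
      exact hmean k (by omega) hek
    have hobs_nm : ∀ r, n + 1 ∉ obs n r := fun r hr => by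
      have := Finset.mem_Icc.1 (hobsI n r hr); omega
    have hest_nm : ∀ r, n + 1 ∉ est n r := fun r hr => by
      have := Finset.mem_Icc.1 (hestI n r hr); omega
    have hmask : ∀ r b, RewardPath n r →
        mask (obs (n + 1) (Function.update r (n + 1) b)) (Function.update r (n + 1) b) =
          if o n r then Function.update (mask (obs n r) r) (n + 1) b else mask (obs n r) r := by
      intro r b hr
      rw [hobs]
      funext i
      by_cases hi : i = n + 1
      · subst hi
        split_ifs with h2
        · simp [mask]
        · simp [mask, hobs_nm r]
      · split_ifs with h2
        · simp [mask, hi]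
        · simp [mask, Function.update_of_ne hi]
    have hmask0 : ∀ r, mask (obs n r) r (n + 1) = 0 := fun r => by simp [mask, hobs_nm r]
    -- The event for `h` is the event for `h'` together with a condition on the new reward alone: it
    -- equals h(n+1) if it is observed, and otherwise h(n+1) must be zero.
    have hiff : ∀ r b, RewardPath n r →
        (mask (obs (n + 1) (Function.update r (n + 1) b)) (Function.update r (n + 1) b) = h ↔
          mask (obs n r) r = h' ∧ h (n + 1) = if o n h' then b else 0) := by
      intro r b hr
      rw [hmask r b hr]
      constructor
      · intro H
        have h1 : mask (obs n r) r = h' := by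
          funext i
          by_cases hi : i = n + 1
          · subst hi; rw [hmask0]; simp [h']
          · rw [hh', Function.update_of_ne hi, ← H]
            split_ifs
            · rw [Function.update_of_ne hi]
            · rfl
        refine ⟨h1, ?_⟩
        rw [← h1, if_congr (ho n r) rfl rfl, ← H]
        split_ifs
        · simp
        · exact hmask0 r
      · rintro ⟨h1, h2⟩
        rw [← h1, if_congr (ho n r) rfl rfl] at h2
        split_ifs at h2 ⊢ with h3
        · rw [h1, hh', ← h2]; simp
        · rw [h1, hh', ← h2]; simp
    have hprod : ∀ r b, ∏ i ∈ est (n + 1) (Function.update r (n + 1) b),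
        φ i (Function.update r (n + 1) b i) =
          (if e n r then φ (n + 1) b else 1) * ∏ i ∈ est n r, φ i (r i) := by
      intro r b
      have h1 : ∏ i ∈ est n r, φ i (Function.update r (n + 1) b i) = ∏ i ∈ est n r, φ i (r i) := by
        refine Finset.prod_congr rfl fun i hi => ?_
        rw [Function.update_of_ne]
        rintro rfl
        exact hest_nm r hi
      rw [hest]
      split_ifs with h2
      · rw [Finset.prod_insert (hest_nm r), h1, Function.update_self]
      · rw [h1, one_mul]
    -- The conditional expectations given the first `n` rewards.
    let KA : ℝ := (1 - q (n + 1) h') *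
        (if h (n + 1) = (if o n h' then 0 else 0) then (if e n h' then φ (n + 1) 0 else 1) else 0) +
      q (n + 1) h' *
        (if h (n + 1) = (if o n h' then 1 else 0) then (if e n h' then φ (n + 1) 1 else 1) else 0)
    let KB : ℝ := (1 - q (n + 1) h') * (if h (n + 1) = (if o n h' then 0 else 0) then 1 else 0) +
      q (n + 1) h' * (if h (n + 1) = (if o n h' then 1 else 0) then 1 else 0)
    have hq0' := hq0 (n + 1) h'
    have hq1' := sub_nonneg.2 (hq1 (n + 1) h')
    have hKA : 0 ≤ KA := by
      refine add_nonneg (mul_nonneg hq1' ?_) (mul_nonneg hq0' ?_) <;>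
      · split_ifs <;> first | exact le_rfl | exact hφ _ _ | exact zero_le_one
    -- In an estimation round the new reward is unobserved, so both outcomes carry the same
    -- indicator and `hmean` bounds the weighted sum. In any other round there is no new factor and
    -- the two sides coincide.
    have hKAB : KA ≤ KB := by
      simp only [KA, KB]
      by_cases hE : e n h'
      · have hO : ¬ o n h' := fun hO => hoe n h' hO hE
        have hm := hmean n (Nat.lt_succ_self n)
        rw [htr] at hm
        have hm := hm hE
        simp only [hE, hO, if_true, if_false]
        split_ifs
        · linarith
        · simp
      · simp only [hE, if_false]
        exact le_rfl
    have eA : treeExp q (n + 1)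
        (fun r => if mask (obs (n + 1) r) r = h then ∏ i ∈ est (n + 1) r, φ i (r i) else 0) =
        KA * treeExp q n
          (fun r => if mask (obs n r) r = h' then ∏ i ∈ est n r, φ i (r i) else 0) := by
      rw [← treeExp_const_mul]
      simp only [treeExp]
      refine treeExp_congr fun r hr => ?_
      rw [hprod, hprod, if_congr (hiff r 0 hr) rfl rfl, if_congr (hiff r 1 hr) rfl rfl]
      by_cases hm : mask (obs n r) r = h'
      · have hEq : e n r ↔ e n h' := by rw [← hm]; exact (he n r).symm
        have hOq : o n r ↔ o n h' := by rw [← hm]; exact (ho n r).symm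
        simp only [hm, true_and, if_true, if_congr hEq rfl rfl, KA]
        by_cases hcase : o n r ∨ e n r
        · have : q (n + 1) r = q (n + 1) h' := by rw [← hm]; exact (hq n r hcase).symm
          rw [this]
          split_ifs <;> ring
        -- In a round that is neither observed nor used for estimation, the branching probability
        -- may depend on unobserved rewards. The integrand ignores the new reward, so the two
        -- weights simply add up to one.
        · push Not at hcase
          have h1 : ¬ o n h' := fun h1 => hcase.1 (hOq.2 h1)
          have h2 : ¬ e n h' := fun h1 => hcase.2 (hEq.2 h1)
          simp only [h1, h2, if_false]
          split_ifs <;> ring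
      · simp [hm]
    have eB : treeExp q (n + 1) (fun r => if mask (obs (n + 1) r) r = h then 1 else 0) =
        KB * treeExp q n (fun r => if mask (obs n r) r = h' then 1 else 0) := by
      rw [← treeExp_const_mul]
      simp only [treeExp]
      refine treeExp_congr fun r hr => ?_
      rw [if_congr (hiff r 0 hr) rfl rfl, if_congr (hiff r 1 hr) rfl rfl]
      by_cases hm : mask (obs n r) r = h'
      · have hOq : o n r ↔ o n h' := by rw [← hm]; exact (ho n r).symm
        simp only [hm, true_and, if_true, KB]
        by_cases hcase : o n r ∨ e n r
        · have : q (n + 1) r = q (n + 1) h' := by rw [← hm]; exact (hq n r hcase).symm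
          rw [this]
          split_ifs <;> ring
        · push Not at hcase
          have h1 : ¬ o n h' := fun h1 => hcase.1 (hOq.2 h1)
          simp only [h1, if_false]
          split_ifs <;> ring
      · simp [hm]
    rw [eA, eB]
    have hBn : 0 ≤ treeExp q n (fun r => if mask (obs n r) r = h' then (1 : ℝ) else 0) := by
      have := treeExp_mono (n := n) (f := fun _ => 0)
        (g := fun r => if mask (obs n r) r = h' then (1 : ℝ) else 0) hq0 hq1
        (fun r _ => by positivity)
      rwa [treeExp_const] at this
    exact (mul_le_mul_of_nonneg_left IH hKA).trans (mul_le_mul_of_nonneg_right hKAB hBn)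

/-- Decoupling: exponential moments of the estimation rewards, with coefficients that depend on
the observed rewards. -/
theorem treeExp_prod_le_one (hq0 : ∀ n r, 0 ≤ q n r) (hq1 : ∀ n r, q n r ≤ 1)
    {obs est : ℕ → (ℕ → ℝ) → Finset ℕ} {o e : ℕ → (ℕ → ℝ) → Prop}
    (hobs0 : ∀ r, obs 0 r = ∅) (hest0 : ∀ r, est 0 r = ∅)
    (hobs : ∀ n r b, (o n r → obs (n + 1) (Function.update r (n + 1) b) = insert (n + 1) (obs n r)) ∧
      (¬ o n r → obs (n + 1) (Function.update r (n + 1) b) = obs n r))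
    (hest : ∀ n r b, (e n r → est (n + 1) (Function.update r (n + 1) b) = insert (n + 1) (est n r)) ∧
      (¬ e n r → est (n + 1) (Function.update r (n + 1) b) = est n r))
    (hobsI : ∀ n r, obs n r ⊆ Finset.Icc 1 n) (hestI : ∀ n r, est n r ⊆ Finset.Icc 1 n)
    (hoe : ∀ n r, o n r → ¬ e n r)
    (ho : ∀ n r, o n (mask (obs n r) r) ↔ o n r)
    (he : ∀ n r, e n (mask (obs n r) r) ↔ e n r)
    (hq : ∀ n r, o n r ∨ e n r → q (n + 1) (mask (obs n r) r) = q (n + 1) r)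
    (φ : (ℕ → ℝ) → ℕ → ℝ → ℝ) (hφ : ∀ h i b, 0 ≤ φ h i b) (N : ℕ)
    (hmean : ∀ h, RewardPath N h → ∀ k < N, e k (trunc k h) →
      (1 - q (k + 1) (trunc k h)) * φ h (k + 1) 0 + q (k + 1) (trunc k h) * φ h (k + 1) 1 ≤ 1) :
    treeExp q N (fun r => ∏ i ∈ est N r, φ (mask (obs N r) r) i (r i)) ≤ 1 := by
  classical
  -- On each piece where the observed rewards equal a fixed `h`, the factors `φ h` are
  -- deterministic. The probabilities of the pieces sum to one.
  let H := (finite_rewardPath N).toFinset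
  have hH : ∀ r, RewardPath N r → mask (obs N r) r ∈ H := fun r hr => by
    simpa [H] using hr.mask _
  have h1 : treeExp q N (fun r => ∏ i ∈ est N r, φ (mask (obs N r) r) i (r i)) =
      ∑ h ∈ H, treeExp q N
        (fun r => if mask (obs N r) r = h then ∏ i ∈ est N r, φ h i (r i) else 0) := by
    rw [← treeExp_sum]
    refine treeExp_congr fun r hr => ?_
    rw [Finset.sum_ite_eq, if_pos (hH r hr)]
  have h2 : (1 : ℝ) = ∑ h ∈ H, treeExp q N
        (fun r => if mask (obs N r) r = h then 1 else 0) := by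
    rw [← treeExp_sum]
    refine (treeExp_const (q := q) N 1).symm.trans (treeExp_congr fun r hr => ?_)
    rw [Finset.sum_ite_eq, if_pos (hH r hr)]
  rw [h1, h2]
  refine Finset.sum_le_sum fun h hh => ?_
  have hpath : RewardPath N h := by simpa [H] using hh
  exact treeExp_prod_le_of_observed hq0 hq1 hobs0 hest0
    (fun n r b => by split_ifs with h3 <;> [exact (hobs n r b).1 h3; exact (hobs n r b).2 h3])
    (fun n r b => by split_ifs with h3 <;> [exact (hest n r b).1 h3; exact (hest n r b).2 h3])
    hobsI hestI hoe ho he hq (φ h) (hφ h) N h hpath (hmean h hpath)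

/-! ### Which rewards the algorithm's decisions depend on. -/

section Congr

variable {d : ℕ}

theorem logisticLoss_congr (lam : ℝ) {I : Finset ℕ} {z z' : ℕ → Vec d} {r r' : ℕ → ℝ}
    (hz : ∀ i ∈ I, z i = z' i) (hr : ∀ i ∈ I, r i = r' i) :
    logisticLoss lam I z r = logisticLoss lam I z' r' := by
  funext θ
  unfold logisticLoss
  congr 1
  exact Finset.sum_congr rfl fun i hi => by rw [hz i hi, hr i hi]

theorem pilot_congr (p : Params) {I : Finset ℕ} {z z' : ℕ → Vec p.d} {r r' : ℕ → ℝ}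
    (hz : ∀ i ∈ I, z i = z' i) (hr : ∀ i ∈ I, r i = r' i) :
    pilot p I z r = pilot p I z' r' := by
  unfold pilot
  rw [logisticLoss_congr p.lam hz hr]

theorem grad_congr (lam : ℝ) {I : Finset ℕ} {z z' : ℕ → Vec d} {r r' : ℕ → ℝ}
    (hz : ∀ i ∈ I, z i = z' i) (hr : ∀ i ∈ I, r i = r' i) (θ : Vec d) :
    grad lam I z r θ = grad lam I z' r' θ := by
  unfold grad
  congr 1
  exact Finset.sum_congr rfl fun i hi => by rw [hz i hi, hr i hi]

theorem hess_congr (lam : ℝ) {I : Finset ℕ} {z z' : ℕ → Vec d}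
    (hz : ∀ i ∈ I, z i = z' i) (θ : Vec d) : hess lam I z θ = hess lam I z' θ :=
  design_congr (fun i hi => by rw [hz i hi]) hz

theorem oneStep_congr (p : Params) {IP IE : Finset ℕ} {z z' : ℕ → Vec p.d} {r r' : ℕ → ℝ}
    (hzP : ∀ i ∈ IP, z i = z' i) (hzE : ∀ i ∈ IE, z i = z' i)
    (hrP : ∀ i ∈ IP, r i = r' i) (hrE : ∀ i ∈ IE, r i = r' i) :
    oneStep p IP IE z r = oneStep p IP IE z' r' := by
  unfold oneStep
  rw [pilot_congr p hzP hrP, hess_congr p.lam hzE, grad_congr p.lam hzE hrE]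

end Congr

section Round

variable (p : Params) (x : ℕ → Fin p.K → Vec p.d) (r : ℕ → ℝ) (σ : State p.K) (t : ℕ)
  (tie : ℕ → Finset (Fin p.K) → Fin p.K)

/-- The round stops by condition (a) at level `s` and is added to the pilot set. -/
def AddsP (s : ℕ) : Prop :=
  stopLevel p x r σ t = s ∧ condA p x r σ t s ∧
    p.τ s < invNormSq (VP p x σ s) (x t (choice p x r σ t tie))

/-- The round stops by condition (a) at level `s` and is added to the estimation set. -/
def AddsE (s : ℕ) : Prop :=
  stopLevel p x r σ t = s ∧ condA p x r σ t s ∧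
    ¬ p.τ s < invNormSq (VP p x σ s) (x t (choice p x r σ t tie))

variable {p x r σ t tie}

theorem step_arm : (step p x r σ t tie).arm =
    Function.update σ.arm t (choice p x r σ t tie) := by
  unfold step
  simp only
  split_ifs <;> rfl

theorem step_P_of_adds {s : ℕ} (h : AddsP p x r σ t tie s) :
    (step p x r σ t tie).P s = insert t (σ.P s) := by
  obtain ⟨rfl, h2, h3⟩ := h
  unfold step
  simp only [if_pos h2, if_pos h3, Function.update_self]

theorem step_E_of_adds {s : ℕ} (h : AddsE p x r σ t tie s) :
    (step p x r σ t tie).E s = insert t (σ.E s) := by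
  obtain ⟨rfl, h2, h3⟩ := h
  unfold step
  simp only [if_pos h2, if_neg h3, Function.update_self]

theorem step_P_of_not_adds {s : ℕ} (h : ¬ AddsP p x r σ t tie s) :
    (step p x r σ t tie).P s = σ.P s := by
  unfold step
  simp only
  split_ifs with h1 h2
  · by_cases hs : s = stopLevel p x r σ t
    · exact absurd ⟨hs.symm, hs ▸ h1, hs ▸ h2⟩ h
    · simp only [Function.update_of_ne hs]
  · rfl
  · rfl

theorem step_E_of_not_adds {s : ℕ} (h : ¬ AddsE p x r σ t tie s) :
    (step p x r σ t tie).E s = σ.E s := by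
  unfold step
  simp only
  split_ifs with h1 h2
  · rfl
  · by_cases hs : s = stopLevel p x r σ t
    · exact absurd ⟨hs.symm, hs ▸ h1, hs ▸ h2⟩ h
    · simp only [Function.update_of_ne hs]
  · rfl

theorem stopLevel_eq_iff (hT : 1 ≤ p.T) {s : ℕ} :
    stopLevel p x r σ t = s ↔ 1 ≤ s ∧ (condA p x r σ t s ∨ condB p x r σ t s) ∧
      ∀ j < s, 1 ≤ j → ¬ (condA p x r σ t j ∨ condB p x r σ t j) := by
  have hne := exists_stopLevel p x r σ t hT
  constructor
  · rintro rfl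
    have h := Nat.sInf_mem hne
    exact ⟨h.1, h.2, fun j hj h1 h2 => Nat.notMem_of_lt_sInf hj ⟨h1, h2⟩⟩
  · rintro ⟨h1, h2, h3⟩
    apply le_antisymm
    · exact Nat.sInf_le ⟨h1, h2⟩
    · by_contra hlt
      have h := Nat.sInf_mem hne
      exact h3 _ (not_le.1 hlt) h.1 h.2

theorem active_congr {r' : ℕ → ℝ} {σ' : State p.K} {s : ℕ}
    (h : ∀ j < s, ∀ a, score p x r σ t j a = score p x r' σ' t j a) :
    active p x r σ t s = active p x r' σ' t s := by
  induction s with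
  | zero => rfl
  | succ s ih =>
    match s with
    | 0 => rfl
    | s + 1 =>
      have ih' := ih fun j hj => h j (by omega)
      have h' := h (s + 1) (by omega)
      simp only [active, ih', h']

theorem active_nonempty (hK : 1 ≤ p.K) (s : ℕ) : (active p x r σ t s).Nonempty := by
  have huniv : (Finset.univ : Finset (Fin p.K)).Nonempty := ⟨⟨0, hK⟩, Finset.mem_univ _⟩
  induction s with
  | zero => exact huniv
  | succ s ih =>
    match s with
    | 0 => exact huniv
    | s + 1 =>
      obtain ⟨a, ha, hmax⟩ := Finset.exists_max_image _ (score p x r σ t (s + 1)) ih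
      refine ⟨a, ?_⟩
      simp only [active, Finset.mem_filter]
      refine ⟨ha, fun b hb => ?_⟩
      have := hmax b hb
      have : (0 : ℝ) ≤ 2 * (1 / 2) ^ (s + 1) := by positivity
      linarith

theorem argmaxSet_nonempty {K : ℕ} {A : Finset (Fin K)} (hA : A.Nonempty) (f : Fin K → ℝ) :
    (argmaxSet A f).Nonempty := by
  obtain ⟨a, ha, hmax⟩ := Finset.exists_max_image _ f hA
  exact ⟨a, by simpa [argmaxSet] using ⟨ha, hmax⟩⟩

theorem choice_spec_condA (hK : 1 ≤ p.K)
    (htie : ∀ t (A : Finset (Fin p.K)), A.Nonempty → tie t A ∈ A) {s : ℕ}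
    (hs : stopLevel p x r σ t = s) (hA : condA p x r σ t s) :
    choice p x r σ t tie ∈ active p x r σ t s ∧
      (1 / 2 : ℝ) ^ s < width p x σ t s (choice p x r σ t tie) := by
  subst hs
  have h := htie t _ (argmaxSet_nonempty (active_nonempty (x := x) (r := r) (σ := σ) (t := t) hK
    (stopLevel p x r σ t)) (width p x σ t (stopLevel p x r σ t)))
  unfold choice
  rw [if_pos hA]
  obtain ⟨a, ha, haw⟩ := hA
  have h' := Finset.mem_filter.1 h
  exact ⟨h'.1, haw.trans_le (h'.2 a ha)⟩

theorem choice_spec_not_condA (hK : 1 ≤ p.K)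
    (htie : ∀ t (A : Finset (Fin p.K)), A.Nonempty → tie t A ∈ A) {s : ℕ}
    (hs : stopLevel p x r σ t = s) (hA : ¬ condA p x r σ t s) :
    choice p x r σ t tie ∈ active p x r σ t s ∧
      ∀ b ∈ active p x r σ t s, score p x r σ t s b ≤ score p x r σ t s (choice p x r σ t tie) := by
  subst hs
  have h := htie t _ (argmaxSet_nonempty (active_nonempty (x := x) (r := r) (σ := σ) (t := t) hK
    (stopLevel p x r σ t)) (score p x r σ t (stopLevel p x r σ t)))
  unfold choice
  rw [if_neg hA]
  exact Finset.mem_filter.1 h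

/-- The two states have the same pilot and estimation sets up to level `s`, with the same arms. -/
def AgreeUpTo {K : ℕ} (s : ℕ) (σ σ' : State K) : Prop :=
  ∀ j ≤ s, σ.P j = σ'.P j ∧ σ.E j = σ'.E j ∧
    (∀ i ∈ σ.P j, σ.arm i = σ'.arm i) ∧ ∀ i ∈ σ.E j, σ.arm i = σ'.arm i

section Agree

variable {r' : ℕ → ℝ} {σ' : State p.K} {s : ℕ}

theorem score_congr {j : ℕ} (h : AgreeUpTo j σ σ') (hP : ∀ i ∈ σ.P j, r i = r' i)
    (hE : ∀ i ∈ σ.E j, r i = r' i) (a : Fin p.K) :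
    score p x r σ t j a = score p x r' σ' t j a := by
  obtain ⟨h1, h2, h3, h4⟩ := h j le_rfl
  unfold score
  rw [← h1, ← h2, oneStep_congr p (z' := chosen p x σ') (r' := r')
    (fun i hi => by unfold chosen; rw [h3 i hi]) (fun i hi => by unfold chosen; rw [h4 i hi]) hP hE]

theorem VE_congr {j : ℕ} (h : AgreeUpTo j σ σ') : VE p x σ j = VE p x σ' j := by
  obtain ⟨h1, h2, h3, h4⟩ := h j le_rfl
  unfold VE
  rw [← h2]
  exact design_congr (fun _ _ => rfl) fun i hi => by unfold chosen; rw [h4 i hi]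

theorem VP_congr {j : ℕ} (h : AgreeUpTo j σ σ') : VP p x σ j = VP p x σ' j := by
  obtain ⟨h1, h2, h3, h4⟩ := h j le_rfl
  unfold VP
  rw [← h1]
  exact design_congr (fun _ _ => rfl) fun i hi => by unfold chosen; rw [h3 i hi]

theorem AgreeUpTo.mono {K : ℕ} {s j : ℕ} {σ σ' : State K} (h : AgreeUpTo s σ σ') (hj : j ≤ s) :
    AgreeUpTo j σ σ' := fun i hi => h i (hi.trans hj)

theorem width_congr {j : ℕ} (h : AgreeUpTo j σ σ') (a : Fin p.K) :
    width p x σ t j a = width p x σ' t j a := by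
  unfold width
  rw [VE_congr h]

variable (h : AgreeUpTo s σ σ') (hP : ∀ j < s, ∀ i ∈ σ.P j, r i = r' i)
  (hE : ∀ j < s, ∀ i ∈ σ.E j, r i = r' i)

include h hP hE

/-- The candidates of level `j` come from eliminations at levels below `j`, so the rewards stored at
level `s` itself are not needed. -/
theorem active_agree {j : ℕ} (hj : j ≤ s) : active p x r σ t j = active p x r' σ' t j :=
  active_congr fun i hi a => score_congr (h.mono (by omega)) (hP i (by omega)) (hE i (by omega)) a

theorem condA_agree {j : ℕ} (hj : j ≤ s) : condA p x r σ t j ↔ condA p x r' σ' t j := by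
  unfold condA
  rw [active_agree h hP hE hj]
  simp only [width_congr (h.mono hj)]

theorem condB_agree {j : ℕ} (hj : j ≤ s) : condB p x r σ t j ↔ condB p x r' σ' t j := by
  unfold condB
  rw [active_agree h hP hE hj]
  simp only [width_congr (h.mono hj)]

theorem stopLevel_agree (hT : 1 ≤ p.T) {j : ℕ} (hj : j ≤ s) :
    stopLevel p x r σ t = j ↔ stopLevel p x r' σ' t = j := by
  rw [stopLevel_eq_iff hT, stopLevel_eq_iff hT, condA_agree h hP hE hj, condB_agree h hP hE hj]
  refine and_congr_right fun _ => and_congr_right fun _ => forall₂_congr fun i hi => ?_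
  rw [condA_agree h hP hE (by omega), condB_agree h hP hE (by omega)]

/-- Condition (a) is essential: the arm then maximizes the width, which involves features but no
rewards of its own level. Under (b) the arm would depend on the scores of level `j`. -/
theorem choice_agree (hT : 1 ≤ p.T) {j : ℕ} (hj : j ≤ s) (hs : stopLevel p x r σ t = j)
    (hA : condA p x r σ t j) : choice p x r σ t tie = choice p x r' σ' t tie := by
  have hs' := (stopLevel_agree h hP hE hT hj).1 hs
  have hA' := (condA_agree h hP hE hj).1 hA
  unfold choice
  rw [hs, hs', if_pos hA, if_pos hA', active_agree h hP hE hj]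
  congr 2
  funext a
  exact width_congr (h.mono hj) a

theorem addsP_agree (hT : 1 ≤ p.T) {j : ℕ} (hj : j ≤ s) :
    AddsP p x r σ t tie j ↔ AddsP p x r' σ' t tie j := by
  unfold AddsP
  rw [stopLevel_agree h hP hE hT hj, condA_agree h hP hE hj]
  refine and_congr_right fun h1 => and_congr_right fun h2 => ?_
  rw [VP_congr (h.mono hj), choice_agree h hP hE hT hj ((stopLevel_agree h hP hE hT hj).2 h1)
    ((condA_agree h hP hE hj).2 h2)]

theorem addsE_agree (hT : 1 ≤ p.T) {j : ℕ} (hj : j ≤ s) :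
    AddsE p x r σ t tie j ↔ AddsE p x r' σ' t tie j := by
  unfold AddsE
  rw [stopLevel_agree h hP hE hT hj, condA_agree h hP hE hj]
  refine and_congr_right fun h1 => and_congr_right fun h2 => ?_
  rw [VP_congr (h.mono hj), choice_agree h hP hE hT hj ((stopLevel_agree h hP hE hT hj).2 h1)
    ((condA_agree h hP hE hj).2 h2)]

theorem step_agree (hT : 1 ≤ p.T) (htP : ∀ j ≤ s, t ∉ σ.P j) (htE : ∀ j ≤ s, t ∉ σ.E j) :
    AgreeUpTo s (step p x r σ t tie) (step p x r' σ' t tie) := by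
  intro j hj
  obtain ⟨h1, h2, h3, h4⟩ := h j hj
  have harmP : ∀ i ∈ σ.P j, (step p x r σ t tie).arm i = (step p x r' σ' t tie).arm i := by
    intro i hi
    have : i ≠ t := fun hit => htP j hj (hit ▸ hi)
    rw [step_arm, step_arm, Function.update_of_ne this, Function.update_of_ne this, h3 i hi]
  have harmE : ∀ i ∈ σ.E j, (step p x r σ t tie).arm i = (step p x r' σ' t tie).arm i := by
    intro i hi
    have : i ≠ t := fun hit => htE j hj (hit ▸ hi)
    rw [step_arm, step_arm, Function.update_of_ne this, Function.update_of_ne this, h4 i hi]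
  -- The two runs may play different arms in a round that is not stored up to level `s`; agreement
  -- is required only for stored rounds.
  have harmt : stopLevel p x r σ t = j → condA p x r σ t j →
      (step p x r σ t tie).arm t = (step p x r' σ' t tie).arm t := by
    intro hs hA
    rw [step_arm, step_arm, Function.update_self, Function.update_self,
      choice_agree h hP hE hT hj hs hA]
  by_cases hp : AddsP p x r σ t tie j
  · have hp' := (addsP_agree h hP hE hT hj).1 hp
    have he : ¬ AddsE p x r σ t tie j := fun he => he.2.2 hp.2.2
    have he' : ¬ AddsE p x r' σ' t tie j := fun he => he.2.2 hp'.2.2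
    rw [step_P_of_adds hp, step_P_of_adds hp', step_E_of_not_adds he, step_E_of_not_adds he']
    refine ⟨by rw [h1], h2, fun i hi => ?_, harmE⟩
    rcases Finset.mem_insert.1 hi with rfl | hi
    · exact harmt hp.1 hp.2.1
    · exact harmP i hi
  · have hp' := fun h' => hp ((addsP_agree h hP hE hT hj).2 h')
    rw [step_P_of_not_adds hp, step_P_of_not_adds hp']
    by_cases he : AddsE p x r σ t tie j
    · have he' := (addsE_agree h hP hE hT hj).1 he
      rw [step_E_of_adds he, step_E_of_adds he']
      refine ⟨h1, by rw [h2], harmP, fun i hi => ?_⟩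
      rcases Finset.mem_insert.1 hi with rfl | hi
      · exact harmt he.1 he.2.1
      · exact harmE i hi
    · have he' := fun h' => he ((addsE_agree h hP hE hT hj).2 h')
      rw [step_E_of_not_adds he, step_E_of_not_adds he']
      exact ⟨h1, h2, harmP, harmE⟩

end Agree

theorem step_congr_rewards {r' : ℕ → ℝ} (hP : ∀ j, ∀ i ∈ σ.P j, r i = r' i)
    (hE : ∀ j, ∀ i ∈ σ.E j, r i = r' i) : step p x r σ t tie = step p x r' σ t tie := by
  have hsc : score p x r σ t = score p x r' σ t := by
    funext j a
    exact score_congr (fun i _ => ⟨rfl, rfl, fun _ _ => rfl, fun _ _ => rfl⟩) (hP j) (hE j) a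
  have hact : active p x r σ t = active p x r' σ t := by
    funext s
    exact active_congr fun j _ a => by rw [hsc]
  have hA : condA p x r σ t = condA p x r' σ t := by unfold condA; rw [hact]
  have hB : condB p x r σ t = condB p x r' σ t := by unfold condB; rw [hact]
  have hs : stopLevel p x r σ t = stopLevel p x r' σ t := by unfold stopLevel; rw [hA, hB]
  have hc : choice p x r σ t tie = choice p x r' σ t tie := by
    unfold choice; rw [hA, hs, hact, hsc]
  unfold step
  rw [hs, hA, hc]

end Round

section Run

variable {p : Params} {tie : ℕ → Finset (Fin p.K) → Fin p.K} {x : ℕ → Fin p.K → Vec p.d}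
  {r : ℕ → ℝ}

theorem run_P_subset (n s : ℕ) : (run p tie x r n).P s ⊆ Finset.Icc 1 n := by
  induction n with
  | zero => simp [run]
  | succ n ih =>
    have ih' : (run p tie x r n).P s ⊆ Finset.Icc 1 (n + 1) :=
      ih.trans (Finset.Icc_subset_Icc_right (by omega))
    rw [run]
    by_cases h : AddsP p x r (run p tie x r n) (n + 1) tie s
    · rw [step_P_of_adds h]
      exact Finset.insert_subset (by simp) ih'
    · rwa [step_P_of_not_adds h]

theorem run_E_subset (n s : ℕ) : (run p tie x r n).E s ⊆ Finset.Icc 1 n := by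
  induction n with
  | zero => simp [run]
  | succ n ih =>
    have ih' : (run p tie x r n).E s ⊆ Finset.Icc 1 (n + 1) :=
      ih.trans (Finset.Icc_subset_Icc_right (by omega))
    rw [run]
    by_cases h : AddsE p x r (run p tie x r n) (n + 1) tie s
    · rw [step_E_of_adds h]
      exact Finset.insert_subset (by simp) ih'
    · rwa [step_E_of_not_adds h]

theorem run_P_notMem (n s : ℕ) : n + 1 ∉ (run p tie x r n).P s := fun h => by
  have := Finset.mem_Icc.1 (run_P_subset n s h)
  omega

theorem run_E_notMem (n s : ℕ) : n + 1 ∉ (run p tie x r n).E s := fun h => by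
  have := Finset.mem_Icc.1 (run_E_subset n s h)
  omega

theorem run_P_mono {n m : ℕ} (hnm : n ≤ m) (s : ℕ) :
    (run p tie x r n).P s ⊆ (run p tie x r m).P s := by
  induction m, hnm using Nat.le_induction with
  | base => exact subset_rfl
  | succ m _ ih =>
    refine ih.trans ?_
    rw [run]
    by_cases h : AddsP p x r (run p tie x r m) (m + 1) tie s
    · rw [step_P_of_adds h]
      exact Finset.subset_insert _ _
    · rw [step_P_of_not_adds h]

theorem run_E_mono {n m : ℕ} (hnm : n ≤ m) (s : ℕ) :
    (run p tie x r n).E s ⊆ (run p tie x r m).E s := by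
  induction m, hnm using Nat.le_induction with
  | base => exact subset_rfl
  | succ m _ ih =>
    refine ih.trans ?_
    rw [run]
    by_cases h : AddsE p x r (run p tie x r m) (m + 1) tie s
    · rw [step_E_of_adds h]
      exact Finset.subset_insert _ _
    · rw [step_E_of_not_adds h]

theorem run_arm_of_le {n m i : ℕ} (hin : i ≤ n) (hnm : n ≤ m) :
    (run p tie x r m).arm i = (run p tie x r n).arm i := by
  induction m, hnm using Nat.le_induction with
  | base => rfl
  | succ m _ ih => rw [run, step_arm, Function.update_of_ne (by omega), ih]

/-- The shift by one matters: the state after round n+1 does not use the reward of round n+1, which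
is what makes the action predictable. -/
theorem run_congr_rewards {r' : ℕ → ℝ} {n : ℕ} (h : ∀ i ∈ Finset.Icc 1 n, r i = r' i) :
    run p tie x r (n + 1) = run p tie x r' (n + 1) := by
  induction n with
  | zero => exact step_congr_rewards (by simp [run]) (by simp [run])
  | succ n ih =>
    rw [run, ih fun i hi => h i (Finset.Icc_subset_Icc_right (by omega) hi)]
    conv_rhs => rw [run]
    exact step_congr_rewards (fun j i hi => h i (run_P_subset _ _ hi))
      (fun j i hi => h i (run_E_subset _ _ hi))

theorem run_congr_rewards' {r' : ℕ → ℝ} {n : ℕ} (h : ∀ i ∈ Finset.Icc 1 n, r i = r' i) :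
    run p tie x r n = run p tie x r' n := by
  cases n with
  | zero => rfl
  | succ n =>
    exact run_congr_rewards fun i hi => h i (Finset.Icc_subset_Icc_right (by omega) hi)

/-- The pilot and estimation sets up to level `s` depend on rewards of lower levels only. -/
theorem run_agree (hT : 1 ≤ p.T) {r' : ℕ → ℝ} {s n : ℕ}
    (hP : ∀ j < s, ∀ i ∈ (run p tie x r n).P j, r i = r' i)
    (hE : ∀ j < s, ∀ i ∈ (run p tie x r n).E j, r i = r' i) :
    AgreeUpTo s (run p tie x r n) (run p tie x r' n) := by
  induction n with
  | zero => exact fun j _ => ⟨rfl, rfl, by simp [run], by simp [run]⟩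
  | succ n ih =>
    have hP' : ∀ j < s, ∀ i ∈ (run p tie x r n).P j, r i = r' i :=
      fun j hj i hi => hP j hj i (run_P_mono (Nat.le_succ n) j hi)
    have hE' : ∀ j < s, ∀ i ∈ (run p tie x r n).E j, r i = r' i :=
      fun j hj i hi => hE j hj i (run_E_mono (Nat.le_succ n) j hi)
    rw [run]
    conv => arg 3; rw [run]
    exact step_agree (ih hP' hE') hP' hE' hT (fun j _ => run_P_notMem n j)
      (fun j _ => run_E_notMem n j)

end Run

/-! ### Self-normalized concentration for the pilot sets. -/

variable {p : Params} {tie : ℕ → Finset (Fin p.K) → Fin p.K} {x : ℕ → Fin p.K → Vec p.d}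

/-- The probability of a positive reward in round `n`, given the past rewards. -/
def rewardProb (p : Params) (tie : ℕ → Finset (Fin p.K) → Fin p.K) (x : ℕ → Fin p.K → Vec p.d)
    (θ : Vec p.d) (n : ℕ) (r : ℕ → ℝ) : ℝ :=
  Real.sigmoid (inner ℝ (x n (action p tie x r n)) θ)

theorem rewardProb_nonneg (θ : Vec p.d) (n : ℕ) (r : ℕ → ℝ) : 0 ≤ rewardProb p tie x θ n r :=
  Real.sigmoid_nonneg _

theorem rewardProb_le_one (θ : Vec p.d) (n : ℕ) (r : ℕ → ℝ) : rewardProb p tie x θ n r ≤ 1 :=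
  Real.sigmoid_le_one _

section Succ

variable {r : ℕ → ℝ} {n s : ℕ}

theorem chosen_run_succ_of_ne {i : ℕ} (hi : i ≠ n + 1) :
    chosen p x (run p tie x r (n + 1)) i = chosen p x (run p tie x r n) i := by
  unfold chosen
  rw [run, step_arm, Function.update_of_ne hi]

theorem chosen_run_self : chosen p x (run p tie x r n) n = x n (action p tie x r n) := rfl

/-- Stated for an arbitrary summand so that the same step serves the design matrix and the noise
vector. -/
theorem sum_run_P_succ_of_adds {M : Type*} [AddCommMonoid M]
    (h : AddsP p x r (run p tie x r n) (n + 1) tie s) (F : ℕ → Vec p.d → M) :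
    ∑ i ∈ (run p tie x r (n + 1)).P s, F i (chosen p x (run p tie x r (n + 1)) i) =
      F (n + 1) (x (n + 1) (action p tie x r (n + 1))) +
        ∑ i ∈ (run p tie x r n).P s, F i (chosen p x (run p tie x r n) i) := by
  have hP : (run p tie x r (n + 1)).P s = insert (n + 1) ((run p tie x r n).P s) := by
    rw [run, step_P_of_adds h]
  rw [hP, Finset.sum_insert (run_P_notMem n s), chosen_run_self]
  congr 1
  refine Finset.sum_congr rfl fun i hi => ?_
  rw [chosen_run_succ_of_ne]
  rintro rfl
  exact run_P_notMem n s hi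

theorem sum_run_E_succ_of_adds {M : Type*} [AddCommMonoid M]
    (h : AddsE p x r (run p tie x r n) (n + 1) tie s) (F : ℕ → Vec p.d → M) :
    ∑ i ∈ (run p tie x r (n + 1)).E s, F i (chosen p x (run p tie x r (n + 1)) i) =
      F (n + 1) (x (n + 1) (action p tie x r (n + 1))) +
        ∑ i ∈ (run p tie x r n).E s, F i (chosen p x (run p tie x r n) i) := by
  have hE : (run p tie x r (n + 1)).E s = insert (n + 1) ((run p tie x r n).E s) := by
    rw [run, step_E_of_adds h]
  rw [hE, Finset.sum_insert (run_E_notMem n s), chosen_run_self]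
  congr 1
  refine Finset.sum_congr rfl fun i hi => ?_
  rw [chosen_run_succ_of_ne]
  rintro rfl
  exact run_E_notMem n s hi

theorem sum_run_P_succ_of_not_adds {M : Type*} [AddCommMonoid M]
    (h : ¬ AddsP p x r (run p tie x r n) (n + 1) tie s) (F : ℕ → Vec p.d → M) :
    ∑ i ∈ (run p tie x r (n + 1)).P s, F i (chosen p x (run p tie x r (n + 1)) i) =
      ∑ i ∈ (run p tie x r n).P s, F i (chosen p x (run p tie x r n) i) := by
  have hP : (run p tie x r (n + 1)).P s = (run p tie x r n).P s := by
    rw [run, step_P_of_not_adds h]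
  rw [hP]
  refine Finset.sum_congr rfl fun i hi => ?_
  rw [chosen_run_succ_of_ne]
  rintro rfl
  exact run_P_notMem n s hi

theorem sum_run_E_succ_of_not_adds {M : Type*} [AddCommMonoid M]
    (h : ¬ AddsE p x r (run p tie x r n) (n + 1) tie s) (F : ℕ → Vec p.d → M) :
    ∑ i ∈ (run p tie x r (n + 1)).E s, F i (chosen p x (run p tie x r (n + 1)) i) =
      ∑ i ∈ (run p tie x r n).E s, F i (chosen p x (run p tie x r n) i) := by
  have hE : (run p tie x r (n + 1)).E s = (run p tie x r n).E s := by
    rw [run, step_E_of_not_adds h]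
  rw [hE]
  refine Finset.sum_congr rfl fun i hi => ?_
  rw [chosen_run_succ_of_ne]
  rintro rfl
  exact run_E_notMem n s hi

theorem VP_run_succ_of_adds (h : AddsP p x r (run p tie x r n) (n + 1) tie s) :
    VP p x (run p tie x r (n + 1)) s = VP p x (run p tie x r n) s +
      Matrix.vecMulVec (x (n + 1) (action p tie x r (n + 1))).ofLp
        (x (n + 1) (action p tie x r (n + 1))).ofLp := by
  unfold VP design
  rw [sum_run_P_succ_of_adds h (fun _ v => (1 : ℝ) • Matrix.vecMulVec v.ofLp v.ofLp), one_smul]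
  abel

theorem VE_run_succ_of_adds (h : AddsE p x r (run p tie x r n) (n + 1) tie s) :
    VE p x (run p tie x r (n + 1)) s = VE p x (run p tie x r n) s +
      Matrix.vecMulVec (x (n + 1) (action p tie x r (n + 1))).ofLp
        (x (n + 1) (action p tie x r (n + 1))).ofLp := by
  unfold VE design
  rw [sum_run_E_succ_of_adds h (fun _ v => (1 : ℝ) • Matrix.vecMulVec v.ofLp v.ofLp), one_smul]
  abel

theorem VP_run_succ_of_not_adds (h : ¬ AddsP p x r (run p tie x r n) (n + 1) tie s) :
    VP p x (run p tie x r (n + 1)) s = VP p x (run p tie x r n) s := by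
  unfold VP design
  rw [sum_run_P_succ_of_not_adds h (fun _ v => (1 : ℝ) • Matrix.vecMulVec v.ofLp v.ofLp)]

theorem VE_run_succ_of_not_adds (h : ¬ AddsE p x r (run p tie x r n) (n + 1) tie s) :
    VE p x (run p tie x r (n + 1)) s = VE p x (run p tie x r n) s := by
  unfold VE design
  rw [sum_run_E_succ_of_not_adds h (fun _ v => (1 : ℝ) • Matrix.vecMulVec v.ofLp v.ofLp)]

theorem posDef_VP (hc : 0 < p.κ * p.lam) (σ : State p.K) : (VP p x σ s).PosDef :=
  posDef_design hc _ (by simp) _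

theorem posDef_VE (hc : 0 < p.κ * p.lam) (σ : State p.K) : (VE p x σ s).PosDef :=
  posDef_design hc _ (by simp) _

theorem log_det_VP_run_le (hd : 1 ≤ p.d) (hc : 0 < p.κ * p.lam)
    (hx : ∀ t ∈ Finset.Icc 1 p.T, ∀ b, ‖x t b‖ ≤ 1) (hn : n ≤ p.T) :
    Real.log (VP p x (run p tie x r n) s).det - Real.log ((p.κ * p.lam) ^ p.d) ≤
      p.d * p.logTerm := by
  refine log_det_design_le hd hc (fun i hi => hx i ?_ _) ?_
  · exact Finset.Icc_subset_Icc_right hn (run_P_subset n s hi)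
  · exact (Finset.card_le_card (run_P_subset n s)).trans (by simpa using hn)

theorem log_det_VE_run_le (hd : 1 ≤ p.d) (hc : 0 < p.κ * p.lam)
    (hx : ∀ t ∈ Finset.Icc 1 p.T, ∀ b, ‖x t b‖ ≤ 1) (hn : n ≤ p.T) :
    Real.log (VE p x (run p tie x r n) s).det - Real.log ((p.κ * p.lam) ^ p.d) ≤
      p.d * p.logTerm := by
  refine log_det_design_le hd hc (fun i hi => hx i ?_ _) ?_
  · exact Finset.Icc_subset_Icc_right hn (run_E_subset n s hi)
  · exact (Finset.card_le_card (run_E_subset n s)).trans (by simpa using hn)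

end Succ

/-- The sum of the noise terms of the pilot set of level `s` after `n` rounds. -/
def pilotNoise (p : Params) (tie : ℕ → Finset (Fin p.K) → Fin p.K) (x : ℕ → Fin p.K → Vec p.d)
    (θ : Vec p.d) (s n : ℕ) (r : ℕ → ℝ) : Vec p.d :=
  ∑ i ∈ (run p tie x r n).P s,
    (r i - Real.sigmoid (inner ℝ (chosen p x (run p tie x r n) i) θ)) •
      chosen p x (run p tie x r n) i

/-- The self-normalized exponential supermartingale of the pilot set of level `s`. -/
def pilotSupermartingale (p : Params) (tie : ℕ → Finset (Fin p.K) → Fin p.K)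
    (x : ℕ → Fin p.K → Vec p.d) (θ : Vec p.d) (s n : ℕ) (r : ℕ → ℝ) : ℝ :=
  Real.exp (2 * invNormSq (VP p x (run p tie x r n) s) (pilotNoise p tie x θ s n r)) *
    ((p.κ * p.lam) ^ p.d / (VP p x (run p tie x r n) s).det)

theorem pilotSupermartingale_update (θ : Vec p.d) (s n : ℕ) (r : ℕ → ℝ) {m : ℕ} (hm : n < m)
    (b : ℝ) : pilotSupermartingale p tie x θ s n (Function.update r m b) =
      pilotSupermartingale p tie x θ s n r := by
  have hrun : run p tie x (Function.update r m b) n = run p tie x r n :=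
    run_congr_rewards' fun i hi => by
      rw [Function.update_of_ne]
      have := Finset.mem_Icc.1 hi
      omega
  unfold pilotSupermartingale pilotNoise
  rw [hrun]
  congr 4
  refine Finset.sum_congr rfl fun i hi => ?_
  rw [Function.update_of_ne]
  have := Finset.mem_Icc.1 (run_P_subset n s hi)
  omega

theorem run_succ_update (n : ℕ) (r : ℕ → ℝ) (b : ℝ) :
    run p tie x (Function.update r (n + 1) b) (n + 1) = run p tie x r (n + 1) :=
  run_congr_rewards fun i hi => by
    rw [Function.update_of_ne]
    have := Finset.mem_Icc.1 hi
    omega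

-- If the round does not join P^(s), the process is unchanged. Otherwise the rank-one formula and
-- the determinant lemma multiply it by a factor depending on the new reward, divided by 1+q, and
-- `bernoulli_selfNormalized_step` says that this factor has mean at most one.
open Matrix in
theorem pilotSupermartingale_step (hc : 0 < p.κ * p.lam) (θ : Vec p.d) (s n : ℕ) (r : ℕ → ℝ) :
    (1 - rewardProb p tie x θ (n + 1) r) *
        pilotSupermartingale p tie x θ s (n + 1) (Function.update r (n + 1) 0) +
      rewardProb p tie x θ (n + 1) r *
        pilotSupermartingale p tie x θ s (n + 1) (Function.update r (n + 1) 1) ≤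
      pilotSupermartingale p tie x θ s n r := by
  have hV := posDef_VP (x := x) (s := s) hc (run p tie x r n)
  have hV' := posDef_VP (x := x) (s := s) hc (run p tie x r (n + 1))
  set z := x (n + 1) (action p tie x r (n + 1)) with hz
  by_cases h : AddsP p x r (run p tie x r n) (n + 1) tie s
  · have hnoise : ∀ b, pilotNoise p tie x θ s (n + 1) (Function.update r (n + 1) b) =
        pilotNoise p tie x θ s n r + (b - rewardProb p tie x θ (n + 1) r) • z := by
      intro b
      unfold pilotNoise
      rw [run_succ_update, sum_run_P_succ_of_adds h
        (fun i v => (Function.update r (n + 1) b i - Real.sigmoid (inner ℝ v θ)) • v), add_comm,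
        Function.update_self]
      congr 1
      refine Finset.sum_congr rfl fun i hi => ?_
      rw [Function.update_of_ne]
      rintro rfl
      exact run_P_notMem n s hi
    have hVeq := VP_run_succ_of_adds h
    rw [← hz] at hVeq
    set V := VP p x (run p tie x r n) s with hVdef
    rw [hVeq] at hV'
    set q := z.ofLp ⬝ᵥ V⁻¹ *ᵥ z.ofLp with hq
    have hq0 : 0 ≤ q := inv_quadForm_nonneg hV _
    set b0 := z.ofLp ⬝ᵥ V⁻¹ *ᵥ (pilotNoise p tie x θ s n r).ofLp with hb0
    set pr := rewardProb p tie x θ (n + 1) r with hpr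
    have hsup : ∀ b, pilotSupermartingale p tie x θ s (n + 1) (Function.update r (n + 1) b) =
        Real.exp (2 * ((2 * (b - pr) * b0 + (b - pr) ^ 2 * q - b0 ^ 2) / (1 + q))) *
          (pilotSupermartingale p tie x θ s n r / (1 + q)) := by
      intro b
      unfold pilotSupermartingale
      rw [hnoise, run_succ_update, hVeq, det_add_vecMulVec_self hV]
      have e := inv_quadForm_rankOne hV z.ofLp (pilotNoise p tie x θ s n r).ofLp hV' (b - pr)
      rw [← hq, ← hb0] at e
      have e' : invNormSq (V + vecMulVec z.ofLp z.ofLp)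
          (pilotNoise p tie x θ s n r + (b - pr) • z) = invNormSq V (pilotNoise p tie x θ s n r) +
          (2 * (b - pr) * b0 + (b - pr) ^ 2 * q - b0 ^ 2) / (1 + q) := e
      rw [e', mul_add, Real.exp_add, ← hq, ← hVdef]
      have := hV.det_pos.ne'
      field_simp
    rw [hsup, hsup]
    have hpos : 0 ≤ pilotSupermartingale p tie x θ s n r / (1 + q) := by
      unfold pilotSupermartingale
      have := hV.det_pos
      rw [← hVdef]
      positivity
    have hstep := bernoulli_selfNormalized_step (rewardProb_nonneg (tie := tie) (x := x) θ (n + 1) r)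
      (rewardProb_le_one (tie := tie) (x := x) θ (n + 1) r) hq0 b0
    calc _ = ((1 - pr) * Real.exp (2 * ((2 * (0 - pr) * b0 + (0 - pr) ^ 2 * q - b0 ^ 2) / (1 + q)))
          + pr * Real.exp (2 * ((2 * (1 - pr) * b0 + (1 - pr) ^ 2 * q - b0 ^ 2) / (1 + q)))) *
          (pilotSupermartingale p tie x θ s n r / (1 + q)) := by ring
      _ ≤ (1 + q) * (pilotSupermartingale p tie x θ s n r / (1 + q)) := by gcongr
      _ = _ := by field_simp
  · have hsup : ∀ b, pilotSupermartingale p tie x θ s (n + 1) (Function.update r (n + 1) b) =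
        pilotSupermartingale p tie x θ s n r := by
      intro b
      have hnoise : pilotNoise p tie x θ s (n + 1) (Function.update r (n + 1) b) =
          pilotNoise p tie x θ s n r := by
        unfold pilotNoise
        rw [run_succ_update, sum_run_P_succ_of_not_adds h
          (fun i v => (Function.update r (n + 1) b i - Real.sigmoid (inner ℝ v θ)) • v)]
        refine Finset.sum_congr rfl fun i hi => ?_
        rw [Function.update_of_ne]
        rintro rfl
        exact run_P_notMem n s hi
      unfold pilotSupermartingale
      rw [hnoise, run_succ_update, VP_run_succ_of_not_adds h]
    rw [hsup, hsup]
    exact le_of_eq (by ring)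

open Classical in
/-- The anytime self-normalized concentration bound for the pilot set of level `s`. -/
theorem treeExp_pilotNoise_le (hd : 1 ≤ p.d) (hc : 0 < p.κ * p.lam)
    (hx : ∀ t ∈ Finset.Icc 1 p.T, ∀ b, ‖x t b‖ ≤ 1) (θ : Vec p.d) (s : ℕ) {c : ℝ} (hc1 : 0 < c) :
    treeExp (rewardProb p tie x θ) p.T (fun r => if ∃ n ≤ p.T,
      0.5 * p.d * p.logTerm + 0.5 * Real.log c <
        invNormSq (VP p x (run p tie x r n) s) (pilotNoise p tie x θ s n r) then 1 else 0) ≤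
      1 / c := by
  have hY0 : pilotSupermartingale p tie x θ s 0 0 = 1 := by
    have : 0 < (p.κ * p.lam) ^ p.d := by positivity
    simp [pilotSupermartingale, pilotNoise, run, VP, det_design_empty, invNormSq, this.ne']
  have hmax := treeExp_maximal (q := rewardProb p tie x θ) (rewardProb_nonneg θ)
    (rewardProb_le_one θ) (Y := pilotSupermartingale p tie x θ s) (n := p.T)
    (fun k r => by
      unfold pilotSupermartingale
      have := (posDef_VP (x := x) (s := s) hc (run p tie x r k)).det_pos
      positivity)
    (fun k r m b hkm => pilotSupermartingale_update θ s k r hkm b)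
    (fun k _ r _ => pilotSupermartingale_step hc θ s k r) hc1
  rw [hY0] at hmax
  refine le_trans (treeExp_mono (rewardProb_nonneg θ) (rewardProb_le_one θ) fun r _ => ?_) hmax
  by_cases h : ∃ n ≤ p.T, 0.5 * p.d * p.logTerm + 0.5 * Real.log c <
        invNormSq (VP p x (run p tie x r n) s) (pilotNoise p tie x θ s n r)
  · obtain ⟨n, hn, hlt⟩ := h
    have h2 : ∃ k ≤ p.T, c ≤ pilotSupermartingale p tie x θ s k r := by
      refine ⟨n, hn, ?_⟩
      have hdet := log_det_VP_run_le (tie := tie) (r := r) (s := s) hd hc hx hn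
      have hpos := (posDef_VP (x := x) (s := s) hc (run p tie x r n)).det_pos
      have hpow : 0 < (p.κ * p.lam) ^ p.d := by positivity
      -- In this form the log-determinant difference is at most `d * logTerm`, so noise beyond the
      -- threshold forces the process above c.
      have e : pilotSupermartingale p tie x θ s n r =
          Real.exp (2 * invNormSq (VP p x (run p tie x r n) s) (pilotNoise p tie x θ s n r) +
            (Real.log ((p.κ * p.lam) ^ p.d) - Real.log (VP p x (run p tie x r n) s).det)) := by
        unfold pilotSupermartingale
        rw [Real.exp_add, Real.exp_sub, Real.exp_log hpow, Real.exp_log hpos]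
      rw [e, ← Real.log_le_iff_le_exp hc1]
      linarith
    rw [if_pos h2]
    split_ifs <;> norm_num
  · rw [if_neg h]
    split_ifs <;> norm_num

/-! ### Error of the pilot estimator. -/

section Pilot

variable {d : ℕ}

theorem inner_grad (lam : ℝ) (I : Finset ℕ) (z : ℕ → Vec d) (r : ℕ → ℝ) (θ v : Vec d) :
    inner ℝ (grad lam I z r θ) v =
      ∑ i ∈ I, (r i - Real.sigmoid (inner ℝ (z i) θ)) * inner ℝ (z i) v - lam * inner ℝ θ v := by
  unfold grad
  rw [inner_sub_left, sum_inner, real_inner_smul_left]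
  simp only [real_inner_smul_left]

theorem hasDerivAt_logisticLoss_line (lam : ℝ) (I : Finset ℕ) (z : ℕ → Vec d) (r : ℕ → ℝ)
    (θ v : Vec d) :
    HasDerivAt (fun ε : ℝ => logisticLoss lam I z r (θ + ε • v))
      (-inner ℝ (grad lam I z r θ) v) 0 := by
  have hlin : ∀ i, HasDerivAt (fun ε : ℝ => inner ℝ (z i) (θ + ε • v)) (inner ℝ (z i) v) 0 := by
    intro i
    have : (fun ε : ℝ => inner ℝ (z i) (θ + ε • v)) =
        fun ε => inner ℝ (z i) θ + ε * inner ℝ (z i) v := by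
      funext ε
      rw [inner_add_right, real_inner_smul_right]
    rw [this]
    exact (((hasDerivAt_id (0 : ℝ)).mul_const (inner ℝ (z i) v)).const_add
      (inner ℝ (z i) θ)).congr_deriv (one_mul _)
  have hsig : ∀ i, HasDerivAt (fun ε : ℝ => Real.sigmoid (inner ℝ (z i) (θ + ε • v)))
      (Real.sigmoid (inner ℝ (z i) θ) * (1 - Real.sigmoid (inner ℝ (z i) θ)) *
        inner ℝ (z i) v) 0 := by
    intro i
    have h := (Real.hasDerivAt_sigmoid (inner ℝ (z i) (θ + (0 : ℝ) • v))).comp 0 (hlin i)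
    exact h.congr_deriv (by rw [zero_smul, add_zero])
  have hterm : ∀ i, HasDerivAt (fun ε : ℝ =>
      -(r i * Real.log (Real.sigmoid (inner ℝ (z i) (θ + ε • v)))) -
        (1 - r i) * Real.log (1 - Real.sigmoid (inner ℝ (z i) (θ + ε • v))))
      (-((r i - Real.sigmoid (inner ℝ (z i) θ)) * inner ℝ (z i) v)) 0 := by
    intro i
    have hpos : Real.sigmoid (inner ℝ (z i) θ) ≠ 0 := (Real.sigmoid_pos _).ne'
    have hpos' : 1 - Real.sigmoid (inner ℝ (z i) θ) ≠ 0 :=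
      (sub_pos.2 (Real.sigmoid_lt_one _)).ne'
    have h1 := ((hsig i).log (by simpa using hpos)).const_mul (r i)
    have h2 := (((hsig i).const_sub 1).log (by simpa using hpos')).const_mul (1 - r i)
    refine (h1.neg.sub h2).congr_deriv ?_
    simp only [zero_smul, add_zero]
    field_simp
    ring
  have hnorm : HasDerivAt (fun ε : ℝ => lam / 2 * ‖θ + ε • v‖ ^ 2) (lam * inner ℝ θ v) 0 := by
    have : (fun ε : ℝ => lam / 2 * ‖θ + ε • v‖ ^ 2) =
        fun ε => lam / 2 * (‖θ‖ ^ 2 + 2 * inner ℝ θ v * ε + ‖v‖ ^ 2 * ε ^ 2) := by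
      funext ε
      rw [norm_add_sq_real, real_inner_smul_right, norm_smul, mul_pow, Real.norm_eq_abs, sq_abs]
      ring
    rw [this]
    have h := ((((hasDerivAt_id (0 : ℝ)).const_mul (2 * inner ℝ θ v)).const_add (‖θ‖ ^ 2)).add
      ((hasDerivAt_pow 2 (0 : ℝ)).const_mul (‖v‖ ^ 2))).const_mul (lam / 2)
    refine h.congr_deriv ?_
    simp
    ring
  have h := (HasDerivAt.fun_sum fun i (_ : i ∈ I) => hterm i).add hnorm
  rw [inner_grad]
  refine h.congr_deriv ?_
  rw [Finset.sum_neg_distrib]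
  ring

/-- First-order optimality of the pilot estimator. -/
theorem inner_grad_pilot_le (p : Params) (hB : 0 ≤ p.B) (I : Finset ℕ) (z : ℕ → Vec p.d)
    (r : ℕ → ℝ) {θ : Vec p.d} (hθ : θ ∈ p.Θ) :
    inner ℝ (grad p.lam I z r (pilot p I z r)) (θ - pilot p I z r) ≤ 0 := by
  obtain ⟨hmem, hmin⟩ := pilot_spec p hB I z r
  set θ0 := pilot p I z r
  have hder := (hasDerivAt_logisticLoss_line p.lam I z r θ0 (θ - θ0)).tendsto_slope_zero_right
  have hev : ∀ᶠ t : ℝ in nhdsWithin 0 (Set.Ioi 0), 0 ≤ t⁻¹ •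
      (logisticLoss p.lam I z r (θ0 + (0 + t) • (θ - θ0)) -
        logisticLoss p.lam I z r (θ0 + (0 : ℝ) • (θ - θ0))) := by
    filter_upwards [Ioo_mem_nhdsGT (zero_lt_one' ℝ)] with t ht
    refine smul_nonneg (inv_nonneg.2 ht.1.le) ?_
    rw [zero_add, zero_smul, add_zero, sub_nonneg]
    refine hmin ?_
    have hconv : Convex ℝ p.Θ := convex_closedBall _ _
    exact hconv.add_smul_sub_mem hmem hθ ⟨ht.1.le, ht.2.le⟩
  have := ge_of_tendsto hder hev
  linarith

/-- Strong monotonicity of the (negative) gradient of the logistic loss. -/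
theorem inner_grad_sub_grad_ge {d : ℕ} {lam m : ℝ} {I : Finset ℕ} {z : ℕ → Vec d} {r : ℕ → ℝ}
    {θ θ' : Vec d}
    (hm : ∀ i ∈ I, ∀ ξ ∈ Set.uIcc (inner ℝ (z i) θ') (inner ℝ (z i) θ),
      m ≤ deriv Real.sigmoid ξ) :
    ∑ i ∈ I, m * inner ℝ (z i) (θ - θ') ^ 2 + lam * ‖θ - θ'‖ ^ 2 ≤
      inner ℝ (grad lam I z r θ') (θ - θ') - inner ℝ (grad lam I z r θ) (θ - θ') := by
  rw [inner_grad, inner_grad, ← real_inner_self_eq_norm_sq (θ - θ')]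
  have h1 : inner ℝ (θ - θ') (θ - θ') = inner ℝ θ (θ - θ') - inner ℝ θ' (θ - θ') :=
    inner_sub_left _ _ _
  have h2 : ∑ i ∈ I, m * inner ℝ (z i) (θ - θ') ^ 2 ≤
      ∑ i ∈ I, (r i - Real.sigmoid (inner ℝ (z i) θ')) * inner ℝ (z i) (θ - θ') -
        ∑ i ∈ I, (r i - Real.sigmoid (inner ℝ (z i) θ)) * inner ℝ (z i) (θ - θ') := by
    rw [← Finset.sum_sub_distrib]
    refine Finset.sum_le_sum fun i hi => ?_
    have h := sigmoid_sub_mul_sub_ge (hm i hi)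
    rw [inner_sub_right]
    nlinarith
  rw [h1, mul_sub]
  linarith

/-- The pilot error in the norm of the design matrix is controlled by the noise. -/
theorem pilot_error_le (p : Params) (hB : 0 ≤ p.B) (hκ : 0 < p.κ) (hlam : 0 < p.lam)
    (I : Finset ℕ) (z : ℕ → Vec p.d) (r : ℕ → ℝ) {θ : Vec p.d} (hθ : θ ∈ p.Θ)
    (hcurv : ∀ i ∈ I, ∀ θ' ∈ p.Θ, 1 / p.κ ≤ deriv Real.sigmoid (inner ℝ (z i) θ')) :
    √((pilot p I z r - θ).ofLp ⬝ᵥ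
        (design (p.κ * p.lam) I (fun _ => 1) z).mulVec (pilot p I z r - θ).ofLp) ≤
      p.κ * √(invNormSq (design (p.κ * p.lam) I (fun _ => 1) z)
        (∑ i ∈ I, (r i - Real.sigmoid (inner ℝ (z i) θ)) • z i)) + p.B * √(p.κ * p.lam) := by
  have hc : 0 < p.κ * p.lam := mul_pos hκ hlam
  set V := design (p.κ * p.lam) I (fun _ => 1) z with hV
  have hVpos : V.PosDef := posDef_design hc I (by simp) z
  set θ0 := pilot p I z r with hθ0
  have hθ0mem : θ0 ∈ p.Θ := (pilot_spec p hB I z r).1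
  set D := θ0 - θ with hD
  set W := ∑ i ∈ I, (r i - Real.sigmoid (inner ℝ (z i) θ)) • z i with hW
  have hconv : Convex ℝ p.Θ := convex_closedBall _ _
  -- Every point between the two linear predictions is the prediction of some parameter on the
  -- segment, which stays in the convex set Θ.
  have hm : ∀ i ∈ I, ∀ ξ ∈ Set.uIcc (inner ℝ (z i) θ) (inner ℝ (z i) θ0),
      1 / p.κ ≤ deriv Real.sigmoid ξ := by
    intro i hi ξ hξ
    rw [← segment_eq_uIcc] at hξ
    obtain ⟨a, b, ha, hb, hab, rfl⟩ := hξ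
    have h := hcurv i hi (a • θ + b • θ0) (hconv hθ hθ0mem ha hb hab)
    rwa [inner_add_right, real_inner_smul_right, real_inner_smul_right] at h
  have h1 := inner_grad_sub_grad_ge (lam := p.lam) (r := r) hm
  have h2 := inner_grad_pilot_le p hB I z r hθ
  rw [← hθ0] at h2
  have h3 : inner ℝ (grad p.lam I z r θ0) (θ0 - θ) = -inner ℝ (grad p.lam I z r θ0) (θ - θ0) := by
    rw [← inner_neg_right, neg_sub]
  have hgrad : grad p.lam I z r θ = W - p.lam • θ := rfl
  have hquad : D.ofLp ⬝ᵥ V.mulVec D.ofLp =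
      p.κ * (∑ i ∈ I, 1 / p.κ * inner ℝ (z i) D ^ 2 + p.lam * ‖D‖ ^ 2) := by
    rw [hV, quadForm_design, mul_add, Finset.mul_sum, add_comm]
    congr 1
    · refine Finset.sum_congr rfl fun i _ => ?_
      field_simp
    · ring
  -- Optimality of the pilot estimate makes its gradient term favourable, leaving only the gradient
  -- at `θ`, which is noise minus λθ. The resulting inequality n² ≤ (bound)·n is divided by n at the
  -- end.
  have h4 : D.ofLp ⬝ᵥ V.mulVec D.ofLp ≤ p.κ * inner ℝ (W - p.lam • θ) D := by
    rw [hquad, ← hgrad]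
    gcongr
    linarith
  set n := √(D.ofLp ⬝ᵥ V.mulVec D.ofLp) with hn
  have hquad0 : 0 ≤ D.ofLp ⬝ᵥ V.mulVec D.ofLp := by
    simpa using hVpos.posSemidef.dotProduct_mulVec_nonneg D.ofLp
  have h5 : inner ℝ W D ≤ √(invNormSq V W) * n := by
    rw [inner_eq_dotProduct]
    exact (le_abs_self _).trans (abs_dotProduct_le_sqrt_mul_sqrt hVpos _ _)
  have hθB : ‖θ‖ ≤ p.B := by simpa [Params.Θ] using hθ
  have hDn : √(p.κ * p.lam) * ‖D‖ ≤ n := by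
    rw [hn]
    apply Real.le_sqrt_of_sq_le
    rw [mul_pow, Real.sq_sqrt hc.le, hquad, mul_add]
    have : 0 ≤ p.κ * ∑ i ∈ I, 1 / p.κ * inner ℝ (z i) D ^ 2 := by positivity
    linarith
  have h6 : -(p.κ * p.lam * inner ℝ θ D) ≤ p.B * √(p.κ * p.lam) * n := by
    have h := abs_le.1 (abs_real_inner_le_norm θ D)
    have hs : p.κ * p.lam = √(p.κ * p.lam) * √(p.κ * p.lam) := (Real.mul_self_sqrt hc.le).symm
    calc -(p.κ * p.lam * inner ℝ θ D) ≤ p.κ * p.lam * (‖θ‖ * ‖D‖) := by nlinarith [h.1]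
      _ ≤ p.κ * p.lam * (p.B * ‖D‖) := by gcongr
      _ = p.B * √(p.κ * p.lam) * (√(p.κ * p.lam) * ‖D‖) := by
          linear_combination p.B * ‖D‖ * hs
      _ ≤ _ := by gcongr
  have h7 : n * n ≤ (p.κ * √(invNormSq V W) + p.B * √(p.κ * p.lam)) * n := by
    rw [hn, Real.mul_self_sqrt hquad0, ← hn]
    rw [inner_sub_left, real_inner_smul_left] at h4
    nlinarith
  rcases (Real.sqrt_nonneg (D.ofLp ⬝ᵥ V.mulVec D.ofLp)).eq_or_lt with h0 | h0
  · rw [← hn] at h0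
    rw [← h0]
    positivity
  · exact le_of_mul_le_mul_right h7 h0

end Pilot

/-! ### Error decomposition of the one-step estimator. -/

section OneStep

variable {d : ℕ}

/-- The vector `H(θ)⁻¹ v`. -/
def hessInv (lam : ℝ) (I : Finset ℕ) (z : ℕ → Vec d) (θ v : Vec d) : Vec d :=
  WithLp.toLp 2 ((hess lam I z θ)⁻¹.mulVec v.ofLp)

theorem posDef_hess {lam : ℝ} (hlam : 0 < lam) (I : Finset ℕ) (z : ℕ → Vec d) (θ : Vec d) :
    (hess lam I z θ).PosDef :=
  posDef_design hlam I (fun _ _ => (deriv_sigmoid_pos _).le) z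

/-- This is yᵀHy = vᵀH⁻¹v for y = H⁻¹v. It controls both ‖y‖ and the weighted sum of the squares
⟨z_i, y⟩². -/
theorem hessInv_quad {lam : ℝ} (hlam : 0 < lam) (I : Finset ℕ) (z : ℕ → Vec d) (θ v : Vec d) :
    lam * ‖hessInv lam I z θ v‖ ^ 2 +
        ∑ i ∈ I, deriv Real.sigmoid (inner ℝ (z i) θ) * inner ℝ (z i) (hessInv lam I z θ v) ^ 2 =
      invNormSq (hess lam I z θ) v := by
  have hH := posDef_hess hlam I z θ
  have h := quadForm_design lam I (fun i => deriv Real.sigmoid (inner ℝ (z i) θ)) z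
    (hessInv lam I z θ v)
  rw [← h]
  change (hessInv lam I z θ v).ofLp ⬝ᵥ (hess lam I z θ).mulVec (hessInv lam I z θ v).ofLp = _
  unfold hessInv
  simp only
  rw [mulVec_inv_mulVec hH, dotProduct_comm]
  rfl

/-- The lower curvature bound at each sample gives V ≤ κH, and inversion reverses the order. -/
theorem invNormSq_hess_le {κ lam : ℝ} (hκ : 0 < κ) (hlam : 0 < lam) (I : Finset ℕ)
    (z : ℕ → Vec d) {θ : Vec d} (hcurv : ∀ i ∈ I, 1 / κ ≤ deriv Real.sigmoid (inner ℝ (z i) θ))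
    (v : Vec d) :
    invNormSq (hess lam I z θ) v ≤ κ * invNormSq (design (κ * lam) I (fun _ => 1) z) v := by
  refine inv_quadForm_le_of_le (posDef_design (mul_pos hκ hlam) I (by simp) z)
    (posDef_hess hlam I z θ) hκ.le (fun y => ?_) v.ofLp
  have h1 := quadForm_design (κ * lam) I (fun _ => 1) z (WithLp.toLp 2 y)
  have h2 := quadForm_design lam I (fun i => deriv Real.sigmoid (inner ℝ (z i) θ)) z
    (WithLp.toLp 2 y)
  simp only at h1 h2
  rw [h1]
  unfold hess
  rw [h2, mul_add, Finset.mul_sum]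
  refine add_le_add (le_of_eq (by ring)) (Finset.sum_le_sum fun i hi => ?_)
  · have := hcurv i hi
    rw [div_le_iff₀ hκ] at this
    rw [← mul_assoc]
    gcongr
    linarith

theorem inner_hessInv {lam : ℝ} (hlam : 0 < lam) (I : Finset ℕ) (z : ℕ → Vec d) (θ v w : Vec d) :
    inner ℝ v (hessInv lam I z θ w) = inner ℝ (hessInv lam I z θ v) w := by
  have hH := posDef_hess hlam I z θ
  rw [inner_eq_dotProduct, inner_eq_dotProduct]
  unfold hessInv
  simp only
  rw [inv_quadForm_symm hH, dotProduct_comm]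

theorem hess_mulVec (lam : ℝ) (I : Finset ℕ) (z : ℕ → Vec d) (θ v : Vec d) :
    WithLp.toLp 2 ((hess lam I z θ).mulVec v.ofLp) =
      lam • v + ∑ i ∈ I, (deriv Real.sigmoid (inner ℝ (z i) θ) * inner ℝ (z i) v) • z i := by
  unfold hess design
  rw [Matrix.add_mulVec, Matrix.smul_mulVec, Matrix.one_mulVec, Matrix.sum_mulVec]
  ext j
  simp only [PiLp.add_apply, Pi.add_apply, Finset.sum_apply, WithLp.ofLp_sum, PiLp.smul_apply]
  congr 1
  refine Finset.sum_congr rfl fun i _ => ?_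
  rw [Matrix.smul_mulVec, Matrix.vecMulVec_mulVec, op_smul_eq_smul, inner_eq_dotProduct (z i) v]
  simp only [Pi.smul_apply, smul_eq_mul]
  ring

/-- Error decomposition of the one-step estimator. -/
theorem inner_oneStep_sub {p : Params} (hlam : 0 < p.lam) (IP IE : Finset ℕ) (z : ℕ → Vec p.d)
    (r : ℕ → ℝ) (θ v : Vec p.d) :
    inner ℝ v (oneStep p IP IE z r) - inner ℝ v θ =
      ∑ i ∈ IE, (r i - Real.sigmoid (inner ℝ (z i) θ)) *
          inner ℝ (z i) (hessInv p.lam IE z (pilot p IP z r) v) +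
        ∑ i ∈ IE, (Real.sigmoid (inner ℝ (z i) θ) - Real.sigmoid (inner ℝ (z i) (pilot p IP z r)) -
          deriv Real.sigmoid (inner ℝ (z i) (pilot p IP z r)) *
            (inner ℝ (z i) θ - inner ℝ (z i) (pilot p IP z r))) *
          inner ℝ (z i) (hessInv p.lam IE z (pilot p IP z r) v) -
        p.lam * inner ℝ θ (hessInv p.lam IE z (pilot p IP z r) v) := by
  set θ0 := pilot p IP z r with hθ0
  have hH := posDef_hess hlam IE z θ0
  set y := hessInv p.lam IE z θ0 v with hy
  -- Writing θ̄ - θ as H⁻¹H(θ̄ - θ) turns every term into a pairing with y = H⁻¹v.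
  have h1 : inner ℝ v (θ0 - θ) =
      inner ℝ y (p.lam • (θ0 - θ) + ∑ i ∈ IE,
        (deriv Real.sigmoid (inner ℝ (z i) θ0) * inner ℝ (z i) (θ0 - θ)) • z i) := by
    rw [← hess_mulVec, hy, ← inner_hessInv hlam]
    congr 1
    unfold hessInv
    simp only
    have hu : IsUnit (hess p.lam IE z θ0).det := (Matrix.isUnit_iff_isUnit_det _).1 hH.isUnit
    rw [Matrix.mulVec_mulVec, Matrix.nonsing_inv_mul _ hu, Matrix.one_mulVec]
  have h2 : oneStep p IP IE z r = θ0 + hessInv p.lam IE z θ0 (grad p.lam IE z r θ0) := rfl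
  have h3 : inner ℝ v (oneStep p IP IE z r) - inner ℝ v θ =
      inner ℝ v (θ0 - θ) + inner ℝ y (grad p.lam IE z r θ0) := by
    rw [h2, inner_add_right, inner_hessInv hlam, inner_sub_right]
    ring
  rw [h3, h1, real_inner_comm (grad p.lam IE z r θ0), inner_grad, inner_add_right,
    real_inner_smul_right, inner_sum, ← Finset.sum_add_distrib, inner_sub_right,
    real_inner_comm θ0 y, real_inner_comm θ y]
  have h4 : ∀ i ∈ IE, inner ℝ y
      ((deriv Real.sigmoid (inner ℝ (z i) θ0) * inner ℝ (z i) (θ0 - θ)) • z i) =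
      (deriv Real.sigmoid (inner ℝ (z i) θ0) * (inner ℝ (z i) θ0 - inner ℝ (z i) θ)) *
        inner ℝ (z i) y := by
    intro i _
    rw [real_inner_smul_right, real_inner_comm (z i) y, inner_sub_right]
  rw [Finset.sum_congr rfl h4]
  -- The linear part of the Taylor remainder is exactly the data part of H(θ̄ - θ), and μ(zᵀθ)
  -- cancels. The ridge terms λ(θ̄ - θ) and -λθ̄ combine to -λθ.
  have h6 : ∑ i ∈ IE, ((r i - Real.sigmoid (inner ℝ (z i) θ)) * inner ℝ (z i) y +
      (Real.sigmoid (inner ℝ (z i) θ) - Real.sigmoid (inner ℝ (z i) θ0) -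
        deriv Real.sigmoid (inner ℝ (z i) θ0) * (inner ℝ (z i) θ - inner ℝ (z i) θ0)) *
        inner ℝ (z i) y) =
      ∑ i ∈ IE, (deriv Real.sigmoid (inner ℝ (z i) θ0) * (inner ℝ (z i) θ0 - inner ℝ (z i) θ)) *
        inner ℝ (z i) y + ∑ i ∈ IE, (r i - Real.sigmoid (inner ℝ (z i) θ0)) * inner ℝ (z i) y := by
    rw [← Finset.sum_add_distrib]
    refine Finset.sum_congr rfl fun i _ => ?_
    ring
  rw [h6]
  ring

/-- Bounds for the direction `H⁻¹ v` in terms of the dual norm of `v`. -/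
theorem hessInv_bounds {κ lam : ℝ} (hκ : 0 < κ) (hlam : 0 < lam) (I : Finset ℕ)
    (z : ℕ → Vec d) {θ : Vec d} (hcurv : ∀ i ∈ I, 1 / κ ≤ deriv Real.sigmoid (inner ℝ (z i) θ))
    (v : Vec d) :
    ‖hessInv lam I z θ v‖ ≤ √(κ / lam) * √(invNormSq (design (κ * lam) I (fun _ => 1) z) v) ∧
      ∑ i ∈ I, deriv Real.sigmoid (inner ℝ (z i) θ) * inner ℝ (z i) (hessInv lam I z θ v) ^ 2 ≤
        κ * invNormSq (design (κ * lam) I (fun _ => 1) z) v := by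
  have h1 := hessInv_quad hlam I z θ v
  have h2 := invNormSq_hess_le hκ hlam I z hcurv v
  have h3 : 0 ≤ ∑ i ∈ I, deriv Real.sigmoid (inner ℝ (z i) θ) *
      inner ℝ (z i) (hessInv lam I z θ v) ^ 2 :=
    Finset.sum_nonneg fun i _ => mul_nonneg (deriv_sigmoid_pos _).le (sq_nonneg _)
  have h4 : 0 ≤ lam * ‖hessInv lam I z θ v‖ ^ 2 := by positivity
  refine ⟨?_, by linarith⟩
  rw [← Real.sqrt_mul (by positivity)]
  apply Real.le_sqrt_of_sq_le
  rw [div_mul_eq_mul_div, le_div_iff₀ hlam]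
  linarith

/-- Deterministic error bound for the one-step estimator. -/
theorem abs_inner_oneStep_sub_le {p : Params} (hB : 0 ≤ p.B) (hκ : 0 < p.κ) (hlam : 0 < p.lam)
    (hLμ : 1 / 4 ≤ p.Lμ) {IP IE : Finset ℕ} {z : ℕ → Vec p.d} {r : ℕ → ℝ} {θ v : Vec p.d}
    (hθ : θ ∈ p.Θ)
    (hcurv : ∀ i ∈ IE, ∀ θ' ∈ p.Θ, 1 / p.κ ≤ deriv Real.sigmoid (inner ℝ (z i) θ'))
    {ρ a₁ : ℝ} (hρ1 : ρ ≤ 1)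
    (hD : ∀ i ∈ IE, (inner ℝ (z i) θ - inner ℝ (z i) (pilot p IP z r)) ^ 2 ≤ ρ)
    (hnoise : |∑ i ∈ IE, (r i - Real.sigmoid (inner ℝ (z i) θ)) *
          inner ℝ (z i) (hessInv p.lam IE z (pilot p IP z r) v)| ≤
        a₁ * √(invNormSq (design (p.κ * p.lam) IE (fun _ => 1) z) v)) (hρ0 : 0 ≤ ρ) :
    |inner ℝ v (oneStep p IP IE z r) - inner ℝ v θ| ≤
      (a₁ + ρ * √(p.Lμ * p.κ * IE.card) + p.B * √(p.κ * p.lam)) *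
        √(invNormSq (design (p.κ * p.lam) IE (fun _ => 1) z) v) := by
  set θ0 := pilot p IP z r with hθ0
  have hθ0mem : θ0 ∈ p.Θ := (pilot_spec p hB IP z r).1
  set N := √(invNormSq (design (p.κ * p.lam) IE (fun _ => 1) z) v) with hN
  have hN0 : 0 ≤ N := Real.sqrt_nonneg _
  set y := hessInv p.lam IE z θ0 v with hy
  have hVpos : (design (p.κ * p.lam) IE (fun _ => 1) z).PosDef :=
    posDef_design (mul_pos hκ hlam) IE (by simp) z
  obtain ⟨hb1, hb2⟩ := hessInv_bounds hκ hlam IE z (fun i hi => hcurv i hi θ0 hθ0mem) v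
  rw [← hy] at hb1 hb2
  rw [← hN] at hb1
  have hNsq : invNormSq (design (p.κ * p.lam) IE (fun _ => 1) z) v = N ^ 2 := by
    rw [hN, Real.sq_sqrt (invNormSq_nonneg_of_posDef hVpos v)]
  rw [hNsq] at hb2
  rw [inner_oneStep_sub hlam]
  have hθB : ‖θ‖ ≤ p.B := by simpa [Params.Θ] using hθ
  have hreg : |p.lam * inner ℝ θ y| ≤ p.B * √(p.κ * p.lam) * N := by
    rw [abs_mul, abs_of_pos hlam]
    have hs : p.lam * √(p.κ / p.lam) = √(p.κ * p.lam) := by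
      rw [← Real.sqrt_sq hlam.le, ← Real.sqrt_mul (sq_nonneg _), Real.sqrt_sq hlam.le]
      congr 1
      field_simp
    calc p.lam * |inner ℝ θ y| ≤ p.lam * (‖θ‖ * ‖y‖) := by
          gcongr; exact abs_real_inner_le_norm _ _
      _ ≤ p.lam * (p.B * (√(p.κ / p.lam) * N)) := by gcongr
      _ = p.B * (p.lam * √(p.κ / p.lam)) * N := by ring
      _ = _ := by rw [hs]
  have hrem : |∑ i ∈ IE, (Real.sigmoid (inner ℝ (z i) θ) - Real.sigmoid (inner ℝ (z i) θ0) -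
        deriv Real.sigmoid (inner ℝ (z i) θ0) * (inner ℝ (z i) θ - inner ℝ (z i) θ0)) *
        inner ℝ (z i) y| ≤ ρ * √(p.Lμ * p.κ * IE.card) * N := by
    have hpt : ∀ i ∈ IE, |(Real.sigmoid (inner ℝ (z i) θ) - Real.sigmoid (inner ℝ (z i) θ0) -
        deriv Real.sigmoid (inner ℝ (z i) θ0) * (inner ℝ (z i) θ - inner ℝ (z i) θ0)) *
        inner ℝ (z i) y| ≤ ρ * (√p.Lμ * (√(deriv Real.sigmoid (inner ℝ (z i) θ0)) *
          |inner ℝ (z i) y|)) := by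
      intro i hi
      have hd0 := deriv_sigmoid_pos (inner ℝ (z i) θ0)
      have habs : |inner ℝ (z i) θ - inner ℝ (z i) θ0| ≤ 1 :=
        (sq_le_one_iff_abs_le_one _).1 ((hD i hi).trans hρ1)
      rw [abs_mul]
      have h1 := abs_sigmoid_remainder_le habs
      -- One square root of μ' is traded for √L_μ; the other is kept so that Cauchy-Schwarz meets
      -- the H-weighted sum in `hb2`. This costs √κ in place of κ.
      have h2 : deriv Real.sigmoid (inner ℝ (z i) θ0) ≤
          √p.Lμ * √(deriv Real.sigmoid (inner ℝ (z i) θ0)) := by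
        rw [← Real.sqrt_mul (by linarith)]
        apply Real.le_sqrt_of_sq_le
        rw [sq]
        gcongr
        exact (deriv_sigmoid_le _).trans hLμ
      calc _ ≤ (deriv Real.sigmoid (inner ℝ (z i) θ0) *
            (inner ℝ (z i) θ - inner ℝ (z i) θ0) ^ 2) * |inner ℝ (z i) y| := by gcongr
        _ ≤ ((√p.Lμ * √(deriv Real.sigmoid (inner ℝ (z i) θ0))) * ρ) * |inner ℝ (z i) y| := by
            gcongr
            exact hD i hi
        _ = _ := by ring
    refine (Finset.abs_sum_le_sum_abs _ _).trans ((Finset.sum_le_sum hpt).trans ?_)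
    rw [← Finset.mul_sum, ← Finset.mul_sum, mul_assoc]
    refine mul_le_mul_of_nonneg_left ?_ hρ0
    have hcard : (0 : ℝ) ≤ IE.card := Nat.cast_nonneg _
    have hcs : ∑ i ∈ IE, √(deriv Real.sigmoid (inner ℝ (z i) θ0)) * |inner ℝ (z i) y| ≤
        √(IE.card * (p.κ * N ^ 2)) := by
      apply Real.le_sqrt_of_sq_le
      refine (sq_sum_le_card_mul_sum_sq).trans (mul_le_mul_of_nonneg_left ?_ hcard)
      refine le_trans (le_of_eq ?_) hb2
      refine Finset.sum_congr rfl fun i _ => ?_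
      rw [mul_pow, sq_abs, Real.sq_sqrt (deriv_sigmoid_pos _).le]
    calc _ ≤ √p.Lμ * √(IE.card * (p.κ * N ^ 2)) := by gcongr
      _ = √(p.Lμ * p.κ * IE.card) * N := by
          rw [← Real.sqrt_mul (by linarith), show p.Lμ * (IE.card * (p.κ * N ^ 2)) =
            p.Lμ * p.κ * IE.card * N ^ 2 by ring, Real.sqrt_mul
            (mul_nonneg (mul_nonneg (by linarith) hκ.le) hcard), Real.sqrt_sq hN0]
  rw [sub_eq_add_neg]
  refine (abs_add_le _ _).trans ?_
  rw [abs_neg]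
  have := abs_add_le (∑ i ∈ IE, (r i - Real.sigmoid (inner ℝ (z i) θ)) * inner ℝ (z i) y)
    (∑ i ∈ IE, (Real.sigmoid (inner ℝ (z i) θ) - Real.sigmoid (inner ℝ (z i) θ0) -
        deriv Real.sigmoid (inner ℝ (z i) θ0) * (inner ℝ (z i) θ - inner ℝ (z i) θ0)) *
        inner ℝ (z i) y)
  linarith

end OneStep

/-! ### Bernstein concentration for the estimation sets. -/

/-- The optimal exponent in Bernstein's inequality. -/
theorem exists_bernstein_exponent {v c L : ℝ} (hv : 0 < v) (hc : 0 < c) (hL : 0 < L) :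
    ∃ η : ℝ, 0 < η ∧ η * c < 1 ∧
      L ≤ η * (√(2 * v * L) + c * L) - η ^ 2 * v / (2 * (1 - η * c)) := by
  -- With η = a/(1+ca) one gets 1 - ηc = 1/(1+ca), and the last claim becomes an equality.
  set a := √(2 * L / v) with ha
  have ha0 : 0 < a := Real.sqrt_pos.2 (by positivity)
  have ha2 : a ^ 2 = 2 * L / v := Real.sq_sqrt (by positivity)
  have hsv : √(2 * v * L) = a * v := by
    rw [show 2 * v * L = (2 * L / v) * v ^ 2 by field_simp, Real.sqrt_mul (by positivity),
      Real.sqrt_sq hv.le]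
  have hL' : L = a ^ 2 * v / 2 := by rw [ha2]; field_simp
  have h1 : 0 < 1 + c * a := by positivity
  have h2 : 1 - a / (1 + c * a) * c = 1 / (1 + c * a) := by field_simp; ring
  refine ⟨a / (1 + c * a), by positivity, ?_, ?_⟩
  · have : 0 < 1 / (1 + c * a) := by positivity
    linarith
  · rw [h2, hsv]
    apply le_of_eq
    rw [hL']
    field_simp
    ring

variable {p : Params} {tie : ℕ → Finset (Fin p.K) → Fin p.K} {x : ℕ → Fin p.K → Vec p.d}

theorem mem_run_P_succ {r : ℕ → ℝ} {n j i : ℕ} : i ∈ (run p tie x r (n + 1)).P j ↔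
    (i = n + 1 ∧ AddsP p x r (run p tie x r n) (n + 1) tie j) ∨ i ∈ (run p tie x r n).P j := by
  rw [run]
  by_cases h : AddsP p x r (run p tie x r n) (n + 1) tie j
  · rw [step_P_of_adds h]; simp [h]
  · rw [step_P_of_not_adds h]; simp [h]

theorem mem_run_E_succ {r : ℕ → ℝ} {n j i : ℕ} : i ∈ (run p tie x r (n + 1)).E j ↔
    (i = n + 1 ∧ AddsE p x r (run p tie x r n) (n + 1) tie j) ∨ i ∈ (run p tie x r n).E j := by
  rw [run]
  by_cases h : AddsE p x r (run p tie x r n) (n + 1) tie j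
  · rw [step_E_of_adds h]; simp [h]
  · rw [step_E_of_not_adds h]; simp [h]

/-- The rounds whose rewards determine the estimation set of level `s` and its initial point. -/
def observed {K : ℕ} (s : ℕ) (σ : State K) : Finset ℕ :=
  (Finset.range (s + 1)).biUnion σ.P ∪ (Finset.range s).biUnion σ.E

theorem mem_observed {K : ℕ} {s : ℕ} {σ : State K} {i : ℕ} :
    i ∈ observed s σ ↔ (∃ j ≤ s, i ∈ σ.P j) ∨ ∃ j < s, i ∈ σ.E j := by
  simp [observed]

theorem mask_apply_of_mem {I : Finset ℕ} {r : ℕ → ℝ} {i : ℕ} (hi : i ∈ I) : mask I r i = r i :=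
  if_pos hi

section Mask

variable {s n : ℕ} {r : ℕ → ℝ}

theorem mask_eq_of_mem_P {j i : ℕ} (hj : j ≤ s) (hi : i ∈ (run p tie x r n).P j) :
    r i = mask (observed s (run p tie x r n)) r i :=
  (mask_apply_of_mem (mem_observed.2 (Or.inl ⟨j, hj, hi⟩))).symm

theorem mask_eq_of_mem_E {j i : ℕ} (hj : j < s) (hi : i ∈ (run p tie x r n).E j) :
    r i = mask (observed s (run p tie x r n)) r i :=
  (mask_apply_of_mem (mem_observed.2 (Or.inr ⟨j, hj, hi⟩))).symm

/-- Erasing all unobserved rewards leaves the sets up to level `s` and their arms unchanged, so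
these are functions of the observed rewards. -/
theorem run_mask_agree (hT : 1 ≤ p.T) : AgreeUpTo s (run p tie x r n)
    (run p tie x (mask (observed s (run p tie x r n)) r) n) :=
  run_agree hT (fun _ hj _ hi => mask_eq_of_mem_P hj.le hi)
    (fun _ hj _ hi => mask_eq_of_mem_E hj hi)

theorem addsP_mask (hT : 1 ≤ p.T) {j : ℕ} (hj : j ≤ s) :
    AddsP p x (mask (observed s (run p tie x r n)) r)
      (run p tie x (mask (observed s (run p tie x r n)) r) n) (n + 1) tie j ↔
    AddsP p x r (run p tie x r n) (n + 1) tie j := by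
  have hag : AgreeUpTo s (run p tie x r n)
      (run p tie x (mask (observed s (run p tie x r n)) r) n) := run_mask_agree hT
  have hP : ∀ i < s, ∀ k ∈ (run p tie x r n).P i,
      r k = mask (observed s (run p tie x r n)) r k := fun i hi k hk => mask_eq_of_mem_P hi.le hk
  have hE : ∀ i < s, ∀ k ∈ (run p tie x r n).E i,
      r k = mask (observed s (run p tie x r n)) r k := fun i hi k hk => mask_eq_of_mem_E hi hk
  exact (addsP_agree hag hP hE hT hj).symm

theorem addsE_mask (hT : 1 ≤ p.T) {j : ℕ} (hj : j ≤ s) :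
    AddsE p x (mask (observed s (run p tie x r n)) r)
      (run p tie x (mask (observed s (run p tie x r n)) r) n) (n + 1) tie j ↔
    AddsE p x r (run p tie x r n) (n + 1) tie j := by
  have hag : AgreeUpTo s (run p tie x r n)
      (run p tie x (mask (observed s (run p tie x r n)) r) n) := run_mask_agree hT
  have hP : ∀ i < s, ∀ k ∈ (run p tie x r n).P i,
      r k = mask (observed s (run p tie x r n)) r k := fun i hi k hk => mask_eq_of_mem_P hi.le hk
  have hE : ∀ i < s, ∀ k ∈ (run p tie x r n).E i,
      r k = mask (observed s (run p tie x r n)) r k := fun i hi k hk => mask_eq_of_mem_E hi hk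
  exact (addsE_agree hag hP hE hT hj).symm

theorem action_succ : action p tie x r (n + 1) = choice p x r (run p tie x r n) (n + 1) tie := by
  unfold action
  rw [run, step_arm, Function.update_self]

theorem action_mask (hT : 1 ≤ p.T) {j : ℕ} (hj : j ≤ s)
    (hlev : stopLevel p x r (run p tie x r n) (n + 1) = j)
    (hA : condA p x r (run p tie x r n) (n + 1) j) :
    action p tie x (mask (observed s (run p tie x r n)) r) (n + 1) = action p tie x r (n + 1) := by
  have hag : AgreeUpTo s (run p tie x r n)
      (run p tie x (mask (observed s (run p tie x r n)) r) n) := run_mask_agree hT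
  have hP : ∀ i < s, ∀ k ∈ (run p tie x r n).P i,
      r k = mask (observed s (run p tie x r n)) r k := fun i hi k hk => mask_eq_of_mem_P hi.le hk
  have hE : ∀ i < s, ∀ k ∈ (run p tie x r n).E i,
      r k = mask (observed s (run p tie x r n)) r k := fun i hi k hk => mask_eq_of_mem_E hi hk
  rw [action_succ, action_succ]
  exact (choice_agree hag hP hE hT hj hlev hA).symm

theorem observed_subset : observed s (run p tie x r n) ⊆ Finset.Icc 1 n := by
  intro i hi
  rcases mem_observed.1 hi with ⟨j, _, h⟩ | ⟨j, _, h⟩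
  · exact run_P_subset n j h
  · exact run_E_subset n j h

end Mask

/-- Exponential moment bound for the rewards of the estimation set of level `s`. -/
theorem treeExp_prod_est_le_one (hT : 1 ≤ p.T) (θ : Vec p.d) (s : ℕ)
    (φ : (ℕ → ℝ) → ℕ → ℝ → ℝ) (hφ : ∀ h i b, 0 ≤ φ h i b) (N : ℕ)
    (hmean : ∀ h, ∀ i ∈ (run p tie x h N).E s,
      (1 - Real.sigmoid (inner ℝ (chosen p x (run p tie x h N) i) θ)) * φ h i 0 +
        Real.sigmoid (inner ℝ (chosen p x (run p tie x h N) i) θ) * φ h i 1 ≤ 1) :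
    treeExp (rewardProb p tie x θ) N (fun r => ∏ i ∈ (run p tie x r N).E s,
      φ (mask (observed s (run p tie x r N)) r) i (r i)) ≤ 1 := by
  refine treeExp_prod_le_one (rewardProb_nonneg θ) (rewardProb_le_one θ)
    (obs := fun n r => observed s (run p tie x r n)) (est := fun n r => (run p tie x r n).E s)
    (o := fun n r => (∃ j ≤ s, AddsP p x r (run p tie x r n) (n + 1) tie j) ∨
      ∃ j < s, AddsE p x r (run p tie x r n) (n + 1) tie j)
    (e := fun n r => AddsE p x r (run p tie x r n) (n + 1) tie s)
    ?_ ?_ ?_ ?_ ?_ ?_ ?_ ?_ ?_ ?_ φ hφ N ?_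
  · intro r
    ext i
    simp [mem_observed, run]
  · intro r
    rfl
  · intro n r b
    constructor
    · intro h
      ext i
      simp only [run_succ_update, mem_observed, mem_run_P_succ, mem_run_E_succ, Finset.mem_insert]
      constructor
      · rintro (⟨j, hj, h1 | h1⟩ | ⟨j, hj, h1 | h1⟩)
        · exact Or.inl h1.1
        · exact Or.inr (Or.inl ⟨j, hj, h1⟩)
        · exact Or.inl h1.1
        · exact Or.inr (Or.inr ⟨j, hj, h1⟩)
      · rintro (h1 | ⟨j, hj, h1⟩ | ⟨j, hj, h1⟩)
        · rcases h with ⟨j, hj, h⟩ | ⟨j, hj, h⟩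
          · exact Or.inl ⟨j, hj, Or.inl ⟨h1, h⟩⟩
          · exact Or.inr ⟨j, hj, Or.inl ⟨h1, h⟩⟩
        · exact Or.inl ⟨j, hj, Or.inr h1⟩
        · exact Or.inr ⟨j, hj, Or.inr h1⟩
    · intro h
      push Not at h
      ext i
      simp only [run_succ_update, mem_observed, mem_run_P_succ, mem_run_E_succ]
      constructor
      · rintro (⟨j, hj, h1 | h1⟩ | ⟨j, hj, h1 | h1⟩)
        · exact absurd h1.2 (h.1 j hj)
        · exact Or.inl ⟨j, hj, h1⟩
        · exact absurd h1.2 (h.2 j hj)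
        · exact Or.inr ⟨j, hj, h1⟩
      · rintro (⟨j, hj, h1⟩ | ⟨j, hj, h1⟩)
        · exact Or.inl ⟨j, hj, Or.inr h1⟩
        · exact Or.inr ⟨j, hj, Or.inr h1⟩
  · intro n r b
    simp only [run_succ_update]
    rw [run]
    exact ⟨fun h => step_E_of_adds h, fun h => step_E_of_not_adds h⟩
  · exact fun n r => observed_subset
  · exact fun n r => run_E_subset n s
  -- A round stops at one level only and joins at most one of the two sets there.
  · rintro n r (⟨j, hj, h⟩ | ⟨j, hj, h⟩) he
    · have hjs : j = s := h.1.symm.trans he.1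
      subst hjs
      exact he.2.2 h.2.2
    · have hjs : j = s := h.1.symm.trans he.1
      omega
  · intro n r
    refine or_congr (exists_congr fun j => and_congr_right fun hj => addsP_mask hT hj)
      (exists_congr fun j => and_congr_right fun hj => addsE_mask hT hj.le)
  · exact fun n r => addsE_mask hT le_rfl
  · rintro n r ((⟨j, hj, h⟩ | ⟨j, hj, h⟩) | h)
    · unfold rewardProb
      rw [action_mask hT hj h.1 h.2.1]
    · unfold rewardProb
      rw [action_mask hT hj.le h.1 h.2.1]
    · unfold rewardProb
      rw [action_mask hT le_rfl h.1 h.2.1]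
  · intro h _ k hk he
    -- Truncation after round k is invisible here, since the state after round k+1 uses k rewards
    -- only.
    have htr : run p tie x (trunc k h) (k + 1) = run p tie x h (k + 1) :=
      run_congr_rewards fun i hi => if_pos (Finset.mem_Icc.1 hi).2
    have hmem : k + 1 ∈ (run p tie x h N).E s := by
      refine run_E_mono (Nat.succ_le_of_lt hk) s ?_
      rw [← htr]
      exact mem_run_E_succ.2 (Or.inl ⟨rfl, he⟩)
    have hprob : rewardProb p tie x θ (k + 1) (trunc k h) =
        Real.sigmoid (inner ℝ (chosen p x (run p tie x h N) (k + 1)) θ) := by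
      unfold rewardProb action chosen
      rw [htr, run_arm_of_le le_rfl (Nat.succ_le_of_lt hk)]
    rw [hprob]
    exact hmean h _ hmem

/-- The direction `H⁻¹ v` of the one-step estimator of level `s` after `n` rounds. -/
def estDir (p : Params) (tie : ℕ → Finset (Fin p.K) → Fin p.K) (x : ℕ → Fin p.K → Vec p.d)
    (s n : ℕ) (v : Vec p.d) (r : ℕ → ℝ) : Vec p.d :=
  hessInv p.lam ((run p tie x r n).E s) (chosen p x (run p tie x r n))
    (pilot p ((run p tie x r n).P s) (chosen p x (run p tie x r n)) r) v

/-- The noise of the one-step estimator of level `s` after `n` rounds in the direction `v`. -/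
def estNoise (p : Params) (tie : ℕ → Finset (Fin p.K) → Fin p.K) (x : ℕ → Fin p.K → Vec p.d)
    (θ : Vec p.d) (s n : ℕ) (v : Vec p.d) (r : ℕ → ℝ) : ℝ :=
  ∑ i ∈ (run p tie x r n).E s,
    (r i - Real.sigmoid (inner ℝ (chosen p x (run p tie x r n) i) θ)) *
      inner ℝ (chosen p x (run p tie x r n) i) (estDir p tie x s n v r)

open Classical in
/-- Bernstein's inequality for the estimation noise. -/
theorem treeExp_estNoise_le (hT : 1 ≤ p.T) (hB : 0 ≤ p.B) (hκ : 0 < p.κ) (hlam : 0 < p.lam)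
    (hLμ : 1 / 4 ≤ p.Lμ) (hx : ∀ t ∈ Finset.Icc 1 p.T, ∀ b, ‖x t b‖ ≤ 1)
    (hcurv : ∀ t ∈ Finset.Icc 1 p.T, ∀ b, ∀ θ' ∈ p.Θ,
      1 / p.κ ≤ deriv Real.sigmoid (inner ℝ (x t b) θ'))
    (θ : Vec p.d) (s : ℕ) {n : ℕ} (hn : n ≤ p.T) (v : Vec p.d) {L : ℝ} (hL : 0 < L)
    {sgn : ℝ} (hsgn : |sgn| = 1) :
    treeExp (rewardProb p tie x θ) n (fun r =>
      if (√(2 * p.Lμ * p.κ ^ 2 * L) + √(p.κ / (9 * p.lam)) * L) *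
          √(invNormSq (VE p x (run p tie x r n) s) v) < sgn * estNoise p tie x θ s n v r
        then 1 else 0) ≤ Real.exp (-L) := by
  have hLμ0 : 0 < p.Lμ := by linarith
  set M := √(p.κ / p.lam) with hM
  have hM0 : 0 < M := Real.sqrt_pos.2 (by positivity)
  -- The conditional variance of the normalized noise is at most L_μκ², and its weights are at most
  -- M = √(κ/λ); c = M/3 yields the term √(κ/(9λ)) L.
  obtain ⟨η, hη0, hη1, hη⟩ := exists_bernstein_exponent (v := p.Lμ * p.κ ^ 2) (c := M / 3) (L := L)
    (by positivity) (by positivity) hL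
  let Nrm : (ℕ → ℝ) → ℝ := fun r => √(invNormSq (VE p x (run p tie x r n) s) v)
  let z : (ℕ → ℝ) → ℕ → Vec p.d := fun r => chosen p x (run p tie x r n)
  let c : (ℕ → ℝ) → ℕ → ℝ := fun r i => sgn * inner ℝ (z r i) (estDir p tie x s n v r) / Nrm r
  let π : (ℕ → ℝ) → ℕ → ℝ := fun r i => Real.sigmoid (inner ℝ (z r i) θ)
  let D : ℝ := 2 * (1 - η * (M / 3))
  have hD : 0 < D := by simp only [D]; linarith
  have hE : ∀ r, ∀ i ∈ (run p tie x r n).E s, i ∈ Finset.Icc 1 p.T := fun r i hi =>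
    Finset.Icc_subset_Icc_right hn (run_E_subset n s hi)
  have hNpos : ∀ r, 0 ≤ Nrm r := fun r => Real.sqrt_nonneg _
  have hbounds : ∀ r, ‖estDir p tie x s n v r‖ ≤ M * Nrm r ∧
      ∑ i ∈ (run p tie x r n).E s, deriv Real.sigmoid (inner ℝ (z r i)
        (pilot p ((run p tie x r n).P s) (chosen p x (run p tie x r n)) r)) *
        inner ℝ (z r i) (estDir p tie x s n v r) ^ 2 ≤ p.κ * Nrm r ^ 2 := by
    intro r
    have h := hessInv_bounds hκ hlam ((run p tie x r n).E s) (z r)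
      (θ := pilot p ((run p tie x r n).P s) (chosen p x (run p tie x r n)) r)
      (fun i hi => hcurv i (hE r i hi) _ _ (pilot_spec p hB _ _ _).1) v
    refine ⟨h.1, ?_⟩
    have h2 : Nrm r ^ 2 = invNormSq (VE p x (run p tie x r n) s) v :=
      Real.sq_sqrt (invNormSq_nonneg_of_posDef (posDef_VE (mul_pos hκ hlam) _) v)
    rw [h2]
    exact h.2
  have hc_le : ∀ r, ∀ i ∈ (run p tie x r n).E s, |c r i| ≤ M := by
    intro r i hi
    have h1 : |inner ℝ (z r i) (estDir p tie x s n v r)| ≤ M * Nrm r := by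
      refine (abs_real_inner_le_norm _ _).trans ?_
      have := hx i (hE r i hi) ((run p tie x r n).arm i)
      calc ‖z r i‖ * ‖estDir p tie x s n v r‖ ≤ 1 * ‖estDir p tie x s n v r‖ := by
            gcongr
            exact this
        _ ≤ _ := by rw [one_mul]; exact (hbounds r).1
    simp only [c]
    rw [abs_div, abs_mul, hsgn, one_mul, abs_of_nonneg (hNpos r)]
    exact div_le_of_le_mul₀ (hNpos r) hM0.le h1
  -- The variances are taken at `θ` but the Hessian at the pilot estimate. They are matched crudely
  -- by π(1-π) ≤ L_μ ≤ L_μκμ', which brings in one factor κ; the other comes from `hbounds`.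
  have hc_sq : ∀ r, ∑ i ∈ (run p tie x r n).E s, c r i ^ 2 * (π r i * (1 - π r i)) ≤
      p.Lμ * p.κ ^ 2 := by
    intro r
    have h1 : ∀ i ∈ (run p tie x r n).E s, c r i ^ 2 * (π r i * (1 - π r i)) ≤
        p.Lμ * p.κ * (deriv Real.sigmoid (inner ℝ (z r i)
          (pilot p ((run p tie x r n).P s) (chosen p x (run p tie x r n)) r)) *
          inner ℝ (z r i) (estDir p tie x s n v r) ^ 2) / Nrm r ^ 2 := by
      intro i hi
      have hcu := hcurv i (hE r i hi) ((run p tie x r n).arm i) _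
        (pilot_spec p hB ((run p tie x r n).P s) (chosen p x (run p tie x r n)) r).1
      rw [div_le_iff₀ hκ] at hcu
      have hvar : π r i * (1 - π r i) ≤ p.Lμ := by
        have := deriv_sigmoid_le (inner ℝ (z r i) θ)
        rw [deriv_sigmoid_apply] at this
        exact this.trans hLμ
      have hs2 : sgn ^ 2 = 1 := by rw [← sq_abs, hsgn, one_pow]
      have e : c r i ^ 2 = inner ℝ (z r i) (estDir p tie x s n v r) ^ 2 / Nrm r ^ 2 := by
        simp only [c]
        rw [div_pow, mul_pow, hs2, one_mul]
      rw [e]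
      calc inner ℝ (z r i) (estDir p tie x s n v r) ^ 2 / Nrm r ^ 2 * (π r i * (1 - π r i))
          ≤ inner ℝ (z r i) (estDir p tie x s n v r) ^ 2 / Nrm r ^ 2 * p.Lμ := by gcongr
        _ = p.Lμ * (1 * inner ℝ (z r i) (estDir p tie x s n v r) ^ 2) / Nrm r ^ 2 := by ring
        _ ≤ p.Lμ * ((deriv Real.sigmoid (inner ℝ (z r i)
              (pilot p ((run p tie x r n).P s) (chosen p x (run p tie x r n)) r)) * p.κ) *
              inner ℝ (z r i) (estDir p tie x s n v r) ^ 2) / Nrm r ^ 2 := by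
            gcongr
            exact hcu
        _ = _ := by ring
    refine (Finset.sum_le_sum h1).trans ?_
    rw [← Finset.sum_div, ← Finset.mul_sum]
    refine div_le_of_le_mul₀ (sq_nonneg _) (by positivity) ?_
    calc _ ≤ p.Lμ * p.κ * (p.κ * Nrm r ^ 2) := by
          gcongr
          exact (hbounds r).2
      _ = _ := by ring
  -- Exponential factors normalized by their Bernstein bound, so that each has mean at most one; the
  -- weights are computed from the observed rewards `h` alone.
  let φ : (ℕ → ℝ) → ℕ → ℝ → ℝ := fun h i b =>
    Real.exp ((η * c h i) * (b - π h i) - (η * c h i) ^ 2 * (π h i * (1 - π h i)) / D)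
  have hmgf := treeExp_prod_est_le_one (tie := tie) (x := x) hT θ s φ
    (fun _ _ _ => (Real.exp_pos _).le) n (by
      intro h i hi
      have hle : |η * c h i| ≤ η * M := by
        rw [abs_mul, abs_of_pos hη0]
        gcongr
        exact hc_le h i hi
      have hb := bernoulli_bernstein_mgf (p := π h i) (Real.sigmoid_nonneg _)
        (Real.sigmoid_le_one _) hle (by linarith)
      have hDeq : 2 * (1 - η * M / 3) = D := by simp only [D]; ring
      rw [hDeq] at hb
      change (1 - π h i) * φ h i 0 + π h i * φ h i 1 ≤ 1
      have hφ : ∀ b, φ h i b = Real.exp (η * c h i * (b - π h i)) /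
        Real.exp ((η * c h i) ^ 2 * (π h i * (1 - π h i)) / D) := fun b => Real.exp_sub _ _
      have hcomb : ∀ A B C B' E : ℝ, A * (B / E) + C * (B' / E) = (A * B + C * B') / E := by
        intros
        ring
      rw [hφ, hφ, hcomb, div_le_one (Real.exp_pos _)]
      exact hb)
  have hkey : ∀ r, (if (√(2 * p.Lμ * p.κ ^ 2 * L) + √(p.κ / (9 * p.lam)) * L) *
          √(invNormSq (VE p x (run p tie x r n) s) v) < sgn * estNoise p tie x θ s n v r
        then (1 : ℝ) else 0) ≤ Real.exp (-L) * ∏ i ∈ (run p tie x r n).E s,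
          φ (mask (observed s (run p tie x r n)) r) i (r i) := by
    intro r
    split_ifs with hbad
    swap
    · exact mul_nonneg (Real.exp_pos _).le (Finset.prod_nonneg fun _ _ => (Real.exp_pos _).le)
    -- On the realized path, the weights computed from the observed rewards are the true ones.
    set h := mask (observed s (run p tie x r n)) r with hh
    have hag : AgreeUpTo s (run p tie x r n) (run p tie x h n) := run_mask_agree hT
    obtain ⟨hP, hE', harmP, harmE⟩ := hag s le_rfl
    have hzE : ∀ i ∈ (run p tie x r n).E s, z r i = z h i := fun i hi => by
      simp only [z, chosen]; rw [harmE i hi]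
    have hzP : ∀ i ∈ (run p tie x r n).P s, z r i = z h i := fun i hi => by
      simp only [z, chosen]; rw [harmP i hi]
    have hpil : pilot p ((run p tie x h n).P s) (z h) h = pilot p ((run p tie x r n).P s) (z r) r := by
      rw [← hP]
      exact (pilot_congr p hzP fun i hi => mask_eq_of_mem_P le_rfl hi).symm
    have hdir : estDir p tie x s n v h = estDir p tie x s n v r := by
      unfold estDir
      change hessInv p.lam ((run p tie x h n).E s) (z h)
        (pilot p ((run p tie x h n).P s) (z h) h) v = hessInv p.lam ((run p tie x r n).E s) (z r)
        (pilot p ((run p tie x r n).P s) (z r) r) v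
      rw [hpil, ← hE']
      unfold hessInv
      rw [hess_congr p.lam hzE]
    have hNrm : Nrm h = Nrm r := by simp only [Nrm]; rw [VE_congr hag]
    have hcc : ∀ i ∈ (run p tie x r n).E s, c h i = c r i := fun i hi => by
      simp only [c]; rw [hdir, hNrm, hzE i hi]
    have hππ : ∀ i ∈ (run p tie x r n).E s, π h i = π r i := fun i hi => by
      simp only [π]; rw [hzE i hi]
    -- If the dual norm of v vanishes, then so does H⁻¹v, the noise is zero and the strict
    -- inequality `hbad` is impossible. The normalized weights are therefore genuine quotients.
    have hNr : 0 < Nrm r := by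
      rcases (hNpos r).eq_or_lt with h0 | h0
      · exfalso
        have hdir0 : estDir p tie x s n v r = 0 := by
          have := (hbounds r).1
          rw [← h0, mul_zero] at this
          exact norm_le_zero_iff.1 this
        have hz0 : √(invNormSq (VE p x (run p tie x r n) s) v) = 0 := h0.symm
        rw [hz0, estNoise, hdir0] at hbad
        simp at hbad
      · exact h0
    have hsum : ∑ i ∈ (run p tie x r n).E s, c r i * (r i - π r i) =
        sgn * estNoise p tie x θ s n v r / Nrm r := by
      unfold estNoise
      rw [Finset.mul_sum, Finset.sum_div]
      refine Finset.sum_congr rfl fun i _ => ?_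
      simp only [c, π, z]
      ring
    have hprod : ∏ i ∈ (run p tie x r n).E s, φ h i (r i) =
        Real.exp (η * (sgn * estNoise p tie x θ s n v r / Nrm r) -
          η ^ 2 * (∑ i ∈ (run p tie x r n).E s, c r i ^ 2 * (π r i * (1 - π r i))) / D) := by
      rw [← Real.exp_sum, ← hsum, Finset.mul_sum, Finset.mul_sum, Finset.sum_div,
        ← Finset.sum_sub_distrib]
      congr 1
      refine Finset.sum_congr rfl fun i hi => ?_
      rw [hcc i hi, hππ i hi]
      ring
    rw [hprod, ← Real.exp_add]
    refine Real.one_le_exp ?_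
    have hu : √(2 * (p.Lμ * p.κ ^ 2) * L) + M / 3 * L ≤
        sgn * estNoise p tie x θ s n v r / Nrm r := by
      rw [le_div_iff₀ hNr]
      refine le_trans (le_of_eq ?_) hbad.le
      have h9 : √(p.κ / (9 * p.lam)) = M / 3 := by
        rw [hM, show p.κ / (9 * p.lam) = p.κ / p.lam / 3 ^ 2 by field_simp; norm_num,
          Real.sqrt_div (by positivity), Real.sqrt_sq (by norm_num)]
      rw [h9, ← mul_assoc]
    have h1 : η * (√(2 * (p.Lμ * p.κ ^ 2) * L) + M / 3 * L) ≤
        η * (sgn * estNoise p tie x θ s n v r / Nrm r) := by gcongr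
    have h2 : η ^ 2 * (∑ i ∈ (run p tie x r n).E s, c r i ^ 2 * (π r i * (1 - π r i))) / D ≤
        η ^ 2 * (p.Lμ * p.κ ^ 2) / D := by
      gcongr
      exact hc_sq r
    linarith
  calc _ ≤ treeExp (rewardProb p tie x θ) n (fun r => Real.exp (-L) *
        ∏ i ∈ (run p tie x r n).E s, φ (mask (observed s (run p tie x r n)) r) i (r i)) :=
        treeExp_mono (rewardProb_nonneg θ) (rewardProb_le_one θ) fun r _ => hkey r
    _ = Real.exp (-L) * _ := treeExp_const_mul _ _ _
    _ ≤ Real.exp (-L) * 1 := by gcongr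
    _ = _ := mul_one _

/-! ### Standing assumptions and elementary bounds on the parameters. -/

/-- The standing assumptions for a fixed sequence of contexts. -/
structure Admissible (p : Params) (x : ℕ → Fin p.K → Vec p.d) (θ : Vec p.d) : Prop where
  one_le_d : 1 ≤ p.d
  four_le_T : 4 ≤ p.T
  one_le_K : 1 ≤ p.K
  B_pos : 0 < p.B
  -- The bounds 4 ≤ κ and 1/4 ≤ L_μ come from the curvature at the parameter zero, where μ' = 1/4;
  -- see `ae_admissible`.
  four_le_κ : 4 ≤ p.κ
  one_le_κ_mul_lam : 1 ≤ p.κ * p.lam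
  le_Lμ : 1 / 4 ≤ p.Lμ
  δ_pos : 0 < p.δ
  δ_lt_one : p.δ < 1
  mem_Θ : θ ∈ p.Θ
  norm_le : ∀ t ∈ Finset.Icc 1 p.T, ∀ b, ‖x t b‖ ≤ 1
  curvature : ∀ t ∈ Finset.Icc 1 p.T, ∀ b, ∀ θ' ∈ p.Θ,
    1 / p.κ ≤ deriv Real.sigmoid (inner ℝ (x t b) θ')

namespace Admissible

variable {p : Params} {x : ℕ → Fin p.K → Vec p.d} {θ : Vec p.d} (h : Admissible p x θ)

include h

theorem κ_pos : 0 < p.κ := by linarith [h.four_le_κ]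

theorem κ_mul_lam_pos : 0 < p.κ * p.lam := by linarith [h.one_le_κ_mul_lam]

theorem lam_pos : 0 < p.lam := pos_of_mul_pos_right h.κ_mul_lam_pos h.κ_pos.le

theorem Lμ_pos : 0 < p.Lμ := by linarith [h.le_Lμ]

theorem one_le_T : 1 ≤ p.T := by linarith [h.four_le_T]

theorem d_pos : (0 : ℝ) < p.d := by exact_mod_cast h.one_le_d

theorem T_pos : (0 : ℝ) < p.T := by exact_mod_cast h.one_le_T

theorem logTerm_pos : 0 < p.logTerm := by
  have h1 := h.d_pos
  have h2 := h.T_pos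
  have h3 := h.κ_mul_lam_pos
  unfold Params.logTerm
  apply Real.log_pos
  have : 0 < (p.T : ℝ) / (p.κ * p.lam * p.d) := by positivity
  linarith

theorem one_le_S : 1 ≤ p.S := by
  unfold Params.S
  apply Nat.le_floor
  have h4 : (4 : ℝ) ≤ p.T := by exact_mod_cast h.four_le_T
  have : (2 : ℝ) ≤ Real.logb 2 p.T := by
    rw [Real.le_logb_iff_rpow_le (by norm_num) h.T_pos]
    norm_num
    exact h.four_le_T
  norm_num
  linarith

theorem sqrt_T_le : √p.T ≤ 2 ^ (p.S + 1) := by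
  have h1 : (0.5 : ℝ) * Real.logb 2 p.T < p.S + 1 := Nat.lt_floor_add_one _
  rw [← Real.rpow_natCast, ← Real.logb_le_iff_le_rpow (by norm_num) (Real.sqrt_pos.2 h.T_pos),
    Real.sqrt_eq_rpow, Real.logb_rpow_eq_mul_logb_of_pos h.T_pos]
  push_cast
  norm_num at h1 ⊢
  linarith

/-- S is the integer part of log₂ √T, so if (a) fails at level S+1, all widths there are small
enough for (b). No round passes this level. -/
theorem half_pow_le : (1 / 2 : ℝ) ^ (p.S + 1) ≤ 1 / √p.T := by
  rw [one_div_pow]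
  exact one_div_le_one_div_of_le (Real.sqrt_pos.2 h.T_pos) h.sqrt_T_le

theorem S_pos : (0 : ℝ) < p.S := by exact_mod_cast h.one_le_S

theorem sixteen_le : 16 ≤ 4 * p.T * p.S * p.K / p.δ := by
  have h1 : (4 : ℝ) ≤ p.T := by exact_mod_cast h.four_le_T
  have h2 : (1 : ℝ) ≤ p.S := by exact_mod_cast h.one_le_S
  have h3 : (1 : ℝ) ≤ p.K := by exact_mod_cast h.one_le_K
  rw [le_div_iff₀ h.δ_pos]
  calc 16 * p.δ ≤ 16 * 1 := by linarith [h.δ_lt_one]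
    _ = 4 * 4 * 1 * 1 := by norm_num
    _ ≤ 4 * p.T * p.S * p.K := by gcongr

theorem two_le_log : 2 ≤ Real.log (4 * p.T * p.S * p.K / p.δ) := by
  refine le_trans ?_ (Real.log_le_log (by norm_num) h.sixteen_le)
  rw [show (16 : ℝ) = 2 ^ 4 by norm_num, Real.log_pow]
  have := Real.log_two_gt_d9
  norm_num
  linarith

theorem α₂_nonneg : 0 ≤ p.α₂ := by
  have := h.B_pos
  unfold Params.α₂
  positivity

/-- A crude lower bound, needed when the rounds of level S+1 are absorbed. The first square root in
α₁ alone gives 4, from κ ≥ 4, L_μ ≥ 1/4 and a logarithm of at least 2. -/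
theorem α_ge : 8 ≤ p.α := by
  have h1 : 4 ≤ √(2 * p.Lμ * p.κ ^ 2 * Real.log (4 * p.T * p.S * p.K / p.δ)) := by
    apply Real.le_sqrt_of_sq_le
    have h2 := h.two_le_log
    have h3 := h.le_Lμ
    have h4 : (16 : ℝ) ≤ p.κ ^ 2 := by nlinarith [h.four_le_κ]
    calc (4 : ℝ) ^ 2 = 2 * (1 / 4) * 16 * 2 := by norm_num
      _ ≤ _ := by gcongr
  have h2 := h.α₂_nonneg
  have h3 : 0 ≤ √(p.κ / (9 * p.lam)) * Real.log (4 * p.T * p.S * p.K / p.δ) :=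
    mul_nonneg (Real.sqrt_nonneg _) (by linarith [h.two_le_log])
  unfold Params.α Params.α₁
  linarith

theorem α_pos : 0 < p.α := by linarith [h.α_ge]

theorem β_pos : 0 < p.β := by
  have h1 := h.B_pos
  have h2 := h.κ_mul_lam_pos
  have h3 := h.κ_pos
  unfold Params.β
  positivity

end Admissible

/-! ### Elliptical potential: sizes of the pilot and estimation sets. -/

section Potential

variable {p : Params} {tie : ℕ → Finset (Fin p.K) → Fin p.K} {x : ℕ → Fin p.K → Vec p.d}
  {θ : Vec p.d}

theorem div_two_le_log_one_add {q : ℝ} (h0 : 0 ≤ q) (h1 : q ≤ 1) : q / 2 ≤ Real.log (1 + q) := by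
  have h := Real.one_sub_inv_le_log_of_pos (show 0 < 1 + q by linarith)
  refine le_trans ?_ h
  rw [← sub_nonneg]
  have : 1 - (1 + q)⁻¹ - q / 2 = q * (1 - q) / (2 * (1 + q)) := by field_simp; ring
  rw [this]
  have := sub_nonneg.2 h1
  positivity

/-- Each new pilot round raises log det V_P by log(1+q) ≥ q/2 > τ/2. The condition q ≤ 1 comes from
κλ ≥ 1. -/
theorem card_run_P_mul_le (h : Admissible p x θ) (r : ℕ → ℝ) (s : ℕ) {n : ℕ} (hn : n ≤ p.T) :
    ((run p tie x r n).P s).card * p.τ s ≤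
      2 * (Real.log (VP p x (run p tie x r n) s).det - Real.log ((p.κ * p.lam) ^ p.d)) := by
  induction n with
  | zero => simp [run, VP, det_design_empty]
  | succ n ih =>
    have ih' := ih (by omega)
    have hc := h.κ_mul_lam_pos
    by_cases hA : AddsP p x r (run p tie x r n) (n + 1) tie s
    · have hV := posDef_VP (x := x) (s := s) hc (run p tie x r n)
      have hP : (run p tie x r (n + 1)).P s = insert (n + 1) ((run p tie x r n).P s) := by
        rw [run, step_P_of_adds hA]
      have hτ := hA.2.2
      rw [← action_succ] at hτ
      have hq0 := invNormSq_nonneg_of_posDef hV (x (n + 1) (action p tie x r (n + 1)))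
      have hq1 : invNormSq (VP p x (run p tie x r n) s) (x (n + 1) (action p tie x r (n + 1))) ≤
          1 := by
        refine (invNormSq_design_le hc _ _ (by simp) _).trans ?_
        rw [div_le_one hc]
        refine le_trans ?_ h.one_le_κ_mul_lam
        exact pow_le_one₀ (norm_nonneg _) (h.norm_le _ (Finset.mem_Icc.2 ⟨by omega, hn⟩) _)
      rw [hP, Finset.card_insert_of_notMem (run_P_notMem n s), VP_run_succ_of_adds hA,
        det_add_vecMulVec_self hV, Real.log_mul hV.det_pos.ne' (by
          have := hq0
          unfold invNormSq at this
          positivity)]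
      have hlog := div_two_le_log_one_add hq0 hq1
      unfold invNormSq at hlog hτ
      push_cast
      linarith
    · have hP : (run p tie x r (n + 1)).P s = (run p tie x r n).P s := by
        rw [run, step_P_of_not_adds hA]
      rw [hP, VP_run_succ_of_not_adds hA]
      exact ih'

/-- The same potential argument: condition (a) makes the chosen width exceed 2⁻ˢ, that is, α²q >
4⁻ˢ. -/
theorem card_run_E_mul_le (h : Admissible p x θ)
    (htie : ∀ t (A : Finset (Fin p.K)), A.Nonempty → tie t A ∈ A)
    (r : ℕ → ℝ) (s : ℕ) {n : ℕ} (hn : n ≤ p.T) :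
    ((run p tie x r n).E s).card * ((1 / 2) ^ s) ^ 2 ≤
      p.α ^ 2 *
        (2 * (Real.log (VE p x (run p tie x r n) s).det - Real.log ((p.κ * p.lam) ^ p.d))) := by
  induction n with
  | zero => simp [run, VE, det_design_empty]
  | succ n ih =>
    have ih' := ih (by omega)
    have hc := h.κ_mul_lam_pos
    by_cases hA : AddsE p x r (run p tie x r n) (n + 1) tie s
    · have hV := posDef_VE (x := x) (s := s) hc (run p tie x r n)
      have hE : (run p tie x r (n + 1)).E s = insert (n + 1) ((run p tie x r n).E s) := by
        rw [run, step_E_of_adds hA]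
      have hw := (choice_spec_condA h.one_le_K htie hA.1 hA.2.1).2
      rw [← action_succ] at hw
      have hq0 := invNormSq_nonneg_of_posDef hV (x (n + 1) (action p tie x r (n + 1)))
      have hq1 : invNormSq (VE p x (run p tie x r n) s) (x (n + 1) (action p tie x r (n + 1))) ≤
          1 := by
        refine (invNormSq_design_le hc _ _ (by simp) _).trans ?_
        rw [div_le_one hc]
        refine le_trans ?_ h.one_le_κ_mul_lam
        exact pow_le_one₀ (norm_nonneg _) (h.norm_le _ (Finset.mem_Icc.2 ⟨by omega, hn⟩) _)
      rw [hE, Finset.card_insert_of_notMem (run_E_notMem n s), VE_run_succ_of_adds hA,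
        det_add_vecMulVec_self hV, Real.log_mul hV.det_pos.ne' (by
          have := hq0
          unfold invNormSq at this
          positivity)]
      have hlog := div_two_le_log_one_add hq0 hq1
      have hw2 : ((1 / 2 : ℝ) ^ s) ^ 2 ≤ p.α ^ 2 *
          invNormSq (VE p x (run p tie x r n) s) (x (n + 1) (action p tie x r (n + 1))) := by
        have h1 := pow_le_pow_left₀ (by positivity) hw.le 2
        unfold width at h1
        rwa [mul_pow, Real.sq_sqrt hq0] at h1
      unfold invNormSq at hlog hw2
      push_cast
      have := mul_le_mul_of_nonneg_left hlog (sq_nonneg p.α)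
      linarith
    · have hE : (run p tie x r (n + 1)).E s = (run p tie x r n).E s := by
        rw [run, step_E_of_not_adds hA]
      rw [hE, VE_run_succ_of_not_adds hA]
      exact ih'

theorem card_run_P_le (h : Admissible p x θ) (r : ℕ → ℝ) (s : ℕ) {n : ℕ} (hn : n ≤ p.T) :
    ((run p tie x r n).P s).card * p.τ s ≤ 2 * p.d * p.logTerm := by
  refine (card_run_P_mul_le h r s hn).trans ?_
  have := log_det_VP_run_le (tie := tie) (r := r) (s := s) h.one_le_d h.κ_mul_lam_pos h.norm_le hn
  linarith

theorem card_run_E_le (h : Admissible p x θ)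
    (htie : ∀ t (A : Finset (Fin p.K)), A.Nonempty → tie t A ∈ A)
    (r : ℕ → ℝ) (s : ℕ) {n : ℕ} (hn : n ≤ p.T) :
    ((run p tie x r n).E s).card * ((1 / 2) ^ s) ^ 2 ≤ p.α ^ 2 * (2 * p.d * p.logTerm) := by
  refine (card_run_E_mul_le h htie r s hn).trans ?_
  have := log_det_VE_run_le (tie := tie) (r := r) (s := s) h.one_le_d h.κ_mul_lam_pos h.norm_le hn
  exact mul_le_mul_of_nonneg_left (by linarith) (sq_nonneg _)

/-- No width exceeds α/√(κλ), so levels with larger 2⁻ˢ collect nothing. This replaces the potential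
bound when T is small compared with κλd. -/
theorem half_pow_le_of_mem_E (h : Admissible p x θ)
    (htie : ∀ t (A : Finset (Fin p.K)), A.Nonempty → tie t A ∈ A)
    (r : ℕ → ℝ) (s : ℕ) {n i : ℕ} (hn : n ≤ p.T) (hi : i ∈ (run p tie x r n).E s) :
    (1 / 2 : ℝ) ^ s ≤ p.α / √(p.κ * p.lam) := by
  induction n with
  | zero => simp [run] at hi
  | succ n ih =>
    rcases mem_run_E_succ.1 hi with ⟨-, hA⟩ | hi
    · have hw := (choice_spec_condA h.one_le_K htie hA.1 hA.2.1).2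
      refine hw.le.trans ?_
      unfold width
      rw [div_eq_mul_inv, ← Real.sqrt_inv]
      have := h.α_pos
      gcongr
      refine (invNormSq_design_le h.κ_mul_lam_pos _ _ (by simp) _).trans ?_
      rw [← one_div]
      have := h.κ_mul_lam_pos
      gcongr
      exact pow_le_one₀ (norm_nonneg _) (h.norm_le _ (Finset.mem_Icc.2 ⟨by omega, hn⟩) _)
    · exact ih (by omega) hi

theorem invNormSq_VP_run_succ_le (hc : 0 < p.κ * p.lam) (r : ℕ → ℝ) (s n : ℕ) (v : Vec p.d) :
    invNormSq (VP p x (run p tie x r (n + 1)) s) v ≤ invNormSq (VP p x (run p tie x r n) s) v := by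
  have e : VP p x (run p tie x r n) s = design (p.κ * p.lam) ((run p tie x r n).P s) (fun _ => 1)
      (chosen p x (run p tie x r (n + 1))) := by
    refine design_congr (fun _ _ => rfl) fun i hi => (chosen_run_succ_of_ne ?_).symm
    rintro rfl
    exact run_P_notMem n s hi
  rw [e]
  exact invNormSq_design_le_of_subset hc (run_P_mono (Nat.le_succ n) s) _ _

/-- The threshold test is passed on entry into E^(s), and V_P can only grow afterwards, so the bound
holds for the final pilot estimate even though it was tested against an earlier matrix. -/
theorem invNormSq_le_τ_of_mem_E (hc : 0 < p.κ * p.lam) (r : ℕ → ℝ) {s n i : ℕ}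
    (hi : i ∈ (run p tie x r n).E s) :
    invNormSq (VP p x (run p tie x r n) s) (chosen p x (run p tie x r n) i) ≤ p.τ s := by
  induction n with
  | zero => simp [run] at hi
  | succ n ih =>
    refine (invNormSq_VP_run_succ_le hc r s n _).trans ?_
    rcases mem_run_E_succ.1 hi with ⟨rfl, hA⟩ | hi
    · have := hA.2.2
      rw [← action_succ] at this
      exact not_lt.1 this
    · rw [chosen_run_succ_of_ne]
      · exact ih hi
      · rintro rfl
        exact run_E_notMem n s hi

end Potential

/-! ### The widths are valid confidence radii. -/

section Confidence

variable {p : Params} {tie : ℕ → Finset (Fin p.K) → Fin p.K} {x : ℕ → Fin p.K → Vec p.d}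
  {θ : Vec p.d}

/-- The noise terms of all levels and rounds are within their confidence bounds. -/
structure NoiseBounds (p : Params) (tie : ℕ → Finset (Fin p.K) → Fin p.K)
    (x : ℕ → Fin p.K → Vec p.d) (θ : Vec p.d) (r : ℕ → ℝ) : Prop where
  pilot : ∀ s ∈ Finset.Icc 1 p.S, ∀ n ≤ p.T,
    invNormSq (VP p x (run p tie x r n) s) (pilotNoise p tie x θ s n r) ≤
      0.5 * p.d * p.logTerm + 0.5 * Real.log (2 * p.S / p.δ)
  est : ∀ s ∈ Finset.Icc 1 p.S, ∀ n < p.T, ∀ a,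
    |estNoise p tie x θ s n (x (n + 1) a) r| ≤
      p.α₁ * √(invNormSq (VE p x (run p tie x r n) s) (x (n + 1) a))

/-- Noise costs α₁, regularization α₂, and together they are α/2. The Taylor remainder costs at most
α/4, which leaves slack. -/
theorem abs_score_sub_le (h : Admissible p x θ)
    (htie : ∀ t (A : Finset (Fin p.K)), A.Nonempty → tie t A ∈ A) {r : ℕ → ℝ}
    (hr : NoiseBounds p tie x θ r) {s n : ℕ} (hs : s ∈ Finset.Icc 1 p.S) (hn : n < p.T)
    (a : Fin p.K) :
    |score p x r (run p tie x r n) (n + 1) s a - inner ℝ (x (n + 1) a) θ| ≤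
      width p x (run p tie x r n) (n + 1) s a := by
  have hκ := h.κ_pos
  have hlam := h.lam_pos
  have hc := h.κ_mul_lam_pos
  have hLμ := h.Lμ_pos
  have hd := h.d_pos
  have hℓ := h.logTerm_pos
  have hβ := h.β_pos
  have hα := h.α_pos
  set σ := run p tie x r n with hσ
  set z := chosen p x σ with hz
  have hmem : ∀ j i, i ∈ σ.P j ∨ i ∈ σ.E j → i ∈ Finset.Icc 1 p.T := by
    rintro j i (hi | hi)
    · exact Finset.Icc_subset_Icc_right hn.le (run_P_subset n j hi)
    · exact Finset.Icc_subset_Icc_right hn.le (run_E_subset n j hi)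
  set R := √(32 * p.Lμ * p.κ * p.d * p.logTerm) with hR
  have hR0 : 0 < R := Real.sqrt_pos.2 (by positivity)
  -- `ρ` equals τβ²: the squared dual norm of a feature in E^(s) times the squared pilot radius,
  -- hence a bound on the squared prediction error of the pilot. The cap at 1 permits the
  -- self-concordance estimate.
  set ρ := min 1 ((1 / 2) ^ s / R) with hρ
  have hρ0 : 0 ≤ ρ := le_min zero_le_one (by positivity)
  have hquad : (pilot p (σ.P s) z r - θ).ofLp ⬝ᵥ
      (VP p x σ s).mulVec (pilot p (σ.P s) z r - θ).ofLp ≤ p.β ^ 2 := by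
    have h1 := pilot_error_le p h.B_pos.le hκ hlam (σ.P s) z r h.mem_Θ
      (fun i hi θ' hθ' => h.curvature i (hmem s i (Or.inl hi)) _ θ' hθ')
    refine (Real.sqrt_le_left hβ.le).1 (h1.trans ?_)
    unfold Params.β
    gcongr
    exact hr.pilot s hs n hn.le
  have hD : ∀ i ∈ σ.E s, (inner ℝ (z i) θ - inner ℝ (z i) (pilot p (σ.P s) z r)) ^ 2 ≤ ρ := by
    intro i hi
    have h1 := invNormSq_le_τ_of_mem_E hc r hi
    have h2 := dotProduct_sq_le_of_posDef (posDef_VP (x := x) (s := s) hc σ) (z i).ofLp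
      (pilot p (σ.P s) z r - θ).ofLp
    rw [← inner_eq_dotProduct, inner_sub_right] at h2
    have h3 : (inner ℝ (z i) θ - inner ℝ (z i) (pilot p (σ.P s) z r)) ^ 2 =
        (inner ℝ (z i) (pilot p (σ.P s) z r) - inner ℝ (z i) θ) ^ 2 := by ring
    rw [h3]
    refine h2.trans ?_
    have h4 : 0 ≤ invNormSq (VP p x σ s) (z i) :=
      invNormSq_nonneg_of_posDef (posDef_VP hc σ) _
    have h5 : p.τ s * p.β ^ 2 = ρ := by
      unfold Params.τ
      rw [← hR, ← hρ]
      field_simp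
    rw [← h5]
    have h6 : (0 : ℝ) ≤ p.τ s := h4.trans h1
    have h7 := (posDef_VP (x := x) (s := s) hc σ).posSemidef.dotProduct_mulVec_nonneg
      (pilot p (σ.P s) z r - θ).ofLp
    rw [star_trivial] at h7
    exact mul_le_mul h1 hquad h7 h6
  have hmain := abs_inner_oneStep_sub_le (p := p) h.B_pos.le hκ hlam h.le_Lμ (IP := σ.P s)
    (IE := σ.E s) (z := z) (r := r) (v := x (n + 1) a) h.mem_Θ
    (fun i hi θ' hθ' => h.curvature i (hmem s i (Or.inr hi)) _ θ' hθ') (min_le_left _ _) hD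
    (hr.est s hs n hn a) hρ0
  -- The factor 2⁻ˢ in ρ cancels the growth of √|E^(s)|, which is at most 2ˢα√(2dℓ). Since R =
  -- 4√(2L_μκdℓ), exactly α/4 remains.
  have hrem : ρ * √(p.Lμ * p.κ * (σ.E s).card) ≤ p.α / 4 := by
    have hcard := card_run_E_le (tie := tie) h htie r s hn.le
    rw [← hσ] at hcard
    have h1 : √(p.Lμ * p.κ * (σ.E s).card) * (1 / 2) ^ s ≤ p.α * (R / 4) := by
      have e1 : √(p.Lμ * p.κ * (σ.E s).card) * (1 / 2) ^ s =
          √(p.Lμ * p.κ * ((σ.E s).card * ((1 / 2) ^ s) ^ 2)) := by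
        rw [← mul_assoc, Real.sqrt_mul' _ (sq_nonneg ((1 / 2 : ℝ) ^ s)),
          Real.sqrt_sq (by positivity)]
      have e2 : p.α * (R / 4) = √(p.Lμ * p.κ * (p.α ^ 2 * (2 * p.d * p.logTerm))) := by
        rw [show p.Lμ * p.κ * (p.α ^ 2 * (2 * p.d * p.logTerm)) =
          p.α ^ 2 * (32 * p.Lμ * p.κ * p.d * p.logTerm / 4 ^ 2) by ring,
          Real.sqrt_mul (sq_nonneg p.α), Real.sqrt_sq hα.le, Real.sqrt_div' _ (by norm_num),
          Real.sqrt_sq (by norm_num)]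
      rw [e1, e2]
      gcongr
    calc ρ * √(p.Lμ * p.κ * (σ.E s).card)
        ≤ ((1 / 2) ^ s / R) * √(p.Lμ * p.κ * (σ.E s).card) := by
          gcongr
          exact min_le_right _ _
      _ = (√(p.Lμ * p.κ * (σ.E s).card) * (1 / 2) ^ s) / R := by ring
      _ ≤ (p.α * (R / 4)) / R := by gcongr
      _ = p.α / 4 := by field_simp
  refine hmain.trans ?_
  unfold width
  refine mul_le_mul_of_nonneg_right ?_ (Real.sqrt_nonneg _)
  have hαeq : p.α = 2 * (p.α₁ + p.α₂) := rfl
  have hα₂ : p.α₂ = p.B * √(p.κ * p.lam) := rfl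
  rw [← hα₂]
  linarith

end Confidence

/-! ### Regret of a single round. -/

section Round

variable {p : Params} {tie : ℕ → Finset (Fin p.K) → Fin p.K} {x : ℕ → Fin p.K → Vec p.d}
  {θ : Vec p.d} {r : ℕ → ℝ} {n s : ℕ}

theorem width_le_of_not_condA {σ : State p.K} {t : ℕ} (hA : ¬ condA p x r σ t s) {a : Fin p.K}
    (ha : a ∈ active p x r σ t s) : width p x σ t s a ≤ (1 / 2) ^ s := by
  by_contra hlt
  exact hA ⟨a, ha, not_le.1 hlt⟩

/-- The best arm survives the eliminations. -/
theorem mem_active_of_isMax (h : Admissible p x θ)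
    (htie : ∀ t (A : Finset (Fin p.K)), A.Nonempty → tie t A ∈ A) (hr : NoiseBounds p tie x θ r)
    (hn : n < p.T) {b : Fin p.K}
    (hb : ∀ a, (inner ℝ (x (n + 1) a) θ : ℝ) ≤ inner ℝ (x (n + 1) b) θ) (hs : s ≤ p.S + 1)
    (hA : ∀ j < s, 1 ≤ j → ¬ condA p x r (run p tie x r n) (n + 1) j) :
    b ∈ active p x r (run p tie x r n) (n + 1) s := by
  induction s with
  | zero => exact Finset.mem_univ _
  | succ s ih =>
    match s with
    | 0 => exact Finset.mem_univ _
    | s + 1 =>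
      have hbs := ih (by omega) fun j hj => hA j (by omega)
      simp only [active, Finset.mem_filter]
      refine ⟨hbs, fun a ha => ?_⟩
      have hA' := hA (s + 1) (by omega) (by omega)
      have hs' : s + 1 ∈ Finset.Icc 1 p.S := Finset.mem_Icc.2 ⟨by omega, by omega⟩
      have h1 := abs_le.1 (abs_score_sub_le h htie hr hs' hn a)
      have h2 := abs_le.1 (abs_score_sub_le h htie hr hs' hn b)
      have h3 := width_le_of_not_condA hA' ha
      have h4 := width_le_of_not_condA hA' hbs
      have h5 := hb a
      -- Both scores are off by at most the current 2⁻ˢ, so the best arm trails any candidate by at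
      -- most 2·2⁻ˢ, the elimination margin.
      linarith [h1.2, h2.1]

/-- A survivor of the previous level has a score gap of at most twice that level's 2⁻ʲ, and two
width errors add the same amount: 4·2⁻ʲ = 8·2⁻ˢ for j = s-1. At level one the trivial gap 1 is at
most 4L_μ. -/
theorem sigmoid_gap_le_of_mem_active (h : Admissible p x θ)
    (htie : ∀ t (A : Finset (Fin p.K)), A.Nonempty → tie t A ∈ A) (hr : NoiseBounds p tie x θ r)
    (hn : n < p.T) {b : Fin p.K}
    (hb : ∀ a, (inner ℝ (x (n + 1) a) θ : ℝ) ≤ inner ℝ (x (n + 1) b) θ) (hs1 : 1 ≤ s)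
    (hs : s ≤ p.S + 1)
    (hA : ∀ j < s, 1 ≤ j → ¬ condA p x r (run p tie x r n) (n + 1) j) {a : Fin p.K}
    (ha : a ∈ active p x r (run p tie x r n) (n + 1) s) :
    Real.sigmoid (inner ℝ (x (n + 1) b) θ) - Real.sigmoid (inner ℝ (x (n + 1) a) θ) ≤
      p.Lμ * (8 * (1 / 2) ^ s) := by
  match s with
  | 0 => omega
  | 1 =>
    have h1 := h.le_Lμ
    have h2 := Real.sigmoid_lt_one (inner ℝ (x (n + 1) b) θ)
    have h3 := Real.sigmoid_pos (inner ℝ (x (n + 1) a) θ)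
    linarith
  | s + 2 =>
    have hbs := mem_active_of_isMax h htie hr hn hb (s := s + 1) (by omega)
      fun j hj => hA j (by omega)
    simp only [active, Finset.mem_filter] at ha
    have hA' := hA (s + 1) (by omega) (by omega)
    have hs' : s + 1 ∈ Finset.Icc 1 p.S := Finset.mem_Icc.2 ⟨by omega, by omega⟩
    have h1 := abs_le.1 (abs_score_sub_le h htie hr hs' hn a)
    have h2 := abs_le.1 (abs_score_sub_le h htie hr hs' hn b)
    have h3 := width_le_of_not_condA hA' ha.1
    have h4 := width_le_of_not_condA hA' hbs
    have h5 := ha.2 b hbs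
    refine (sigmoid_sub_le h.le_Lμ (hb a)).trans ?_
    apply mul_le_mul_of_nonneg_left _ h.Lμ_pos.le
    have h6 : (1 / 2 : ℝ) ^ (s + 2) = (1 / 2) ^ (s + 1) * (1 / 2) := pow_succ _ _
    rw [h6]
    linarith [h1.1, h2.1, h1.2, h2.2]

/-- The regret of round `t` when arm `a` is chosen. -/
def roundRegret (p : Params) (θ : Vec p.d) (x : ℕ → Fin p.K → Vec p.d) (t : ℕ) (a : Fin p.K) : ℝ :=
  Real.sigmoid (⨆ b, inner ℝ (x t b) θ) - Real.sigmoid (inner ℝ (x t a) θ)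

/-- A round either adds its index to the sets of a level `s ≤ S`, or stops by condition (b), or
reaches level `S + 1`. -/
theorem roundRegret_cases (h : Admissible p x θ)
    (htie : ∀ t (A : Finset (Fin p.K)), A.Nonempty → tie t A ∈ A) (hr : NoiseBounds p tie x θ r)
    (hn : n < p.T) :
    (∃ s ∈ Finset.Icc 1 p.S, stopLevel p x r (run p tie x r n) (n + 1) = s ∧
        condA p x r (run p tie x r n) (n + 1) s ∧
        roundRegret p θ x (n + 1) (action p tie x r (n + 1)) ≤ p.Lμ * (8 * (1 / 2) ^ s)) ∨
    ((∀ s ∈ Finset.Icc 1 p.S, ¬ (stopLevel p x r (run p tie x r n) (n + 1) = s ∧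
        condA p x r (run p tie x r n) (n + 1) s)) ∧
      (roundRegret p θ x (n + 1) (action p tie x r (n + 1)) ≤ p.Lμ * (2 / √p.T) ∨
        (roundRegret p θ x (n + 1) (action p tie x r (n + 1)) ≤ p.Lμ * (8 / √p.T) ∧
          1 / √p.T ≤ p.α / √(p.κ * p.lam)))) := by
  have : Nonempty (Fin p.K) := ⟨⟨0, h.one_le_K⟩⟩
  obtain ⟨b, hb⟩ := exists_eq_ciSup_of_finite (f := fun a => (inner ℝ (x (n + 1) a) θ : ℝ))
  have hbmax : ∀ a, (inner ℝ (x (n + 1) a) θ : ℝ) ≤ inner ℝ (x (n + 1) b) θ := fun a => by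
    have := le_ciSup (Set.finite_range fun a => (inner ℝ (x (n + 1) a) θ : ℝ)).bddAbove a
    rw [← hb] at this
    exact this
  have hreg : ∀ a, roundRegret p θ x (n + 1) a =
      Real.sigmoid (inner ℝ (x (n + 1) b) θ) - Real.sigmoid (inner ℝ (x (n + 1) a) θ) := fun a => by
    unfold roundRegret
    rw [← hb]
  rw [hreg, action_succ]
  set σ := run p tie x r n with hσ
  obtain ⟨s, hs⟩ : ∃ s, stopLevel p x r σ (n + 1) = s := ⟨_, rfl⟩
  obtain ⟨hs1, hAB, hlt⟩ := (stopLevel_eq_iff h.one_le_T).1 hs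
  have hTpos : 0 < √(p.T : ℝ) := Real.sqrt_pos.2 h.T_pos
  -- At level S+1 one of (a), (b) always holds: if no width exceeds 2^-(S+1), all are at most 1/√T.
  have hsS : s ≤ p.S + 1 := by
    by_contra hgt
    refine hlt (p.S + 1) (by omega) (by omega) (or_iff_not_imp_left.2 fun hA a ha => ?_)
    exact (width_le_of_not_condA hA ha).trans h.half_pow_le
  have hnA : ∀ j < s, 1 ≤ j → ¬ condA p x r σ (n + 1) j := fun j hj h1 hA => hlt j hj h1 (Or.inl hA)
  have hmem : choice p x r σ (n + 1) tie ∈ active p x r σ (n + 1) s := by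
    by_cases hA : condA p x r σ (n + 1) s
    · exact (choice_spec_condA h.one_le_K htie hs hA).1
    · exact (choice_spec_not_condA h.one_le_K htie hs hA).1
  have hgap := sigmoid_gap_le_of_mem_active h htie hr hn hbmax hs1 hsS hnA hmem
  rcases hsS.lt_or_eq with hlt' | rfl
  · have hsm : s ∈ Finset.Icc 1 p.S := Finset.mem_Icc.2 ⟨hs1, by omega⟩
    by_cases hA : condA p x r σ (n + 1) s
    · exact Or.inl ⟨s, hsm, hs, hA, hgap⟩
    · refine Or.inr ⟨?_, Or.inl ?_⟩
      · rintro s' - ⟨hs', hA'⟩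
        rw [hs] at hs'
        exact hA (hs' ▸ hA')
      · have hB := hAB.resolve_left hA
        have hbs := mem_active_of_isMax h htie hr hn hbmax hsS hnA
        have h1 := (choice_spec_not_condA h.one_le_K htie hs hA).2 b hbs
        have h2 := abs_le.1 (abs_score_sub_le h htie hr hsm hn b)
        have h3 := abs_le.1 (abs_score_sub_le h htie hr hsm hn (choice p x r σ (n + 1) tie))
        have h4 := hB b hbs
        have h5 := hB _ hmem
        refine (sigmoid_sub_le h.le_Lμ (hbmax _)).trans ?_
        apply mul_le_mul_of_nonneg_left _ h.Lμ_pos.le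
        have h6 : 2 / √(p.T : ℝ) = 1 / √p.T + 1 / √p.T := by ring
        rw [h6]
        linarith [h2.1, h3.2]
  · refine Or.inr ⟨?_, Or.inr ⟨?_, ?_⟩⟩
    · rintro s' hs' ⟨hs'', -⟩
      have := (Finset.mem_Icc.1 hs').2
      omega
    · refine hgap.trans (mul_le_mul_of_nonneg_left ?_ h.Lμ_pos.le)
      have := h.half_pow_le
      calc 8 * (1 / 2 : ℝ) ^ (p.S + 1) ≤ 8 * (1 / √p.T) := by gcongr
        _ = 8 / √p.T := by ring
    -- Failure of (b) at level S exhibits a width above 1/√T, while every width is at most α/√(κλ).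
    -- The comparison is recorded for the case of a short horizon.
    · have hS := hlt p.S (by omega) h.one_le_S
      have hnB : ¬ condB p x r σ (n + 1) p.S := fun hB => hS (Or.inr hB)
      unfold condB at hnB
      push Not at hnB
      obtain ⟨a, -, ha⟩ := hnB
      refine ha.le.trans ?_
      unfold width
      rw [div_eq_mul_inv p.α, ← Real.sqrt_inv]
      refine mul_le_mul_of_nonneg_left (Real.sqrt_le_sqrt ?_) h.α_pos.le
      refine (invNormSq_design_le h.κ_mul_lam_pos _ _ (by simp) _).trans ?_
      rw [← one_div]
      refine div_le_div_of_nonneg_right ?_ h.κ_mul_lam_pos.le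
      exact pow_le_one₀ (norm_nonneg _) (h.norm_le _ (Finset.mem_Icc.2 ⟨by omega, hn⟩) _)

/-- The number of rounds that level `s` has collected after `n` rounds. -/
def levelCount (p : Params) (tie : ℕ → Finset (Fin p.K) → Fin p.K) (x : ℕ → Fin p.K → Vec p.d)
    (r : ℕ → ℝ) (n s : ℕ) : ℝ :=
  ((run p tie x r n).P s).card + ((run p tie x r n).E s).card

open Classical in
theorem card_run_succ (s : ℕ) :
    ((run p tie x r (n + 1)).P s).card + ((run p tie x r (n + 1)).E s).card =
      ((run p tie x r n).P s).card + ((run p tie x r n).E s).card +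
        if s = stopLevel p x r (run p tie x r n) (n + 1) ∧
          condA p x r (run p tie x r n) (n + 1) s then 1 else 0 := by
  by_cases hA : stopLevel p x r (run p tie x r n) (n + 1) = s ∧
      condA p x r (run p tie x r n) (n + 1) s
  · rw [if_pos ⟨hA.1.symm, hA.2⟩]
    by_cases hτ : p.τ s < invNormSq (VP p x (run p tie x r n) s)
        (x (n + 1) (choice p x r (run p tie x r n) (n + 1) tie))
    · have hP : AddsP p x r (run p tie x r n) (n + 1) tie s := ⟨hA.1, hA.2, hτ⟩
      have hE : ¬ AddsE p x r (run p tie x r n) (n + 1) tie s := fun hE => hE.2.2 hτ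
      rw [run, step_P_of_adds hP, step_E_of_not_adds hE,
        Finset.card_insert_of_notMem (run_P_notMem n s)]
      omega
    · have hE : AddsE p x r (run p tie x r n) (n + 1) tie s := ⟨hA.1, hA.2, hτ⟩
      have hP : ¬ AddsP p x r (run p tie x r n) (n + 1) tie s := fun hP => hτ hP.2.2
      rw [run, step_E_of_adds hE, step_P_of_not_adds hP,
        Finset.card_insert_of_notMem (run_E_notMem n s)]
      omega
  · rw [if_neg fun h' => hA ⟨h'.1.symm, h'.2⟩, run,
      step_P_of_not_adds fun h' => hA ⟨h'.1, h'.2.1⟩,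
      step_E_of_not_adds fun h' => hA ⟨h'.1, h'.2.1⟩]
    omega

/-- Used with weight 1 to count rounds and with weight 8·2⁻ˢ to accumulate regret; this is why
`sum_roundRegret_le` carries a factor `1 *`. -/
theorem sum_levelCount_succ (w : ℕ → ℝ) {s : ℕ} (hs : s ∈ Finset.Icc 1 p.S)
    (hlev : stopLevel p x r (run p tie x r n) (n + 1) = s)
    (hA : condA p x r (run p tie x r n) (n + 1) s) :
    ∑ j ∈ Finset.Icc 1 p.S, w j * levelCount p tie x r (n + 1) j =
      ∑ j ∈ Finset.Icc 1 p.S, w j * levelCount p tie x r n j + w s := by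
  classical
  have e : ∀ j ∈ Finset.Icc 1 p.S, w j * levelCount p tie x r (n + 1) j =
      w j * levelCount p tie x r n j + if j = s then w j else 0 := by
    intro j _
    have hj := card_run_succ (p := p) (tie := tie) (x := x) (r := r) (n := n) j
    unfold levelCount
    rw [← Nat.cast_add, ← Nat.cast_add, hj, hlev]
    by_cases hj : j = s
    · subst hj
      simp only [hA, and_self, if_true]
      push_cast
      ring
    · simp [hj]
  rw [Finset.sum_congr rfl e, Finset.sum_add_distrib, Finset.sum_ite_eq' _ _ w, if_pos hs]

theorem sum_levelCount_succ_of_not (w : ℕ → ℝ)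
    (hA : ∀ s ∈ Finset.Icc 1 p.S, ¬ (stopLevel p x r (run p tie x r n) (n + 1) = s ∧
        condA p x r (run p tie x r n) (n + 1) s)) :
    ∑ j ∈ Finset.Icc 1 p.S, w j * levelCount p tie x r (n + 1) j =
      ∑ j ∈ Finset.Icc 1 p.S, w j * levelCount p tie x r n j := by
  classical
  refine Finset.sum_congr rfl fun j hj => ?_
  unfold levelCount
  rw [← Nat.cast_add, ← Nat.cast_add, card_run_succ j,
    if_neg fun h' => hA j hj ⟨h'.1.symm, h'.2⟩, add_zero]

/-- The regret in terms of the sizes of the level sets and the number `m` of rounds that reach level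
`S + 1`. -/
theorem sum_roundRegret_le (h : Admissible p x θ)
    (htie : ∀ t (A : Finset (Fin p.K)), A.Nonempty → tie t A ∈ A) (hr : NoiseBounds p tie x θ r)
    (hn : n ≤ p.T) :
    ∃ m : ℕ, ∑ s ∈ Finset.Icc 1 p.S, 1 * levelCount p tie x r n s + m ≤ n ∧
      ∑ t ∈ Finset.Icc 1 n, roundRegret p θ x t (action p tie x r t) ≤
        p.Lμ * (∑ s ∈ Finset.Icc 1 p.S, (8 * (1 / 2) ^ s) * levelCount p tie x r n s +
          2 / √p.T * n + 8 / √p.T * m) ∧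
      (0 < m → 1 / √p.T ≤ p.α / √(p.κ * p.lam)) := by
  have hLμ := h.Lμ_pos
  induction n with
  | zero => exact ⟨0, by simp [run, levelCount], by simp [run, levelCount], by simp⟩
  | succ n ih =>
    obtain ⟨m, h1, h2, h3⟩ := ih (by omega)
    have hT2 : 0 ≤ p.Lμ * (2 / √p.T) := by positivity
    rcases roundRegret_cases h htie hr (show n < p.T by omega) with
      ⟨s, hs, hlev, hA, hreg⟩ | ⟨hA, hreg | ⟨hreg, hα⟩⟩
    · refine ⟨m, ?_, ?_, h3⟩
      · rw [sum_levelCount_succ _ hs hlev hA]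
        push_cast
        linarith
      · rw [sum_levelCount_succ _ hs hlev hA, Finset.sum_Icc_succ_top (by omega)]
        push_cast
        linarith
    · refine ⟨m, ?_, ?_, h3⟩
      · rw [sum_levelCount_succ_of_not _ hA]
        push_cast
        linarith
      · rw [sum_levelCount_succ_of_not _ hA, Finset.sum_Icc_succ_top (by omega)]
        push_cast
        linarith
    · refine ⟨m + 1, ?_, ?_, fun _ => hα⟩
      · rw [sum_levelCount_succ_of_not _ hA]
        push_cast
        linarith
      · rw [sum_levelCount_succ_of_not _ hA, Finset.sum_Icc_succ_top (by omega)]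
        push_cast
        linarith

end Round

/-! ### Summation of the regret over all rounds. -/

section Bound

variable {p : Params} {tie : ℕ → Finset (Fin p.K) → Fin p.K} {x : ℕ → Fin p.K → Vec p.d}
  {θ : Vec p.d} {r : ℕ → ℝ}

/-- Dividing by the minimum in τ turns 2⁻ˢ into max(2⁻ˢ, R), which is bounded by the sum 2⁻ˢ + R. -/
theorem card_run_P_mul_half_pow_le (h : Admissible p x θ) (r : ℕ → ℝ) (s : ℕ) :
    (1 / 2) ^ s * ((run p tie x r p.T).P s).card ≤
      2 * p.d * p.logTerm * p.β ^ 2 * ((1 / 2) ^ s + √(32 * p.Lμ * p.κ * p.d * p.logTerm)) := by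
  have hcard := card_run_P_le (tie := tie) h r s le_rfl
  have hβ := h.β_pos
  have hd := h.d_pos
  have hℓ := h.logTerm_pos
  have hκ := h.κ_pos
  have hLμ := h.Lμ_pos
  unfold Params.τ at hcard
  set R := √(32 * p.Lμ * p.κ * p.d * p.logTerm) with hR
  have hR0 : 0 < R := Real.sqrt_pos.2 (by positivity)
  have hc0 : (0 : ℝ) ≤ ((run p tie x r p.T).P s).card := Nat.cast_nonneg _
  generalize (((run p tie x r p.T).P s).card : ℝ) = c at hcard hc0 ⊢
  set h' : ℝ := (1 / 2) ^ s with hh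
  have hh0 : 0 < h' := by positivity
  have h1 : c * min 1 (h' / R) ≤ 2 * p.d * p.logTerm * p.β ^ 2 := by
    calc c * min 1 (h' / R) = (c * (1 / p.β ^ 2 * min 1 (h' / R))) * p.β ^ 2 := by
          field_simp
      _ ≤ _ := by gcongr
  have h2 : h' ≤ min 1 (h' / R) * (h' + R) := by
    rcases min_cases 1 (h' / R) with ⟨e, -⟩ | ⟨e, -⟩ <;> rw [e]
    · linarith
    · rw [mul_add, div_mul_cancel₀ _ hR0.ne']
      have : 0 ≤ h' / R * h' := by positivity
      linarith
  calc h' * c ≤ (min 1 (h' / R) * (h' + R)) * c := by gcongr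
    _ = c * min 1 (h' / R) * (h' + R) := by ring
    _ ≤ _ := by gcongr

theorem sum_half_pow_le (S : ℕ) : ∑ s ∈ Finset.Icc 1 S, (1 / 2 : ℝ) ^ s ≤ 1 := by
  suffices ∑ s ∈ Finset.Icc 1 S, (1 / 2 : ℝ) ^ s = 1 - (1 / 2) ^ S by
    rw [this]
    have : (0 : ℝ) < (1 / 2) ^ S := by positivity
    linarith
  induction S with
  | zero => simp
  | succ n ih =>
    rw [Finset.sum_Icc_succ_top (by omega), ih, pow_succ]
    ring

theorem sum_mul_sq_le {ι : Type*} (I : Finset ι) (w : ι → ℝ) {e : ι → ℝ} (he : ∀ i, 0 ≤ e i) :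
    (∑ i ∈ I, w i * e i) ^ 2 ≤ (∑ i ∈ I, e i * w i ^ 2) * ∑ i ∈ I, e i := by
  have hcs := Finset.sum_mul_sq_le_sq_mul_sq I (fun i => w i * √(e i)) (fun i => √(e i))
  have e1 : ∀ i, w i * √(e i) * √(e i) = w i * e i := fun i => by
    rw [mul_assoc, Real.mul_self_sqrt (he i)]
  have e2 : ∀ i, (w i * √(e i)) ^ 2 = e i * w i ^ 2 := fun i => by
    rw [mul_pow, Real.sq_sqrt (he i), mul_comm]
  have e3 : ∀ i, √(e i) ^ 2 = e i := fun i => Real.sq_sqrt (he i)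
  simpa only [e1, e2, e3] using hcs

/-- The `m` rounds that reach level S+1 are paid for together with the estimation rounds, without an
extra term. The argument depends on whether the horizon T exceeds κλd. -/
theorem sum_card_run_E_le (h : Admissible p x θ)
    (htie : ∀ t (A : Finset (Fin p.K)), A.Nonempty → tie t A ∈ A) (r : ℕ → ℝ) {m : ℕ}
    (hm : ∑ s ∈ Finset.Icc 1 p.S, (((run p tie x r p.T).E s).card : ℝ) + m ≤ p.T)
    (hα : 0 < m → 1 / √p.T ≤ p.α / √(p.κ * p.lam)) :
    ∑ s ∈ Finset.Icc 1 p.S, (1 / 2) ^ s * (((run p tie x r p.T).E s).card : ℝ) + 1 / √p.T * m ≤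
      p.α * √(2 * p.S * p.T * p.d * p.logTerm) := by
  have hd := h.d_pos
  have hℓ := h.logTerm_pos
  have hc := h.κ_mul_lam_pos
  have hT := h.T_pos
  have hS := h.S_pos
  have hα0 := h.α_pos
  obtain ⟨e, he⟩ : ∃ e : ℕ → ℝ, ∀ s, (((run p tie x r p.T).E s).card : ℝ) = e s :=
    ⟨_, fun _ => rfl⟩
  have he0 : ∀ s, 0 ≤ e s := fun s => he s ▸ Nat.cast_nonneg _
  simp only [he] at hm ⊢
  have hm0 : (0 : ℝ) ≤ m := Nat.cast_nonneg _
  -- For a short horizon each round costs at most the maximal width α/√(κλ), and ℓ ≥ T/(2κλd) makes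
  -- the trivial total αT/√(κλ) small enough. For a long horizon ℓ ≥ log 2, so c = α√(2Sdℓ) ≥ 2 and
  -- Cauchy-Schwarz gives c√N for the estimation rounds.
  rcases le_or_gt (p.T : ℝ) (p.κ * p.lam * p.d) with hsmall | hlarge
  · have hg : 0 ≤ p.α / √(p.κ * p.lam) := by positivity
    have h1 : ∀ s ∈ Finset.Icc 1 p.S, (1 / 2) ^ s * e s ≤ p.α / √(p.κ * p.lam) * e s := by
      intro s _
      rcases ((run p tie x r p.T).E s).eq_empty_or_nonempty with h0 | ⟨i, hi⟩
      · simp [← he, h0]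
      · exact mul_le_mul_of_nonneg_right (half_pow_le_of_mem_E h htie r s le_rfl hi) (he0 s)
    have h2 : 1 / √p.T * (m : ℝ) ≤ p.α / √(p.κ * p.lam) * m := by
      rcases Nat.eq_zero_or_pos m with rfl | hmp
      · simp
      · exact mul_le_mul_of_nonneg_right (hα hmp) hm0
    have h3 : ∑ s ∈ Finset.Icc 1 p.S, (1 / 2) ^ s * e s + 1 / √p.T * m ≤
        p.α / √(p.κ * p.lam) * p.T := by
      calc _ ≤ ∑ s ∈ Finset.Icc 1 p.S, p.α / √(p.κ * p.lam) * e s + p.α / √(p.κ * p.lam) * m :=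
            add_le_add (Finset.sum_le_sum h1) h2
        _ = p.α / √(p.κ * p.lam) * (∑ s ∈ Finset.Icc 1 p.S, e s + m) := by
            rw [← Finset.mul_sum]; ring
        _ ≤ _ := mul_le_mul_of_nonneg_left hm hg
    refine h3.trans ?_
    have h4 : (p.T : ℝ) / (p.κ * p.lam * p.d) / 2 ≤ p.logTerm :=
      div_two_le_log_one_add (by positivity) ((div_le_one (by positivity)).2 hsmall)
    have h5 : (p.T : ℝ) / √(p.κ * p.lam) ≤ √(2 * p.S * p.T * p.d * p.logTerm) := by
      apply Real.le_sqrt_of_sq_le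
      rw [div_pow, Real.sq_sqrt hc.le]
      have hS1 : (1 : ℝ) ≤ p.S := by exact_mod_cast h.one_le_S
      calc (p.T : ℝ) ^ 2 / (p.κ * p.lam) =
            2 * 1 * p.T * p.d * (p.T / (p.κ * p.lam * p.d) / 2) := by field_simp
        _ ≤ _ := by gcongr
    calc p.α / √(p.κ * p.lam) * p.T = p.α * (p.T / √(p.κ * p.lam)) := by ring
      _ ≤ _ := by gcongr
  · set c := p.α * √(2 * p.S * p.d * p.logTerm) with hcdef
    have hℓ2 : Real.log 2 ≤ p.logTerm := by
      apply Real.log_le_log (by norm_num)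
      have : 1 ≤ (p.T : ℝ) / (p.κ * p.lam * p.d) := (one_le_div (by positivity)).2 hlarge.le
      linarith
    have hc2 : 2 ≤ c := by
      have h1 : 1 ≤ √(2 * p.S * p.d * p.logTerm) := by
        apply Real.le_sqrt_of_sq_le
        have hS1 : (1 : ℝ) ≤ p.S := by exact_mod_cast h.one_le_S
        have hd1 : (1 : ℝ) ≤ p.d := by exact_mod_cast h.one_le_d
        have hl := Real.log_two_gt_d9
        calc (1 : ℝ) ^ 2 ≤ 2 * 1 * 1 * (1 / 2) := by norm_num
          _ ≤ _ := by gcongr; linarith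
      have h2 := h.α_ge
      rw [hcdef]
      nlinarith
    set N := ∑ s ∈ Finset.Icc 1 p.S, e s with hN
    have hN0 : 0 ≤ N := Finset.sum_nonneg fun s _ => he0 s
    have hNT : N ≤ p.T := by linarith
    have h1 : ∑ s ∈ Finset.Icc 1 p.S, (1 / 2) ^ s * e s ≤ c * √N := by
      have hcs := sum_mul_sq_le (Finset.Icc 1 p.S) (fun s => (1 / 2 : ℝ) ^ s) he0
      have h2 : ∑ s ∈ Finset.Icc 1 p.S, e s * ((1 / 2) ^ s) ^ 2 ≤ c ^ 2 := by
        calc ∑ s ∈ Finset.Icc 1 p.S, e s * ((1 / 2) ^ s) ^ 2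
            ≤ ∑ s ∈ Finset.Icc 1 p.S, p.α ^ 2 * (2 * p.d * p.logTerm) :=
              Finset.sum_le_sum fun s _ => he s ▸ card_run_E_le h htie r s le_rfl
          _ = c ^ 2 := by
              rw [hcdef, mul_pow, Real.sq_sqrt (by positivity)]
              simp only [Finset.sum_const, Nat.card_Icc, nsmul_eq_mul, Nat.add_sub_cancel]
              ring
      have h3 : (∑ s ∈ Finset.Icc 1 p.S, (1 / 2) ^ s * e s) ^ 2 ≤ (c * √N) ^ 2 := by
        refine hcs.trans ?_
        rw [mul_pow, Real.sq_sqrt hN0]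
        gcongr
      exact le_of_sq_le_sq h3 (by positivity)
    have h2 : c * √N + 1 / √p.T * m ≤ c * √p.T := by
      have hsT : 0 < √(p.T : ℝ) := Real.sqrt_pos.2 hT
      have hsN : √N ≤ √p.T := Real.sqrt_le_sqrt hNT
      have hsq : √(p.T : ℝ) ^ 2 = p.T := Real.sq_sqrt hT.le
      have hsqN : √N ^ 2 = N := Real.sq_sqrt hN0
      have hsN0 := Real.sqrt_nonneg N
      -- m ≤ T - N = (√T - √N)(√T + √N) ≤ 2√T(√T - √N). The remaining rounds thus cost at most 2(√T
      -- - √N), which fits into the gap c(√T - √N).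
      have h3 : (m : ℝ) ≤ 2 * √p.T * (√p.T - √N) := by nlinarith
      calc c * √N + 1 / √p.T * m ≤ c * √N + 1 / √p.T * (2 * √p.T * (√p.T - √N)) := by gcongr
        _ = c * √N + 2 * (√p.T - √N) := by field_simp
        _ ≤ c * √N + c * (√p.T - √N) := by
            gcongr
        _ = c * √p.T := by ring
    have h3 : c * √p.T = p.α * √(2 * p.S * p.T * p.d * p.logTerm) := by
      rw [hcdef, mul_assoc, ← Real.sqrt_mul' _ hT.le]
      congr 2
      ring
    linarith

theorem regret_le_of_noiseBounds (h : Admissible p x θ)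
    (htie : ∀ t (A : Finset (Fin p.K)), A.Nonempty → tie t A ∈ A) (hr : NoiseBounds p tie x θ r) :
    regret p θ x (action p tie x r) ≤ p.regretBound := by
  obtain ⟨m, h1, h2, h3⟩ := sum_roundRegret_le h htie hr le_rfl
  have hLμ := h.Lμ_pos
  have hT := h.T_pos
  have hsT : √(p.T : ℝ) * √p.T = p.T := Real.mul_self_sqrt hT.le
  have hsT0 : 0 < √(p.T : ℝ) := Real.sqrt_pos.2 hT
  simp only [levelCount, one_mul, mul_add, Finset.sum_add_distrib] at h1 h2
  have hP0 : 0 ≤ ∑ s ∈ Finset.Icc 1 p.S, (((run p tie x r p.T).P s).card : ℝ) :=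
    Finset.sum_nonneg fun _ _ => Nat.cast_nonneg _
  have hE := sum_card_run_E_le h htie r (m := m) (by linarith) h3
  have hP : ∑ s ∈ Finset.Icc 1 p.S, 8 * (1 / 2) ^ s * (((run p tie x r p.T).P s).card : ℝ) ≤
      16 * p.d * p.logTerm * p.β ^ 2 *
        (1 + p.S * √(32 * p.Lμ * p.κ * p.d * p.logTerm)) := by
    have hd := h.d_pos
    have hℓ := h.logTerm_pos
    calc ∑ s ∈ Finset.Icc 1 p.S, 8 * (1 / 2) ^ s * (((run p tie x r p.T).P s).card : ℝ)
        ≤ ∑ s ∈ Finset.Icc 1 p.S, 8 * (2 * p.d * p.logTerm * p.β ^ 2 *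
            ((1 / 2) ^ s + √(32 * p.Lμ * p.κ * p.d * p.logTerm))) := by
          refine Finset.sum_le_sum fun s _ => ?_
          rw [mul_assoc]
          exact mul_le_mul_of_nonneg_left (card_run_P_mul_half_pow_le h r s) (by norm_num)
      _ = 16 * p.d * p.logTerm * p.β ^ 2 * (∑ s ∈ Finset.Icc 1 p.S, (1 / 2 : ℝ) ^ s +
            p.S * √(32 * p.Lμ * p.κ * p.d * p.logTerm)) := by
          rw [← Finset.mul_sum, ← Finset.mul_sum, Finset.sum_add_distrib]
          simp only [Finset.sum_const, Nat.card_Icc, nsmul_eq_mul, Nat.add_sub_cancel]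
          ring
      _ ≤ _ := by
          gcongr
          exact sum_half_pow_le _
  have hE' : ∑ s ∈ Finset.Icc 1 p.S, 8 * (1 / 2) ^ s * (((run p tie x r p.T).E s).card : ℝ) +
      8 / √p.T * m ≤ 8 * (p.α * √(2 * p.S * p.T * p.d * p.logTerm)) := by
    refine le_trans (le_of_eq ?_) (mul_le_mul_of_nonneg_left hE (by norm_num))
    rw [mul_add, Finset.mul_sum]
    congr 1
    · exact Finset.sum_congr rfl fun _ _ => by ring
    · ring
  have hB : 2 / √p.T * (p.T : ℝ) = 2 * √p.T := by
    rw [div_mul_eq_mul_div, div_eq_iff hsT0.ne', mul_assoc, hsT]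
  have hreg : regret p θ x (action p tie x r) =
      ∑ t ∈ Finset.Icc 1 p.T, roundRegret p θ x t (action p tie x r t) := rfl
  rw [hreg]
  refine h2.trans ?_
  rw [hB]
  unfold Params.regretBound
  have hP' := mul_le_mul_of_nonneg_left hP hLμ.le
  have hE'' := mul_le_mul_of_nonneg_left hE' hLμ.le
  rw [mul_add] at hE''
  linarith

end Bound

/-! ### Union bound over levels, rounds, arms and signs. -/

section Confidence

variable {p : Params} {tie : ℕ → Finset (Fin p.K) → Fin p.K} {x : ℕ → Fin p.K → Vec p.d}
  {θ : Vec p.d}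

theorem estNoise_congr {r r' : ℕ → ℝ} {n : ℕ} (h : ∀ i ∈ Finset.Icc 1 n, r i = r' i)
    (θ : Vec p.d) (s : ℕ) (v : Vec p.d) :
    estNoise p tie x θ s n v r = estNoise p tie x θ s n v r' := by
  have hrun : run p tie x r n = run p tie x r' n := run_congr_rewards' h
  have hdir : estDir p tie x s n v r = estDir p tie x s n v r' := by
    unfold estDir
    rw [hrun, pilot_congr p (fun _ _ => rfl) fun i hi => h i (run_P_subset n s hi)]
  unfold estNoise
  rw [hrun, hdir]
  refine Finset.sum_congr rfl fun i hi => ?_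
  rw [h i (run_E_subset n s hi)]

-- The estimation noise after n rounds sees only n rewards, so the tree may be cut at depth n before
-- Bernstein's bound is applied.
open Classical in
theorem treeExp_estNoise_horizon_le (h : Admissible p x θ) (s : ℕ) {n : ℕ} (hn : n < p.T)
    (v : Vec p.d) {sgn : ℝ} (hsgn : |sgn| = 1) :
    treeExp (rewardProb p tie x θ) p.T (fun r =>
      if p.α₁ * √(invNormSq (VE p x (run p tie x r n) s) v) < sgn * estNoise p tie x θ s n v r
        then 1 else 0) ≤ p.δ / (4 * p.T * p.S * p.K) := by
  rw [treeExp_of_le hn.le fun r k b hk => ?_]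
  · have hL := h.two_le_log
    have hexp : p.δ / (4 * p.T * p.S * p.K) =
        Real.exp (-Real.log (4 * p.T * p.S * p.K / p.δ)) := by
      rw [Real.exp_neg, Real.exp_log (by linarith [h.sixteen_le]), inv_div]
    rw [hexp]
    exact treeExp_estNoise_le h.one_le_T h.B_pos.le h.κ_pos h.lam_pos h.le_Lμ h.norm_le h.curvature
      θ s hn.le v (by linarith) hsgn
  · have hag : ∀ i ∈ Finset.Icc 1 n, Function.update r k b i = r i := fun i hi =>
      Function.update_of_ne (by have := (Finset.mem_Icc.1 hi).2; omega) _ _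
    have hrun : run p tie x (Function.update r k b) n = run p tie x r n := run_congr_rewards' hag
    rw [estNoise_congr hag, hrun]

-- The budget: S pilot events of probability δ/(2S), uniform over rounds by Ville's inequality, and
-- 2·T·S·K one-sided Bernstein events of probability δ/(4TSK), each half costing δ/2.
open Classical in
theorem treeExp_not_noiseBounds_le (h : Admissible p x θ) :
    treeExp (rewardProb p tie x θ) p.T (fun r => if NoiseBounds p tie x θ r then 0 else 1) ≤
      p.δ := by
  have hS := h.S_pos
  have hT := h.T_pos
  have hδ := h.δ_pos
  have hK : (0 : ℝ) < p.K := by exact_mod_cast h.one_le_K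
  let bad1 : ℕ → (ℕ → ℝ) → ℝ := fun s r =>
    if ∃ n ≤ p.T, 0.5 * p.d * p.logTerm + 0.5 * Real.log (2 * p.S / p.δ) <
      invNormSq (VP p x (run p tie x r n) s) (pilotNoise p tie x θ s n r) then 1 else 0
  let bad2 : ℕ → ℕ → Fin p.K → ℝ → (ℕ → ℝ) → ℝ := fun s n a sgn r =>
    if p.α₁ * √(invNormSq (VE p x (run p tie x r n) s) (x (n + 1) a)) <
      sgn * estNoise p tie x θ s n (x (n + 1) a) r then 1 else 0
  have hbad1 : ∀ s r, 0 ≤ bad1 s r := fun s r => by simp only [bad1]; split_ifs <;> norm_num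
  have hbad2 : ∀ s n a sgn r, 0 ≤ bad2 s n a sgn r := fun s n a sgn r => by
    simp only [bad2]; split_ifs <;> norm_num
  have hle : ∀ r, (if NoiseBounds p tie x θ r then (0 : ℝ) else 1) ≤
      ∑ s ∈ Finset.Icc 1 p.S, bad1 s r + ∑ s ∈ Finset.Icc 1 p.S, ∑ n ∈ Finset.range p.T, ∑ a,
        (bad2 s n a 1 r + bad2 s n a (-1) r) := by
    intro r
    have h1 : 0 ≤ ∑ s ∈ Finset.Icc 1 p.S, bad1 s r := Finset.sum_nonneg fun s _ => hbad1 s r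
    have h2' : ∀ s n, 0 ≤ ∑ a, (bad2 s n a 1 r + bad2 s n a (-1) r) := fun s n =>
      Finset.sum_nonneg fun a _ => add_nonneg (hbad2 _ _ _ _ _) (hbad2 _ _ _ _ _)
    have h2'' : ∀ s, 0 ≤ ∑ n ∈ Finset.range p.T, ∑ a, (bad2 s n a 1 r + bad2 s n a (-1) r) :=
      fun s => Finset.sum_nonneg fun n _ => h2' s n
    have h2 : 0 ≤ ∑ s ∈ Finset.Icc 1 p.S, ∑ n ∈ Finset.range p.T, ∑ a,
        (bad2 s n a 1 r + bad2 s n a (-1) r) := Finset.sum_nonneg fun s _ => h2'' s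
    split_ifs with hN
    · exact add_nonneg h1 h2
    by_cases hP : ∀ s ∈ Finset.Icc 1 p.S, ∀ n ≤ p.T,
        invNormSq (VP p x (run p tie x r n) s) (pilotNoise p tie x θ s n r) ≤
          0.5 * p.d * p.logTerm + 0.5 * Real.log (2 * p.S / p.δ)
    · have hE : ¬ ∀ s ∈ Finset.Icc 1 p.S, ∀ n < p.T, ∀ a,
          |estNoise p tie x θ s n (x (n + 1) a) r| ≤
            p.α₁ * √(invNormSq (VE p x (run p tie x r n) s) (x (n + 1) a)) :=
        fun hE => hN ⟨hP, hE⟩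
      push Not at hE
      obtain ⟨s, hs, n, hn, a, hlt⟩ := hE
      have h3 : 1 ≤ bad2 s n a 1 r + bad2 s n a (-1) r := by
        rcases lt_abs.1 hlt with hlt | hlt
        · have : bad2 s n a 1 r = 1 := if_pos (by rwa [one_mul])
          linarith [hbad2 s n a (-1) r]
        · have : bad2 s n a (-1) r = 1 := if_pos (by rwa [neg_one_mul])
          linarith [hbad2 s n a 1 r]
      have h4 := Finset.single_le_sum (f := fun a => bad2 s n a 1 r + bad2 s n a (-1) r)
        (fun a _ => add_nonneg (hbad2 _ _ _ _ _) (hbad2 _ _ _ _ _)) (Finset.mem_univ a)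
      have h5 := Finset.single_le_sum
        (f := fun n => ∑ a, (bad2 s n a 1 r + bad2 s n a (-1) r)) (fun n _ => h2' s n)
        (Finset.mem_range.2 hn)
      have h6 := Finset.single_le_sum (f := fun s => ∑ n ∈ Finset.range p.T,
        ∑ a, (bad2 s n a 1 r + bad2 s n a (-1) r)) (fun s _ => h2'' s) hs
      linarith
    · push Not at hP
      obtain ⟨s, hs, n, hn, hlt⟩ := hP
      have h3 : bad1 s r = 1 := if_pos ⟨n, hn, hlt⟩
      have h4 := Finset.single_le_sum (f := fun s => bad1 s r) (fun s _ => hbad1 s r) hs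
      linarith
  refine (treeExp_mono (rewardProb_nonneg θ) (rewardProb_le_one θ) fun r _ => hle r).trans ?_
  rw [treeExp_add]
  simp only [treeExp_sum, treeExp_add]
  have hsum1 : ∑ s ∈ Finset.Icc 1 p.S, treeExp (rewardProb p tie x θ) p.T (bad1 s) ≤ p.δ / 2 := by
    calc _ ≤ ∑ s ∈ Finset.Icc 1 p.S, 1 / (2 * p.S / p.δ) :=
          Finset.sum_le_sum fun s _ => treeExp_pilotNoise_le h.one_le_d h.κ_mul_lam_pos h.norm_le
            θ s (by positivity)
      _ = p.δ / 2 := by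
          simp only [Finset.sum_const, Nat.card_Icc, nsmul_eq_mul, Nat.add_sub_cancel]
          field_simp
  have hsum2 : ∑ s ∈ Finset.Icc 1 p.S, ∑ n ∈ Finset.range p.T, ∑ a,
      (treeExp (rewardProb p tie x θ) p.T (bad2 s n a 1) +
        treeExp (rewardProb p tie x θ) p.T (bad2 s n a (-1))) ≤ p.δ / 2 := by
    calc _ ≤ ∑ s ∈ Finset.Icc 1 p.S, ∑ n ∈ Finset.range p.T, ∑ _a : Fin p.K,
          (p.δ / (4 * p.T * p.S * p.K) + p.δ / (4 * p.T * p.S * p.K)) :=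
          Finset.sum_le_sum fun s _ => Finset.sum_le_sum fun n hn => Finset.sum_le_sum fun a _ =>
            add_le_add
              (treeExp_estNoise_horizon_le h s (Finset.mem_range.1 hn) _ (by norm_num))
              (treeExp_estNoise_horizon_le h s (Finset.mem_range.1 hn) _ (by norm_num))
      _ = p.δ / 2 := by
          simp only [Finset.sum_const, Nat.card_Icc, nsmul_eq_mul, Nat.add_sub_cancel,
            Finset.card_range, Finset.card_univ, Fintype.card_fin]
          field_simp
          norm_num
  linarith

open Classical in
theorem treeExp_regret_gt_le (h : Admissible p x θ)
    (htie : ∀ t (A : Finset (Fin p.K)), A.Nonempty → tie t A ∈ A) :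
    treeExp (rewardProb p tie x θ) p.T
      (fun r => if regret p θ x (action p tie x r) ≤ p.regretBound then 0 else 1) ≤ p.δ := by
  refine le_trans (treeExp_mono (rewardProb_nonneg θ) (rewardProb_le_one θ) fun r _ => ?_)
    (treeExp_not_noiseBounds_le (tie := tie) h)
  by_cases hN : NoiseBounds p tie x θ r
  · rw [if_pos (regret_le_of_noiseBounds h htie hN), if_pos hN]
  · rw [if_neg hN]
    split_ifs <;> norm_num

end Confidence

/-! ### Measurability of the algorithm in the contexts, for fixed rewards. -/

section CountableRange

variable {Ω : Type*} [MeasurableSpace Ω] {β γ : Type*}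

/-- The function takes countably many values, each of them on a measurable set. -/
def CountablyMeasurable (f : Ω → β) : Prop :=
  (Set.range f).Countable ∧ ∀ y, MeasurableSet (f ⁻¹' {y})

theorem countablyMeasurable_const (b : β) : CountablyMeasurable fun _ : Ω => b :=
  ⟨(Set.countable_singleton b).mono (by rintro _ ⟨_, rfl⟩; rfl), fun _ => by
    classical
    rw [Set.preimage_const]
    split_ifs <;> simp⟩

theorem countablyMeasurable_of_discrete [MeasurableSpace γ] [DiscreteMeasurableSpace γ]
    [Countable γ] {g : Ω → γ} (hg : Measurable g) (F : γ → β) :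
    CountablyMeasurable fun ω => F (g ω) :=
  ⟨(Set.countable_range F).mono (Set.range_comp_subset_range g F),
    fun y => hg (MeasurableSet.of_discrete (s := F ⁻¹' {y}))⟩

/-- `State` carries no σ-algebra. Splitting Ω along its countably many attained values reduces
measurability to a fixed state. -/
theorem CountablyMeasurable.measurable_apply {f : Ω → β} (hf : CountablyMeasurable f)
    [MeasurableSpace γ] {g : β → Ω → γ} (hg : ∀ y ∈ Set.range f, Measurable (g y)) :
    Measurable fun ω => g (f ω) ω := by
  intro B hB
  have : (fun ω => g (f ω) ω) ⁻¹' B = ⋃ y ∈ Set.range f, f ⁻¹' {y} ∩ g y ⁻¹' B := by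
    ext ω
    simp only [Set.mem_preimage, Set.mem_iUnion, Set.mem_inter_iff, Set.mem_singleton_iff,
      exists_prop]
    exact ⟨fun h => ⟨f ω, ⟨ω, rfl⟩, rfl, h⟩, fun ⟨y, _, hy, h⟩ => hy ▸ h⟩
  rw [this]
  exact MeasurableSet.biUnion hf.1 fun y hy => (hf.2 y).inter (hg y hy hB)

theorem CountablyMeasurable.apply {f : Ω → β} (hf : CountablyMeasurable f)
    {g : β → Ω → γ} (hg : ∀ y ∈ Set.range f, CountablyMeasurable (g y)) :
    CountablyMeasurable fun ω => g (f ω) ω := by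
  refine ⟨(hf.1.biUnion fun y hy => (hg y hy).1).mono ?_, fun z => ?_⟩
  · rintro _ ⟨ω, rfl⟩
    exact Set.mem_biUnion ⟨ω, rfl⟩ ⟨ω, rfl⟩
  · have : (fun ω => g (f ω) ω) ⁻¹' {z} = ⋃ y ∈ Set.range f, f ⁻¹' {y} ∩ g y ⁻¹' {z} := by
      ext ω
      simp only [Set.mem_preimage, Set.mem_iUnion, Set.mem_inter_iff, Set.mem_singleton_iff,
        exists_prop]
      exact ⟨fun h => ⟨f ω, ⟨ω, rfl⟩, rfl, h⟩, fun ⟨y, _, hy, h⟩ => hy ▸ h⟩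
    rw [this]
    exact MeasurableSet.biUnion hf.1 fun y hy => (hf.2 y).inter ((hg y hy).2 z)

end CountableRange

section LinearAlgebra

variable {Ω : Type*} [MeasurableSpace Ω] {d : ℕ}

theorem measurable_det {M : Ω → Matrix (Fin d) (Fin d) ℝ}
    (hM : ∀ i j, Measurable fun ω => M ω i j) : Measurable fun ω => (M ω).det := by
  simp only [Matrix.det_apply]
  exact Finset.measurable_sum _ fun σ _ =>
    (Finset.measurable_prod _ fun i _ => hM _ _).const_smul _

/-- The inverse is the inverse determinant times the adjugate, whose entries are polynomial.
Singular matrices are covered because the scalar inverse of zero is zero. -/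
theorem measurable_inv_apply {M : Ω → Matrix (Fin d) (Fin d) ℝ}
    (hM : ∀ i j, Measurable fun ω => M ω i j) (i j : Fin d) :
    Measurable fun ω => (M ω)⁻¹ i j := by
  simp only [Matrix.inv_def, Matrix.smul_apply, Ring.inverse_eq_inv', Matrix.adjugate_apply,
    smul_eq_mul]
  refine (measurable_det hM).inv.mul (measurable_det fun k l => ?_)
  by_cases hk : k = j
  · subst hk
    simp only [Matrix.updateRow_self]
    exact measurable_const
  · simp only [Matrix.updateRow_ne hk]
    exact hM k l

theorem measurable_ofLp_apply {v : Ω → Vec d} (hv : Measurable v) (i : Fin d) :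
    Measurable fun ω => (v ω).ofLp i :=
  ((continuous_apply i).comp (PiLp.continuous_ofLp 2 _)).measurable.comp hv

theorem measurable_mulVec {M : Ω → Matrix (Fin d) (Fin d) ℝ} {v : Ω → Vec d}
    (hM : ∀ i j, Measurable fun ω => M ω i j) (hv : Measurable v) :
    Measurable fun ω => (M ω).mulVec (v ω).ofLp := by
  refine measurable_pi_lambda _ fun i => ?_
  simp only [Matrix.mulVec, dotProduct]
  exact Finset.measurable_sum _ fun j _ => (hM i j).mul (measurable_ofLp_apply hv j)

theorem measurable_invNormSq {M : Ω → Matrix (Fin d) (Fin d) ℝ} {v : Ω → Vec d}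
    (hM : ∀ i j, Measurable fun ω => M ω i j) (hv : Measurable v) :
    Measurable fun ω => invNormSq (M ω) (v ω) := by
  unfold invNormSq
  simp only [dotProduct]
  exact Finset.measurable_sum _ fun j _ => (measurable_ofLp_apply hv j).mul
    ((measurable_pi_apply j).comp (measurable_mulVec (measurable_inv_apply hM) hv))

theorem measurable_design (c : ℝ) {I : Finset ℕ} {w : Ω → ℕ → ℝ} {z : Ω → ℕ → Vec d}
    (hw : ∀ i ∈ I, Measurable fun ω => w ω i) (hz : ∀ i ∈ I, Measurable fun ω => z ω i)
    (k l : Fin d) : Measurable fun ω => design c I (w ω) (z ω) k l := by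
  unfold design
  simp only [Matrix.add_apply, Matrix.sum_apply, Matrix.smul_apply, Matrix.vecMulVec_apply,
    smul_eq_mul]
  refine measurable_const.add (Finset.measurable_sum _ fun i hi => ?_)
  exact (hw i hi).mul ((measurable_ofLp_apply (hz i hi) k).mul (measurable_ofLp_apply (hz i hi) l))

theorem measurable_sigmoid : Measurable Real.sigmoid := continuous_sigmoid.measurable

theorem measurable_grad (lam : ℝ) {I : Finset ℕ} {z : Ω → ℕ → Vec d} (r : ℕ → ℝ) {θ : Ω → Vec d}
    (hz : ∀ i ∈ I, Measurable fun ω => z ω i) (hθ : Measurable θ) :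
    Measurable fun ω => grad lam I (z ω) r (θ ω) := by
  unfold grad
  refine Measurable.sub (Finset.measurable_sum _ fun i hi => ?_) (hθ.const_smul lam)
  exact (measurable_const.sub (measurable_sigmoid.comp ((hz i hi).inner hθ))).smul (hz i hi)

theorem measurable_hess (lam : ℝ) {I : Finset ℕ} {z : Ω → ℕ → Vec d} {θ : Ω → Vec d}
    (hz : ∀ i ∈ I, Measurable fun ω => z ω i) (hθ : Measurable θ) (k l : Fin d) :
    Measurable fun ω => hess lam I (z ω) (θ ω) k l :=
  measurable_design lam
    (fun i hi => (measurable_deriv Real.sigmoid).comp ((hz i hi).inner hθ)) hz k l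

end LinearAlgebra

section Pilot

variable {p : Params}

/-- The initial-point estimator is stable under changes of the features. -/
theorem lam_mul_norm_pilot_sub_le (hB : 0 ≤ p.B) (I : Finset ℕ) (z z' : ℕ → Vec p.d) (r : ℕ → ℝ) :
    p.lam * ‖pilot p I z' r - pilot p I z r‖ ≤
      ‖grad p.lam I z r (pilot p I z r) - grad p.lam I z' r (pilot p I z r)‖ := by
  set θ := pilot p I z r with hθ
  set θ' := pilot p I z' r with hθ'
  have hmem : θ ∈ p.Θ := (pilot_spec p hB I z r).1
  have hmem' : θ' ∈ p.Θ := (pilot_spec p hB I z' r).1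
  -- Each minimizer is tested against the other; adding the two optimality conditions and using
  -- λ-strong monotonicity leaves the difference of the gradients at `θ`.
  have h1 := inner_grad_pilot_le p hB I z r hmem'
  have h2 := inner_grad_pilot_le p hB I z' r hmem
  have h3 := inner_grad_sub_grad_ge (lam := p.lam) (m := 0) (I := I) (z := z') (r := r) (θ := θ)
    (θ' := θ') fun i _ ξ _ => (deriv_sigmoid_pos ξ).le
  rw [← hθ] at h1
  rw [← hθ'] at h2
  simp only [zero_mul, Finset.sum_const_zero, zero_add] at h3
  have h4 : p.lam * ‖θ' - θ‖ ^ 2 ≤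
      inner ℝ (grad p.lam I z r θ - grad p.lam I z' r θ) (θ - θ') := by
    rw [inner_sub_left, norm_sub_rev]
    have e : inner ℝ (grad p.lam I z r θ) (θ' - θ) = -inner ℝ (grad p.lam I z r θ) (θ - θ') := by
      rw [← inner_neg_right, neg_sub]
    linarith
  have h5 := h4.trans (real_inner_le_norm _ _)
  rw [norm_sub_rev θ θ'] at h5
  rcases (norm_nonneg (θ' - θ)).eq_or_lt with h0 | h0
  · rw [← h0, mul_zero]
    exact norm_nonneg _
  · refine le_of_mul_le_mul_right ?_ h0
    calc p.lam * ‖θ' - θ‖ * ‖θ' - θ‖ = p.lam * ‖θ' - θ‖ ^ 2 := by ring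
      _ ≤ _ := h5

/-- Continuity in the features gives measurability of a minimizer chosen by `Classical.epsilon`,
with no measurable selection argument. -/
theorem continuous_pilot (hB : 0 ≤ p.B) (hlam : 0 < p.lam) (I : Finset ℕ) (r : ℕ → ℝ) :
    Continuous fun z : ℕ → Vec p.d => pilot p I z r := by
  rw [continuous_iff_continuousAt]
  intro z
  rw [ContinuousAt, tendsto_iff_norm_sub_tendsto_zero]
  have hg : Continuous fun z' : ℕ → Vec p.d =>
      p.lam⁻¹ * ‖grad p.lam I z r (pilot p I z r) - grad p.lam I z' r (pilot p I z r)‖ := by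
    unfold grad
    have h1 : ∀ i, Continuous fun z' : ℕ → Vec p.d => Real.sigmoid (inner ℝ (z' i) (pilot p I z r)) :=
      fun i => continuous_sigmoid.comp ((continuous_apply i).inner continuous_const)
    refine continuous_const.mul (Continuous.norm (continuous_const.sub (Continuous.sub ?_
      continuous_const)))
    exact continuous_finsetSum _ fun i _ => (continuous_const.sub (h1 i)).smul (continuous_apply i)
  have h0 := hg.tendsto z
  simp only [sub_self, norm_zero, mul_zero] at h0
  refine squeeze_zero (fun _ => norm_nonneg _) (fun z' => ?_) h0
  rw [inv_mul_eq_div, le_div_iff₀ hlam, mul_comm]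
  exact lam_mul_norm_pilot_sub_le hB I z z' r

variable {Ω : Type*} [MeasurableSpace Ω]

theorem measurable_pilot (hB : 0 ≤ p.B) (hlam : 0 < p.lam) {I : Finset ℕ} {z : Ω → ℕ → Vec p.d}
    (r : ℕ → ℝ) (hz : ∀ i ∈ I, Measurable fun ω => z ω i) :
    Measurable fun ω => pilot p I (z ω) r := by
  classical
  have e : (fun ω => pilot p I (z ω) r) =
      fun ω => pilot p I (fun i => if i ∈ I then z ω i else 0) r := by
    funext ω
    exact pilot_congr p (fun i hi => (if_pos hi).symm) fun _ _ => rfl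
  rw [e]
  refine (continuous_pilot hB hlam I r).measurable.comp (measurable_pi_lambda _ fun i => ?_)
  by_cases hi : i ∈ I
  · simp only [if_pos hi]
    exact hz i hi
  · simp only [if_neg hi]
    exact measurable_const

theorem measurable_oneStep (hB : 0 ≤ p.B) (hlam : 0 < p.lam) {IP IE : Finset ℕ}
    {z : Ω → ℕ → Vec p.d} (r : ℕ → ℝ) (hP : ∀ i ∈ IP, Measurable fun ω => z ω i)
    (hE : ∀ i ∈ IE, Measurable fun ω => z ω i) :
    Measurable fun ω => oneStep p IP IE (z ω) r := by
  have h := measurable_pilot hB hlam r hP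
  refine h.add ((PiLp.continuous_toLp 2 _).measurable.comp ?_)
  exact measurable_mulVec (measurable_inv_apply (measurable_hess p.lam hE h))
    (measurable_grad p.lam r hE h)

end Pilot

section Run

variable {p : Params} {tie : ℕ → Finset (Fin p.K) → Fin p.K} {r : ℕ → ℝ}

/-- As `tie` is an arbitrary function of finite sets, the event is rewritten with quantifiers over
finite types and membership conditions whose measurability is known. -/
theorem tie_argmaxSet_eq_iff {t : ℕ} {A : Finset (Fin p.K)} {f : Fin p.K → ℝ} {a : Fin p.K} :
    tie t (argmaxSet A f) = a ↔
      ∃ B, tie t B = a ∧ ∀ b, b ∈ B ↔ b ∈ A ∧ ∀ c, c ∈ A → f c ≤ f b := by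
  constructor
  · exact fun h => ⟨_, h, fun b => by simp [argmaxSet]⟩
  · rintro ⟨B, hB, h⟩
    have : argmaxSet A f = B := by
      ext b
      rw [h]
      simp [argmaxSet]
    rw [this, hB]

variable {Ω : Type*} [MeasurableSpace Ω] {x : Ω → ℕ → Fin p.K → Vec p.d}

section Step

variable {σ : State p.K} {n : ℕ}

theorem measurable_arm {i : ℕ} (hx : Measurable fun ω => x ω i) (a : Fin p.K) :
    Measurable fun ω => x ω i a := (measurable_pi_apply a).comp hx

variable (hB : 0 ≤ p.B) (hlam : 0 < p.lam) (hT : 1 ≤ p.T)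
  (hx : ∀ i ∈ Finset.Icc 1 (n + 1), Measurable fun ω => x ω i)
  (hP : ∀ s, σ.P s ⊆ Finset.Icc 1 n) (hE : ∀ s, σ.E s ⊆ Finset.Icc 1 n)

include hx

theorem measurable_current (a : Fin p.K) : Measurable fun ω => x ω (n + 1) a :=
  measurable_arm (hx _ (Finset.mem_Icc.2 ⟨by omega, le_rfl⟩)) a

theorem measurable_chosen {i : ℕ} (hi : i ∈ Finset.Icc 1 n) :
    Measurable fun ω => chosen p (x ω) σ i :=
  measurable_arm (hx i (Finset.Icc_subset_Icc_right (Nat.le_succ n) hi)) _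

include hE in
theorem measurable_width (s : ℕ) (a : Fin p.K) :
    Measurable fun ω => width p (x ω) σ (n + 1) s a :=
  (measurable_invNormSq (measurable_design _ (fun _ _ => measurable_const)
    fun _ hi => measurable_chosen hx (hE s hi)) (measurable_current hx a)).sqrt.const_mul _

include hP in
theorem measurable_invNormSq_VP (s : ℕ) (a : Fin p.K) :
    Measurable fun ω => invNormSq (VP p (x ω) σ s) (x ω (n + 1) a) :=
  measurable_invNormSq (measurable_design _ (fun _ _ => measurable_const)
    fun _ hi => measurable_chosen hx (hP s hi)) (measurable_current hx a)

include hB hlam hP hE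

theorem measurable_score (s : ℕ) (a : Fin p.K) :
    Measurable fun ω => score p (x ω) r σ (n + 1) s a :=
  (measurable_current hx a).inner (measurable_oneStep hB hlam r
    (fun _ hi => measurable_chosen hx (hP s hi)) fun _ hi => measurable_chosen hx (hE s hi))

theorem measurable_mem_active (s : ℕ) (a : Fin p.K) :
    Measurable fun ω => a ∈ active p (x ω) r σ (n + 1) s := by
  induction s generalizing a with
  | zero => simp [active]
  | succ s ih =>
    match s with
    | 0 => simp [active]
    | s + 1 =>
      simp only [active, Finset.mem_filter]
      refine (ih a).and (Measurable.forall fun b => (ih b).imp ?_)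
      exact measurableSet_setOfPred.1 (measurableSet_le
        ((measurable_score hB hlam hx hP hE _ b).sub_const _)
        (measurable_score hB hlam hx hP hE _ a))

theorem measurable_condA (s : ℕ) : Measurable fun ω => condA p (x ω) r σ (n + 1) s := by
  unfold condA
  refine Measurable.exists fun a => (measurable_mem_active hB hlam hx hP hE s a).and ?_
  exact measurableSet_setOfPred.1 (measurableSet_lt measurable_const (measurable_width hx hE s a))

theorem measurable_condB (s : ℕ) : Measurable fun ω => condB p (x ω) r σ (n + 1) s := by
  unfold condB
  refine Measurable.forall fun a => (measurable_mem_active hB hlam hx hP hE s a).imp ?_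
  exact measurableSet_setOfPred.1 (measurableSet_le (measurable_width hx hE s a) measurable_const)

include hT

theorem measurable_stopLevel : Measurable fun ω => stopLevel p (x ω) r σ (n + 1) := by
  refine measurable_to_countable' fun s => ?_
  have hAB : ∀ j, Measurable fun ω => condA p (x ω) r σ (n + 1) j ∨ condB p (x ω) r σ (n + 1) j :=
    fun j => (measurable_condA hB hlam hx hP hE j).or (measurable_condB hB hlam hx hP hE j)
  have e : (fun ω => stopLevel p (x ω) r σ (n + 1)) ⁻¹' {s} = {ω | 1 ≤ s ∧
      (condA p (x ω) r σ (n + 1) s ∨ condB p (x ω) r σ (n + 1) s) ∧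
      ∀ j < s, 1 ≤ j → ¬ (condA p (x ω) r σ (n + 1) j ∨ condB p (x ω) r σ (n + 1) j)} := by
    ext ω
    exact stopLevel_eq_iff hT
  rw [e]
  exact (measurable_const.and ((hAB s).and (Measurable.forall fun j => measurable_const.imp
    (measurable_const.imp (hAB j).not)))).setOf

theorem measurable_choice : Measurable fun ω => choice p (x ω) r σ (n + 1) tie := by
  refine measurable_to_countable' fun a => ?_
  have hargmax : ∀ (s : ℕ) (f : Ω → Fin p.K → ℝ), (∀ b, Measurable fun ω => f ω b) →
      Measurable fun ω => tie (n + 1) (argmaxSet (active p (x ω) r σ (n + 1) s) (f ω)) = a := by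
    intro s f hf
    simp only [tie_argmaxSet_eq_iff]
    have hmem := measurable_mem_active (r := r) hB hlam hx hP hE s
    refine Measurable.exists fun B => measurable_const.and (Measurable.forall fun b =>
      measurable_const.iff ((hmem b).and (Measurable.forall fun c => (hmem c).imp ?_)))
    exact measurableSet_setOfPred.1 (measurableSet_le (hf c) (hf b))
  have e : (fun ω => choice p (x ω) r σ (n + 1) tie) ⁻¹' {a} =
      {ω | ∃ s, stopLevel p (x ω) r σ (n + 1) = s ∧
        ((condA p (x ω) r σ (n + 1) s ∧ tie (n + 1) (argmaxSet (active p (x ω) r σ (n + 1) s)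
          (width p (x ω) σ (n + 1) s)) = a) ∨
        (¬ condA p (x ω) r σ (n + 1) s ∧ tie (n + 1) (argmaxSet (active p (x ω) r σ (n + 1) s)
          (score p (x ω) r σ (n + 1) s)) = a))} := by
    ext ω
    simp only [Set.mem_preimage, Set.mem_singleton_iff, Set.mem_ofPred_eq, exists_eq_left']
    unfold choice
    split_ifs with hA <;> simp [hA]
  rw [e]
  have hA := measurable_condA (r := r) hB hlam hx hP hE
  exact (Measurable.exists fun s => (measurableSet_setOfPred.1
    (measurable_stopLevel hB hlam hT hx hP hE (measurableSet_singleton s))).and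
    (((hA s).and (hargmax s _ fun b => measurable_width hx hE s b)).or
      ((hA s).not.and (hargmax s _ fun b => measurable_score hB hlam hx hP hE s b)))).setOf

/-- From a fixed state, the next one is a function of the stopping level, the arm and two truth
values, which together form a discrete variable. -/
theorem countablyMeasurable_step :
    CountablyMeasurable fun ω => step p (x ω) r σ (n + 1) tie := by
  classical
  have hs := measurable_stopLevel (r := r) hB hlam hT hx hP hE
  have hc := measurable_choice (tie := tie) (r := r) hB hlam hT hx hP hE
  have hA : Measurable fun ω => condA p (x ω) r σ (n + 1) (stopLevel p (x ω) r σ (n + 1)) :=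
    (countablyMeasurable_of_discrete hs id).measurable_apply fun s _ =>
      measurable_condA hB hlam hx hP hE s
  have hτ : Measurable fun ω => p.τ (stopLevel p (x ω) r σ (n + 1)) <
      invNormSq (VP p (x ω) σ (stopLevel p (x ω) r σ (n + 1)))
        (x ω (n + 1) (choice p (x ω) r σ (n + 1) tie)) :=
    (countablyMeasurable_of_discrete (hs.prodMk hc) id).measurable_apply
      (g := fun y ω => p.τ y.1 < invNormSq (VP p (x ω) σ y.1) (x ω (n + 1) y.2)) fun y _ =>
        measurableSet_setOfPred.1
          (measurableSet_lt measurable_const (measurable_invNormSq_VP hx hP y.1 y.2))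
  exact countablyMeasurable_of_discrete (hs.prodMk (hc.prodMk (hA.prodMk hτ)))
    fun y : ℕ × Fin p.K × Prop × Prop =>
      let arm := Function.update σ.arm (n + 1) y.2.1
      if y.2.2.1 then
        if y.2.2.2 then
          ({ arm := arm, P := Function.update σ.P y.1 (insert (n + 1) (σ.P y.1)), E := σ.E } :
            State p.K)
        else
          { arm := arm, P := σ.P, E := Function.update σ.E y.1 (insert (n + 1) (σ.E y.1)) }
      else
        { arm := arm, P := σ.P, E := σ.E }

end Step

/-- For fixed rewards, the state after `n` rounds is a measurable function of the first `n`
contexts. -/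
theorem countablyMeasurable_run (hB : 0 ≤ p.B) (hlam : 0 < p.lam) (hT : 1 ≤ p.T) (r : ℕ → ℝ)
    {n : ℕ} (hx : ∀ i ∈ Finset.Icc 1 n, Measurable fun ω => x ω i) :
    CountablyMeasurable fun ω => run p tie (x ω) r n := by
  induction n with
  | zero => exact countablyMeasurable_const _
  | succ n ih =>
    have ih' := ih fun i hi => hx i (Finset.Icc_subset_Icc_right (Nat.le_succ n) hi)
    refine ih'.apply (g := fun σ ω => step p (x ω) r σ (n + 1) tie) ?_
    rintro _ ⟨ω, rfl⟩
    exact countablyMeasurable_step hB hlam hT hx (run_P_subset n) (run_E_subset n)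

theorem measurable_action_apply {γ : Type*} [MeasurableSpace γ] (hB : 0 ≤ p.B) (hlam : 0 < p.lam)
    (hT : 1 ≤ p.T) (r : ℕ → ℝ) {n : ℕ} (hx : ∀ i ∈ Finset.Icc 1 n, Measurable fun ω => x ω i)
    {g : Fin p.K → Ω → γ} (hg : ∀ a, Measurable (g a)) :
    Measurable fun ω => g (action p tie (x ω) r n) ω :=
  (countablyMeasurable_run (tie := tie) hB hlam hT r hx).measurable_apply
    (g := fun σ ω => g (σ.arm n) ω) fun _ _ => hg _

theorem measurable_rewardProb (hB : 0 ≤ p.B) (hlam : 0 < p.lam) (hT : 1 ≤ p.T) (θ : Vec p.d)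
    (r : ℕ → ℝ) {n : ℕ} (hn : 1 ≤ n) (hx : ∀ i ∈ Finset.Icc 1 n, Measurable fun ω => x ω i) :
    Measurable fun ω => rewardProb p tie (x ω) θ n r :=
  measurable_action_apply hB hlam hT r hx
    (g := fun a ω => Real.sigmoid (inner ℝ (x ω n a) θ)) fun a =>
      measurable_sigmoid.comp ((measurable_arm (hx n (Finset.mem_Icc.2 ⟨hn, le_rfl⟩)) a).inner
        measurable_const)

theorem measurable_regret (hB : 0 ≤ p.B) (hlam : 0 < p.lam) (hT : 1 ≤ p.T) (θ : Vec p.d)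
    (r : ℕ → ℝ) (hx : ∀ i ∈ Finset.Icc 1 p.T, Measurable fun ω => x ω i) :
    Measurable fun ω => regret p θ (x ω) (action p tie (x ω) r) := by
  refine Finset.measurable_sum _ fun t ht => ?_
  have hinner : ∀ a, Measurable fun ω => (inner ℝ (x ω t a) θ : ℝ) := fun a =>
    (measurable_arm (hx t ht) a).inner measurable_const
  refine (measurable_sigmoid.comp (Measurable.iSup hinner)).sub ?_
  exact measurable_action_apply hB hlam hT r
    (fun i hi => hx i (Finset.Icc_subset_Icc_right (Finset.mem_Icc.1 ht).2 hi))
    (g := fun a ω => Real.sigmoid (inner ℝ (x ω t a) θ)) fun a => measurable_sigmoid.comp (hinner a)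

end Run

/-! ### From the probability space to the reward tree. -/

section Sigma

variable {Ω γ : Type*} [MeasurableSpace γ]

theorem measurable_sigmaUpTo (f : ℕ → Ω → γ) {n i : ℕ} (hi : i ∈ Finset.Icc 1 n) :
    Measurable[sigmaUpTo f n] (f i) :=
  measurable_iff_comap_le.2 (le_iSup₂_of_le i hi le_rfl)

theorem sigmaUpTo_le [mΩ : MeasurableSpace Ω] {f : ℕ → Ω → γ} (hf : ∀ i, Measurable (f i)) (n : ℕ) :
    sigmaUpTo f n ≤ mΩ :=
  iSup₂_le fun i _ => (hf i).comap_le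

theorem sigmaUpTo_mono (f : ℕ → Ω → γ) {n m : ℕ} (h : n ≤ m) : sigmaUpTo f n ≤ sigmaUpTo f m :=
  biSup_mono fun _ hi => Finset.Icc_subset_Icc_right h hi

theorem measurableSet_sigmaUpTo_forall_eq [MeasurableSingletonClass γ] (f : ℕ → Ω → γ) (n : ℕ)
    (ρ : ℕ → γ) : MeasurableSet[sigmaUpTo f n] {ω | ∀ i ∈ Finset.Icc 1 n, f i ω = ρ i} := by
  have : {ω | ∀ i ∈ Finset.Icc 1 n, f i ω = ρ i} = ⋂ i ∈ Finset.Icc 1 n, f i ⁻¹' {ρ i} := by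
    ext ω
    simp
  rw [this]
  exact Finset.measurableSet_biInter _ fun i hi =>
    measurable_sigmaUpTo f hi (measurableSet_singleton _)

end Sigma

/-- A random variable with vanishing integrals over the sets of `m` is orthogonal to the
`m`-measurable functions. -/
theorem integral_mul_eq_zero_of_setIntegral_eq_zero {Ω : Type*} {m mΩ : MeasurableSpace Ω}
    {Pr : Measure Ω} [IsProbabilityMeasure Pr] (hm : m ≤ mΩ) {g Y : Ω → ℝ} (hY : Integrable Y Pr)
    (h0 : ∀ D, MeasurableSet[m] D → ∫ ω in D, Y ω ∂Pr = 0) (hg : StronglyMeasurable[m] g)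
    (hgY : Integrable (g * Y) Pr) : ∫ ω, (g * Y) ω ∂Pr = 0 := by
  have h1 : (0 : Ω → ℝ) =ᵐ[Pr] Pr[Y | m] :=
    ae_eq_condExp_of_forall_setIntegral_eq hm hY (fun _ _ _ => integrableOn_zero)
      (fun D hD _ => by simp [h0 D hD]) stronglyMeasurable_zero.aestronglyMeasurable
  have h2 : Pr[g * Y | m] =ᵐ[Pr] 0 := by
    filter_upwards [condExp_mul_of_stronglyMeasurable_left hg hgY hY, h1] with ω h2 h3
    rw [h2, Pi.mul_apply, ← h3]
    simp
  rw [← integral_condExp hm, integral_congr_ae h2]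
  simp

section Environment

variable {p : Params} {tie : ℕ → Finset (Fin p.K) → Fin p.K} {Ω : Type*} [mΩ : MeasurableSpace Ω]
  {Pr : Measure Ω} {x : ℕ → Ω → Fin p.K → Vec p.d}
  {a : ℕ → Ω → Fin p.K} {r : ℕ → Ω → ℝ} {θ : Vec p.d}

/-- The structural assumptions on the interaction. -/
structure Interaction (p : Params) (tie : ℕ → Finset (Fin p.K) → Fin p.K) (Pr : Measure Ω)
    (x : ℕ → Ω → Fin p.K → Vec p.d) (a : ℕ → Ω → Fin p.K) (r : ℕ → Ω → ℝ) (θ : Vec p.d) :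
    Prop where
  B_nonneg : 0 ≤ p.B
  lam_pos : 0 < p.lam
  one_le_T : 1 ≤ p.T
  measurable_context : ∀ t, Measurable (x t)
  measurable_reward : ∀ t, Measurable (r t)
  arm_eq : ∀ t ω, a t ω = action p tie (fun i => x i ω) (fun i => r i ω) t
  bernoulli : BernoulliRewards p x a r Pr θ
  exogenous : ExogenousContexts p x a r Pr

namespace Interaction

variable (h : Interaction p tie Pr x a r θ)

include h

theorem reward_nonneg (t : ℕ) (ω : Ω) : 0 ≤ r t ω := by
  rcases h.bernoulli.1 t ω with e | e <;> rw [e]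
  norm_num

theorem reward_le_one (t : ℕ) (ω : Ω) : r t ω ≤ 1 := by
  rcases h.bernoulli.1 t ω with e | e <;> rw [e]
  norm_num

theorem measurable_rewardProb_sigmaUpTo (ρ : ℕ → ℝ) (n : ℕ) :
    Measurable[sigmaUpTo x (n + 1)]
      fun ω => rewardProb p tie (fun i => x i ω) θ (n + 1) ρ :=
  @measurable_rewardProb p tie Ω (sigmaUpTo x (n + 1)) (fun ω i => x i ω) h.B_nonneg h.lam_pos
    h.one_le_T θ ρ (n + 1) (by omega) fun _ hi => measurable_sigmaUpTo x hi

theorem rewardPath_mask (n : ℕ) (ω : Ω) :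
    RewardPath n (mask (Finset.Icc 1 n) fun i => r i ω) := by
  intro i
  unfold mask
  split_ifs with hi
  · exact (h.bernoulli.1 i ω).imp_right fun e => ⟨hi, e⟩
  · exact Or.inl rfl

theorem countablyMeasurable_mask (n : ℕ) :
    CountablyMeasurable fun ω => mask (Finset.Icc 1 n) fun i => r i ω := by
  refine ⟨((finite_rewardPath n).subset ?_).countable, fun ρ => ?_⟩
  · rintro _ ⟨ω, rfl⟩
    exact h.rewardPath_mask n ω
  · refine (measurable_pi_lambda _ fun i => ?_) (measurableSet_singleton ρ)
    unfold mask
    split_ifs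
    · exact h.measurable_reward i
    · exact measurable_const

variable [IsProbabilityMeasure Pr]

/-- If the history were not a sub-σ-algebra, its conditional expectation would be zero by
convention, contradicting the positive mean of the rewards. -/
theorem history_le {t : ℕ} (ht : t ∈ Finset.Icc 1 p.T) : history p x a r t ≤ mΩ := by
  by_contra hle
  have h0 := h.bernoulli.2 t ht
  rw [condExp_of_not_le hle] at h0
  obtain ⟨ω, hω⟩ := h0.exists
  exact (Real.sigmoid_pos _).ne hω

/-- Given the rewards of rounds `1, …, n`, the reward of round `n + 1` has mean `rewardProb`, on
every event that is determined by the contexts. -/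
theorem integral_indicator_mul_reward {n : ℕ} (hn : n < p.T) (ρ : ℕ → ℝ) {D : Set Ω}
    (hD : MeasurableSet[sigmaUpTo x p.T] D) :
    ∫ ω, ((D ∩ {ω | ∀ i ∈ Finset.Icc 1 n, r i ω = ρ i}).indicator (fun _ => (1 : ℝ)) ω) *
        r (n + 1) ω ∂Pr =
      ∫ ω, rewardProb p tie (fun i => x i ω) θ (n + 1) ρ *
        ((D ∩ {ω | ∀ i ∈ Finset.Icc 1 n, r i ω = ρ i}).indicator (fun _ => (1 : ℝ)) ω) ∂Pr := by
  have ht : n + 1 ∈ Finset.Icc 1 p.T := Finset.mem_Icc.2 ⟨by omega, hn⟩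
  set C := {ω | ∀ i ∈ Finset.Icc 1 n, r i ω = ρ i} with hC
  set C' := C ∩ r (n + 1) ⁻¹' {1} with hC'
  set q : Ω → ℝ := fun ω => rewardProb p tie (fun i => x i ω) θ (n + 1) ρ with hq
  let one : Set Ω → Ω → ℝ := fun s => s.indicator fun _ => 1
  have hF : history p x a r (n + 1) ≤ mΩ := h.history_le ht
  have hGF : sigmaUpTo x (n + 1) ≤ history p x a r (n + 1) := le_sup_left.trans le_sup_left
  have hG : sigmaUpTo x (n + 1) ≤ mΩ := hGF.trans hF
  have hCr : MeasurableSet[sigmaUpTo r n] C := measurableSet_sigmaUpTo_forall_eq r n ρ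
  have hCF : MeasurableSet[history p x a r (n + 1)] C := (le_sup_right : sigmaUpTo r n ≤ history p x a r (n + 1)) _ hCr
  have hCH : MeasurableSet[sigmaUpTo a (n + 1) ⊔ sigmaUpTo r (n + 1)] C :=
    (le_sup_right : _ ≤ sigmaUpTo a (n + 1) ⊔ sigmaUpTo r (n + 1)) _
      (sigmaUpTo_mono r (Nat.le_succ n) _ hCr)
  have hr1 : MeasurableSet[sigmaUpTo r (n + 1)] (r (n + 1) ⁻¹' {1}) :=
    measurable_sigmaUpTo r (Finset.mem_Icc.2 ⟨by omega, le_rfl⟩) (measurableSet_singleton _)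
  have hC'H : MeasurableSet[sigmaUpTo a (n + 1) ⊔ sigmaUpTo r (n + 1)] C' :=
    hCH.inter ((le_sup_right : _ ≤ sigmaUpTo a (n + 1) ⊔ sigmaUpTo r (n + 1)) _ hr1)
  have hCm : MeasurableSet C := hF _ hCF
  have hDm : MeasurableSet D := sigmaUpTo_le h.measurable_context p.T _ hD
  have hqG : StronglyMeasurable[sigmaUpTo x (n + 1)] q :=
    (h.measurable_rewardProb_sigmaUpTo ρ n).stronglyMeasurable
  have hqb : ∀ ω, ‖q ω‖ ≤ 1 := fun ω => by
    rw [Real.norm_of_nonneg (rewardProb_nonneg θ _ _)]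
    exact rewardProb_le_one θ _ _
  have hone : ∀ {s : Set Ω}, MeasurableSet s → Integrable (one s) Pr := fun hs =>
    (integrable_const 1).indicator hs
  have hqone : ∀ {s : Set Ω}, MeasurableSet s → Integrable (q * one s) Pr := fun hs =>
    (hone hs).bdd_mul (hqG.mono hG).aestronglyMeasurable (Filter.Eventually.of_forall hqb)
  have hrint : Integrable (r (n + 1)) Pr :=
    Integrable.of_bound (h.measurable_reward _).aestronglyMeasurable 1
      (Filter.Eventually.of_forall fun ω => by
        rw [Real.norm_of_nonneg (h.reward_nonneg _ _)]
        exact h.reward_le_one _ _)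
  have hmulr : ∀ s : Set Ω, one s * r (n + 1) = one (s ∩ r (n + 1) ⁻¹' {1}) := by
    classical
    intro s
    funext ω
    simp only [Pi.mul_apply, one, Set.indicator_apply, Set.mem_inter_iff, Set.mem_preimage,
      Set.mem_singleton_iff]
    rcases h.bernoulli.1 (n + 1) ω with e | e <;> simp [e]
  have hC'm : MeasurableSet C' := hCm.inter (h.measurable_reward _ (measurableSet_singleton _))
  -- On `C` the past rewards are ρ, so the arm of round n+1 is a function of the contexts and the
  -- success probability is `q`, measurable with respect to the first n+1 contexts.
  have h1 : Pr[one C' | history p x a r (n + 1)] =ᵐ[Pr] q * one C := by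
    have e1 : Pr[one C' | history p x a r (n + 1)] =ᵐ[Pr] one C * Pr[r (n + 1) | history p x a r (n + 1)] := by
      rw [← hmulr C]
      refine condExp_mul_of_stronglyMeasurable_left
        (stronglyMeasurable_const.indicator hCF) ?_ hrint
      rw [hmulr C]
      exact hone hC'm
    filter_upwards [e1, h.bernoulli.2 (n + 1) ht] with ω e2 e3
    rw [e2, Pi.mul_apply, Pi.mul_apply, e3]
    by_cases hω : ω ∈ C
    · have hact : a (n + 1) ω = action p tie (fun i => x i ω) ρ (n + 1) := by
        rw [h.arm_eq]
        unfold action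
        rw [run_congr_rewards (r' := ρ) hω]
      simp only [one, Set.indicator_of_mem hω, hq, rewardProb, hact]
      ring
    · simp [one, Set.indicator_of_notMem hω]
  have h2 : Pr[one C' | sigmaUpTo x (n + 1)] =ᵐ[Pr] q * Pr[one C | sigmaUpTo x (n + 1)] :=
    ((condExp_condExp_of_le hGF hF).symm.trans (condExp_congr_ae h1)).trans
      (condExp_mul_of_stronglyMeasurable_left hqG (hqone hCm) (hone hCm))
  have hDC : MeasurableSet (D ∩ C) := hDm.inter hCm
  -- Exogeneity is used twice: it factors `D` out for `C'`, where `h2` extracts q, and it brings `D`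
  -- back in for `C`. Thus future contexts do not bias the current reward.
  have h3 : Pr[one (D ∩ C') | sigmaUpTo x (n + 1)] =ᵐ[Pr] Pr[q * one (D ∩ C) | sigmaUpTo x (n + 1)] := by
    filter_upwards [h.exogenous (n + 1) ht D C' hD hC'H, h.exogenous (n + 1) ht D C hD hCH, h2,
      condExp_mul_of_stronglyMeasurable_left hqG (hqone hDC) (hone hDC)] with ω e1 e2 e3 e4
    simp only [Pi.mul_apply] at e1 e2 e3 e4
    rw [e4]
    refine e1.trans ?_
    refine (congrArg _ e3).trans ?_
    refine Eq.trans ?_ (congrArg (q ω * ·) e2.symm)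
    simp only [one]
    ring
  have h4 : ∫ ω, one (D ∩ C') ω ∂Pr = ∫ ω, (q * one (D ∩ C)) ω ∂Pr := by
    rw [← integral_condExp hG, integral_congr_ae h3, integral_condExp hG]
  have h5 : ∀ ω, (D ∩ C).indicator (fun _ => (1 : ℝ)) ω * r (n + 1) ω = one (D ∩ C') ω := fun ω => by
    have := congrFun (hmulr (D ∩ C)) ω
    rw [Set.inter_assoc] at this
    exact this
  simp only [h5]
  exact h4

/-- The previous identity for context events says that the centered reward on a fixed past is
orthogonal to them, hence to bounded functions of all contexts. -/
theorem integral_reward_sub_eq_zero {n : ℕ} (hn : n < p.T) (ρ : ℕ → ℝ) {g : Ω → ℝ}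
    (hg : Measurable[sigmaUpTo x p.T] g) {c : ℝ} (hgc : ∀ ω, ‖g ω‖ ≤ c) :
    Integrable (g * fun ω => ({ω | ∀ i ∈ Finset.Icc 1 n, r i ω = ρ i}.indicator (fun _ => (1 : ℝ)) ω) *
        (r (n + 1) ω - rewardProb p tie (fun i => x i ω) θ (n + 1) ρ)) Pr ∧
    ∫ ω, (g * fun ω => ({ω | ∀ i ∈ Finset.Icc 1 n, r i ω = ρ i}.indicator (fun _ => (1 : ℝ)) ω) *
        (r (n + 1) ω - rewardProb p tie (fun i => x i ω) θ (n + 1) ρ)) ω ∂Pr = 0 := by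
  have hM := sigmaUpTo_le h.measurable_context p.T
  set C := {ω | ∀ i ∈ Finset.Icc 1 n, r i ω = ρ i} with hC
  set q : Ω → ℝ := fun ω => rewardProb p tie (fun i => x i ω) θ (n + 1) ρ with hq
  have hCm : MeasurableSet C :=
    sigmaUpTo_le h.measurable_reward n _ (measurableSet_sigmaUpTo_forall_eq r n ρ)
  have hqm : Measurable q :=
    (h.measurable_rewardProb_sigmaUpTo ρ n).mono (sigmaUpTo_le h.measurable_context _) le_rfl
  have hq0 : ∀ ω, 0 ≤ q ω := fun ω => rewardProb_nonneg θ _ _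
  have hq1 : ∀ ω, q ω ≤ 1 := fun ω => rewardProb_le_one θ _ _
  have hYm : Measurable fun ω => C.indicator (fun _ => (1 : ℝ)) ω * (r (n + 1) ω - q ω) :=
    (measurable_const.indicator hCm).mul ((h.measurable_reward _).sub hqm)
  have hY : Integrable (fun ω => C.indicator (fun _ => (1 : ℝ)) ω * (r (n + 1) ω - q ω)) Pr := by
    refine Integrable.of_bound hYm.aestronglyMeasurable 1 (Filter.Eventually.of_forall fun ω => ?_)
    have h1 := h.reward_nonneg (n + 1) ω
    have h2 := h.reward_le_one (n + 1) ω
    have h3 : |r (n + 1) ω - q ω| ≤ 1 := abs_le.2 ⟨by linarith [hq1 ω], by linarith [hq0 ω]⟩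
    by_cases hω : ω ∈ C
    · simpa [Set.indicator_of_mem hω] using h3
    · simp [Set.indicator_of_notMem hω]
  have hgY := hY.bdd_mul (hg.mono hM le_rfl).aestronglyMeasurable (Filter.Eventually.of_forall hgc)
  refine ⟨hgY, integral_mul_eq_zero_of_setIntegral_eq_zero hM hY (fun D hD => ?_)
    hg.stronglyMeasurable hgY⟩
  have hDm : MeasurableSet D := hM _ hD
  have hone : Integrable ((D ∩ C).indicator fun _ => (1 : ℝ)) Pr :=
    (integrable_const 1).indicator (hDm.inter hCm)
  have hi1 : Integrable (fun ω => (D ∩ C).indicator (fun _ => (1 : ℝ)) ω * r (n + 1) ω) Pr := by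
    refine hone.mul_bdd (c := 1) (h.measurable_reward _).aestronglyMeasurable
      (Filter.Eventually.of_forall fun ω => ?_)
    rw [Real.norm_of_nonneg (h.reward_nonneg _ _)]
    exact h.reward_le_one _ _
  have hi2 : Integrable (fun ω => q ω * (D ∩ C).indicator (fun _ => (1 : ℝ)) ω) Pr := by
    refine hone.bdd_mul (c := 1) hqm.aestronglyMeasurable (Filter.Eventually.of_forall fun ω => ?_)
    rw [Real.norm_of_nonneg (hq0 _)]
    exact hq1 _
  have hkey := h.integral_indicator_mul_reward hn ρ hD
  rw [← integral_indicator hDm, ← sub_eq_zero.2 hkey, ← integral_sub hi1 hi2]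
  congr 1
  funext ω
  classical
  by_cases hω : ω ∈ D <;> by_cases hω' : ω ∈ C <;>
    simp only [Set.indicator_apply, Set.mem_inter_iff, hω, hω', hq, if_true, if_false, and_true,
      and_false, one_mul, mul_one, zero_mul, mul_zero, sub_self]

/-- Integrals of functions of the contexts and rewards are averages of the expectations over the
reward tree of the contexts. -/
theorem integral_eq_integral_treeExp {n : ℕ} (hn : n ≤ p.T) {f : Ω → (ℕ → ℝ) → ℝ}
    (hf : ∀ ρ, Measurable[sigmaUpTo x p.T] fun ω => f ω ρ) (hf0 : ∀ ω ρ, 0 ≤ f ω ρ)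
    (hf1 : ∀ ω ρ, f ω ρ ≤ 1) :
    ∫ ω, f ω (mask (Finset.Icc 1 n) fun i => r i ω) ∂Pr =
      ∫ ω, treeExp (rewardProb p tie (fun i => x i ω) θ) n (f ω) ∂Pr := by
  classical
  induction n generalizing f with
  | zero =>
    have : ∀ ω, (mask (Finset.Icc 1 0) fun i => r i ω) = 0 := fun ω => by
      funext i
      simp [mask]
    simp only [this, treeExp]
  | succ n ih =>
    have hn' : n < p.T := hn
    let q : Ω → (ℕ → ℝ) → ℝ := fun ω ρ => rewardProb p tie (fun i => x i ω) θ (n + 1) ρ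
    let f' : Ω → (ℕ → ℝ) → ℝ := fun ω ρ =>
      (1 - q ω ρ) * f ω (Function.update ρ (n + 1) 0) + q ω ρ * f ω (Function.update ρ (n + 1) 1)
    have hq : ∀ ρ, Measurable[sigmaUpTo x p.T] fun ω => q ω ρ := fun ρ =>
      (h.measurable_rewardProb_sigmaUpTo ρ n).mono (sigmaUpTo_mono x hn) le_rfl
    have hq0 : ∀ ω ρ, 0 ≤ q ω ρ := fun ω ρ => rewardProb_nonneg θ _ _
    have hq1 : ∀ ω ρ, q ω ρ ≤ 1 := fun ω ρ => rewardProb_le_one θ _ _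
    have hf' : ∀ ρ, Measurable[sigmaUpTo x p.T] fun ω => f' ω ρ := fun ρ =>
      (((@measurable_const _ _ _ (sigmaUpTo x p.T) 1).sub (hq ρ)).mul (hf _)).add
        ((hq ρ).mul (hf _))
    have hf'0 : ∀ ω ρ, 0 ≤ f' ω ρ := fun ω ρ => add_nonneg
      (mul_nonneg (sub_nonneg.2 (hq1 ω ρ)) (hf0 _ _)) (mul_nonneg (hq0 ω ρ) (hf0 _ _))
    have hf'1 : ∀ ω ρ, f' ω ρ ≤ 1 := fun ω ρ => by
      have h1 := mul_le_mul_of_nonneg_left (hf1 ω (Function.update ρ (n + 1) 0))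
        (sub_nonneg.2 (hq1 ω ρ))
      have h2 := mul_le_mul_of_nonneg_left (hf1 ω (Function.update ρ (n + 1) 1)) (hq0 ω ρ)
      simp only [f']
      linarith
    have hM := sigmaUpTo_le h.measurable_context p.T
    refine Eq.trans ?_ (ih hn'.le hf' hf'0 hf'1)
    let g : (ℕ → ℝ) → Ω → ℝ := fun ρ ω =>
      f ω (Function.update ρ (n + 1) 1) - f ω (Function.update ρ (n + 1) 0)
    let Y : (ℕ → ℝ) → Ω → ℝ := fun ρ ω =>
      ({ω | ∀ i ∈ Finset.Icc 1 n, r i ω = ρ i}.indicator (fun _ => (1 : ℝ)) ω) *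
        (r (n + 1) ω - q ω ρ)
    let paths := (finite_rewardPath n).toFinset
    have hzero : ∀ ρ, Integrable (g ρ * Y ρ) Pr ∧ ∫ ω, (g ρ * Y ρ) ω ∂Pr = 0 := fun ρ =>
      h.integral_reward_sub_eq_zero hn' ρ (g := g ρ) ((hf _).sub (hf _)) (c := 1) fun ω => by
        rw [Real.norm_eq_abs, abs_le]
        simp only [g]
        constructor
        · linarith [hf0 ω (Function.update ρ (n + 1) 1), hf1 ω (Function.update ρ (n + 1) 0)]
        · linarith [hf1 ω (Function.update ρ (n + 1) 1), hf0 ω (Function.update ρ (n + 1) 0)]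
    -- A function of a binary reward is affine in it, so it is its mean over the last branching plus
    -- a multiple of the centered reward. Only the term of the realized past survives in the sum,
    -- and every term integrates to zero.
    have hdec : ∀ ω, f ω (mask (Finset.Icc 1 (n + 1)) fun i => r i ω) =
        f' ω (mask (Finset.Icc 1 n) fun i => r i ω) + ∑ ρ ∈ paths, (g ρ * Y ρ) ω := by
      intro ω
      set ρ0 := mask (Finset.Icc 1 n) fun i => r i ω with hρ0
      have hmem : ρ0 ∈ paths := (finite_rewardPath n).mem_toFinset.2 (h.rewardPath_mask n ω)
      have hupd : (mask (Finset.Icc 1 (n + 1)) fun i => r i ω) =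
          Function.update ρ0 (n + 1) (r (n + 1) ω) := by
        funext i
        by_cases hi : i = n + 1
        · subst hi
          simp [mask]
        · rw [Function.update_of_ne hi]
          simp only [hρ0, mask, Finset.mem_Icc]
          congr 1
          simp only [eq_iff_iff]
          omega
      rw [Finset.sum_eq_single ρ0, hupd]
      · have hω : ω ∈ {ω | ∀ i ∈ Finset.Icc 1 n, r i ω = ρ0 i} := fun i hi =>
          (if_pos hi : ρ0 i = r i ω).symm
        simp only [Pi.mul_apply, g, Y, f', Set.indicator_of_mem hω]
        rcases h.bernoulli.1 (n + 1) ω with e | e <;> rw [e] <;> ring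
      · intro ρ hρ hne
        have hω : ω ∉ {ω | ∀ i ∈ Finset.Icc 1 n, r i ω = ρ i} := by
          intro hω
          apply hne
          funext i
          by_cases hi : i ∈ Finset.Icc 1 n
          · rw [← hω i hi]
            exact (if_pos hi : ρ0 i = r i ω).symm
          · have h1 : ρ0 i = 0 := if_neg hi
            rw [h1]
            exact ((finite_rewardPath n).mem_toFinset.1 hρ i).resolve_right fun h' => hi h'.1
        rw [Pi.mul_apply]
        simp only [Y]
        rw [Set.indicator_of_notMem hω, zero_mul, mul_zero]
      · exact fun hne => absurd hmem hne
    have hint : Integrable (fun ω => f' ω (mask (Finset.Icc 1 n) fun i => r i ω)) Pr := by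
      refine Integrable.of_bound ((h.countablyMeasurable_mask n).measurable_apply
        (g := fun ρ ω => f' ω ρ) fun ρ _ => (hf' ρ).mono hM le_rfl).aestronglyMeasurable 1
        (Filter.Eventually.of_forall fun ω => ?_)
      rw [Real.norm_of_nonneg (hf'0 _ _)]
      exact hf'1 _ _
    simp only [hdec]
    rw [integral_add hint (integrable_finsetSum _ fun ρ _ => (hzero ρ).1),
      integral_finsetSum _ fun ρ _ => (hzero ρ).1, Finset.sum_eq_zero fun ρ _ => (hzero ρ).2, add_zero]

-- The indicator of large regret is a function of contexts and rewards, so its integral averages the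
-- tree expectations bounded by `htree`.
open Classical in
theorem le_prob_regret_le {b c : ℝ}
    (htree : ∀ᵐ ω ∂Pr, treeExp (rewardProb p tie (fun i => x i ω) θ) p.T
      (fun ρ => if regret p θ (fun i => x i ω) (action p tie (fun i => x i ω) ρ) ≤ b
        then 0 else 1) ≤ c) :
    ENNReal.ofReal (1 - c) ≤ Pr {ω | regret p θ (fun t => x t ω) (fun t => a t ω) ≤ b} := by
  have hM := sigmaUpTo_le h.measurable_context p.T
  let f : Ω → (ℕ → ℝ) → ℝ := fun ω ρ =>
    if regret p θ (fun i => x i ω) (action p tie (fun i => x i ω) ρ) ≤ b then 0 else 1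
  have hf : ∀ ρ, Measurable[sigmaUpTo x p.T] fun ω => f ω ρ := by
    intro ρ
    have hreg := @measurable_regret p tie Ω (sigmaUpTo x p.T) (fun ω i => x i ω) h.B_nonneg
      h.lam_pos h.one_le_T θ ρ fun i hi => measurable_sigmaUpTo x hi
    exact Measurable.ite (hreg measurableSet_Iic) measurable_const measurable_const
  have hf0 : ∀ ω ρ, 0 ≤ f ω ρ := fun ω ρ => by
    simp only [f]
    split_ifs <;> norm_num
  have hf1 : ∀ ω ρ, f ω ρ ≤ 1 := fun ω ρ => by
    simp only [f]
    split_ifs <;> norm_num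
  set good := {ω | regret p θ (fun t => x t ω) (fun t => a t ω) ≤ b} with hgood
  have hmask : ∀ ω, f ω (mask (Finset.Icc 1 p.T) fun i => r i ω) = goodᶜ.indicator 1 ω := by
    intro ω
    have e : regret p θ (fun i => x i ω) (action p tie (fun i => x i ω)
        (mask (Finset.Icc 1 p.T) fun i => r i ω)) =
        regret p θ (fun t => x t ω) (fun t => a t ω) := by
      unfold regret
      refine Finset.sum_congr rfl fun t ht => ?_
      have hact : action p tie (fun i => x i ω) (mask (Finset.Icc 1 p.T) fun i => r i ω) t =
          a t ω := by
        rw [h.arm_eq]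
        unfold action
        rw [run_congr_rewards' (r' := fun i => r i ω) fun i hi =>
          mask_apply_of_mem (Finset.Icc_subset_Icc_right (Finset.mem_Icc.1 ht).2 hi)]
      rw [hact]
    by_cases hω : ω ∈ good
    · rw [Set.indicator_of_notMem (by simpa using hω)]
      exact if_pos (by rw [e]; exact hω)
    · rw [Set.indicator_of_mem (by simpa using hω)]
      exact if_neg (by rw [e]; exact hω)
  -- Measurability follows from the finitely many reward paths and the measurability of the regret
  -- in the contexts for each fixed path.
  have hbadm : MeasurableSet goodᶜ := by
    have hm : Measurable fun ω => f ω (mask (Finset.Icc 1 p.T) fun i => r i ω) :=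
      (h.countablyMeasurable_mask p.T).measurable_apply (g := fun ρ ω => f ω ρ) fun ρ _ =>
        (hf ρ).mono hM le_rfl
    have : goodᶜ = (fun ω => f ω (mask (Finset.Icc 1 p.T) fun i => r i ω)) ⁻¹' {1} := by
      ext ω
      simp only [hmask, Set.mem_preimage, Set.mem_singleton_iff, Set.indicator_apply,
        Pi.one_apply]
      split_ifs with h' <;> simp [h']
    rw [this]
    exact hm (measurableSet_singleton _)
  have hint := h.integral_eq_integral_treeExp le_rfl hf hf0 hf1
  simp only [hmask] at hint
  rw [integral_indicator_one hbadm] at hint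
  have hle : Pr.real goodᶜ ≤ c := by
    rw [hint]
    have h1 := integral_mono_of_nonneg (μ := Pr) (Filter.Eventually.of_forall fun ω => ?_)
      (integrable_const c) htree
    · simpa using h1
    · have h2 := treeExp_mono (rewardProb_nonneg (tie := tie) (x := fun i => x i ω) θ)
        (rewardProb_le_one (tie := tie) (x := fun i => x i ω) θ) (n := p.T) (f := fun _ => 0)
        (g := f ω) fun ρ _ => hf0 ω ρ
      rw [treeExp_const] at h2
      exact h2
  have hgm : MeasurableSet good := by simpa using hbadm.compl
  rw [probReal_compl_eq_one_sub hgm] at hle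
  refine ENNReal.ofReal_le_of_le_toReal ?_
  change 1 - c ≤ Pr.real good
  linarith

end Interaction

end Environment

/-! ### Almost every context sequence is admissible. -/

section HighProbability

variable {p : Params} {tie : ℕ → Finset (Fin p.K) → Fin p.K} {Ω : Type*} [MeasurableSpace Ω]
  {Pr : Measure Ω} [IsProbabilityMeasure Pr] {x : ℕ → Ω → Fin p.K → Vec p.d}
  {a : ℕ → Ω → Fin p.K} {r : ℕ → Ω → ℝ} {θ : Vec p.d}

/-- The zero parameter lies in Θ and μ'(0) = 1/4, so the curvature bounds at one typical ω already
force κ ≥ 4 and L_μ ≥ 1/4. -/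
theorem ae_admissible (hd : 1 ≤ p.d) (hT : 4 ≤ p.T) (hK : 1 ≤ p.K) (hB : 0 < p.B) (hκ : 0 < p.κ)
    (hlam : 1 / p.κ ≤ p.lam) (hδ : 0 < p.δ) (hδ1 : p.δ < 1) (hx : BoundedFeatures p x Pr θ)
    (hcurv : CurvatureBounds p x Pr) : ∀ᵐ ω ∂Pr, Admissible p (fun i => x i ω) θ := by
  have hcurv' := hcurv
  unfold CurvatureBounds at hcurv'
  obtain ⟨ω₀, h₀⟩ := hcurv'.exists
  have h1 := h₀ 1 (Finset.mem_Icc.2 ⟨le_rfl, by omega⟩) ⟨0, hK⟩ 0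
    (Metric.mem_closedBall_self hB.le)
  rw [inner_zero_right, deriv_sigmoid_zero] at h1
  have h4 : 4 ≤ p.κ := by
    have h2 := h1.1
    rw [div_le_div_iff₀ hκ (by norm_num)] at h2
    linarith
  have hκlam : 1 ≤ p.κ * p.lam := by
    rwa [div_le_iff₀ hκ, mul_comm] at hlam
  filter_upwards [hx.1, hcurv] with ω hω1 hω2
  exact ⟨hd, hT, hK, hB, h4, hκlam, h1.2, hδ, hδ1, hx.2, hω1,
    fun t ht b θ' hθ' => (hω2 t ht b θ' hθ').1⟩

end HighProbability

/-! ### The order of the regret bound. -/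

section Order

theorem rpow_five_halves {u : ℝ} (hu : 0 < u) : u ^ (5 / 2 : ℝ) = u ^ 2 * √u := by
  rw [show (5 / 2 : ℝ) = 2 + 1 / 2 by norm_num, Real.rpow_add hu, ← Real.sqrt_eq_rpow,
    Real.rpow_two]

variable {p : Params}

/-- The logarithmic quantities in terms of `Λ = log (T K / δ)`. -/
theorem log_bounds (hd : 1 ≤ p.d) (hT : 4 ≤ p.T) (hK : 1 ≤ p.K) (hκlam : 1 ≤ p.κ * p.lam)
    (hδ : 0 < p.δ) (hδ1 : p.δ < 1) :
    1 ≤ Real.log (p.T * p.K / p.δ) ∧ 0 ≤ p.logTerm ∧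
      p.logTerm ≤ 2 * Real.log (p.T * p.K / p.δ) ∧ (p.S : ℝ) ≤ Real.log (p.T * p.K / p.δ) ∧
      Real.log (2 * p.S / p.δ) ≤ Real.log (p.T * p.K / p.δ) ∧
      Real.log (4 * p.T * p.S * p.K / p.δ) ≤ 3 * Real.log (p.T * p.K / p.δ) := by
  have hd' : (1 : ℝ) ≤ p.d := by exact_mod_cast hd
  have hT' : (4 : ℝ) ≤ p.T := by exact_mod_cast hT
  have hK' : (1 : ℝ) ≤ p.K := by exact_mod_cast hK
  have hT0 : (0 : ℝ) < p.T := by linarith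
  have hS0 : (0 : ℝ) ≤ p.S := Nat.cast_nonneg _
  set Λ := Real.log (p.T * p.K / p.δ) with hΛ
  have hTK : (p.T : ℝ) ≤ p.T * p.K / p.δ := by
    rw [le_div_iff₀ hδ]
    calc (p.T : ℝ) * p.δ ≤ p.T * 1 := by gcongr
      _ ≤ p.T * p.K := by gcongr
  have hlogT : Real.log p.T ≤ Λ := Real.log_le_log hT0 hTK
  have hlog4 : 1 ≤ Real.log p.T := by
    refine le_trans ?_ (Real.log_le_log (by norm_num) hT')
    rw [show (4 : ℝ) = 2 ^ 2 by norm_num, Real.log_pow]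
    have := Real.log_two_gt_d9
    norm_num
    linarith
  have hΛ1 : 1 ≤ Λ := hlog4.trans hlogT
  have hΛ0 : 0 < Λ := by linarith
  have hℓ0 : 0 ≤ p.logTerm := by
    apply Real.log_nonneg
    have : 0 ≤ (p.T : ℝ) / (p.κ * p.lam * p.d) := by positivity
    linarith
  have hℓ : p.logTerm ≤ 2 * Λ := by
    have h1 : (p.T : ℝ) / (p.κ * p.lam * p.d) ≤ p.T := by
      apply div_le_self hT0.le
      calc (1 : ℝ) = 1 * 1 := by norm_num
        _ ≤ p.κ * p.lam * p.d := by gcongr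
    have h2 : p.logTerm ≤ Real.log ((p.T : ℝ) ^ 2) := by
      apply Real.log_le_log (by positivity)
      nlinarith
    rw [Real.log_pow] at h2
    push_cast at h2
    linarith
  have hS2 : 2 * (p.S : ℝ) ≤ Real.logb 2 p.T := by
    have h1 : (p.S : ℝ) ≤ 0.5 * Real.logb 2 p.T := by
      apply Nat.floor_le
      have := Real.logb_nonneg (b := 2) (by norm_num) (show (1 : ℝ) ≤ p.T by linarith)
      positivity
    norm_num at h1
    linarith
  have hlogb : Real.logb 2 p.T * Real.log 2 = Real.log p.T := by
    rw [Real.logb, div_mul_cancel₀]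
    exact (Real.log_pos (by norm_num)).ne'
  -- 2S log 2 ≤ log T ≤ Λ, and 2 log 2 > 1.
  have hS : (p.S : ℝ) ≤ Λ := by
    have := Real.log_two_gt_d9
    nlinarith
  have hST : 2 * (p.S : ℝ) ≤ p.T := by
    refine hS2.trans ?_
    rw [Real.logb_le_iff_le_rpow (by norm_num) hT0, Real.rpow_natCast]
    exact_mod_cast p.T.lt_two_pow_self.le
  have hlog1 : Real.log (2 * p.S / p.δ) ≤ Λ := by
    rcases hS0.eq_or_lt with h0 | h0
    · simp [← h0, hΛ0.le]
    · apply Real.log_le_log (by positivity)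
      refine div_le_div_of_nonneg_right ?_ hδ.le
      calc 2 * (p.S : ℝ) ≤ p.T * 1 := by linarith
        _ ≤ p.T * p.K := by gcongr
  have hlog2 : Real.log (4 * p.T * p.S * p.K / p.δ) ≤ 3 * Λ := by
    rcases hS0.eq_or_lt with h0 | h0
    · simp [← h0, hΛ0.le]
    · have hpos : 0 < (p.T : ℝ) * p.K / p.δ := by linarith
      have h1 : 4 * p.T * p.S * p.K / p.δ ≤ ((p.T : ℝ) * p.K / p.δ) ^ 3 := by
        have h2 : 4 * (p.S : ℝ) ≤ (p.T * p.K / p.δ) ^ 2 := by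
          have : (p.T : ℝ) ^ 2 ≤ (p.T * p.K / p.δ) ^ 2 := by gcongr
          nlinarith
        calc 4 * p.T * p.S * p.K / p.δ = (p.T * p.K / p.δ) * (4 * p.S) := by ring
          _ ≤ (p.T * p.K / p.δ) * (p.T * p.K / p.δ) ^ 2 := by gcongr
          _ = _ := by ring
      have h3 := Real.log_le_log (by positivity) h1
      rw [Real.log_pow] at h3
      push_cast at h3
      exact h3
  exact ⟨hΛ1, hℓ0, hℓ, hS, hlog1, hlog2⟩

/-- The regret bound in terms of `Λ = log (T K / δ)`. -/
theorem regretBound_le (hd : 1 ≤ p.d) (hT : 4 ≤ p.T) (hK : 1 ≤ p.K) (hB : 0 < p.B) (hκ : 1 ≤ p.κ)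
    (hlam : 0 < p.lam) (hκlam : 1 ≤ p.κ * p.lam) (hLμ : 0 < p.Lμ) (hδ : 0 < p.δ) (hδ1 : p.δ < 1) :
    p.regretBound ≤
      (32 * p.Lμ * (2 + p.B * √p.lam) ^ 2 * (1 + 8 * √p.Lμ) +
          32 * p.Lμ * (√(6 * p.Lμ) + 3 * √(1 / (9 * p.lam)) + p.B * √p.lam) + 2 * p.Lμ) *
        Real.log (p.T * p.K / p.δ) ^ 4 *
          (p.κ * √(p.d * p.T) + p.κ ^ (5 / 2 : ℝ) * (p.d : ℝ) ^ (5 / 2 : ℝ)) := by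
  have hd' : (1 : ℝ) ≤ p.d := by exact_mod_cast hd
  have hT' : (4 : ℝ) ≤ p.T := by exact_mod_cast hT
  have hK' : (1 : ℝ) ≤ p.K := by exact_mod_cast hK
  have hκ0 : 0 < p.κ := by linarith
  have hd0 : (0 : ℝ) < p.d := by linarith
  have hT0 : (0 : ℝ) < p.T := by linarith
  obtain ⟨hΛ1, hℓ0, hℓ, hS, hlog1, hlog2⟩ := log_bounds hd hT hK hκlam hδ hδ1
  have hS0 : (0 : ℝ) ≤ p.S := Nat.cast_nonneg _
  generalize Real.log (p.T * p.K / p.δ) = Λ at *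
  have hΛ0 : 0 < Λ := by linarith
  have hsκ : √p.κ ≤ p.κ := by
    rw [Real.sqrt_le_left hκ0.le]
    nlinarith
  have hβ0 : 0 ≤ p.β := by
    unfold Params.β
    positivity
  have hβ : p.β ≤ (2 + p.B * √p.lam) * p.κ * √(p.d * Λ) := by
    have h1 : √(0.5 * p.d * p.logTerm + 0.5 * Real.log (2 * p.S / p.δ)) ≤ 2 * √(p.d * Λ) := by
      rw [Real.sqrt_le_left (by positivity), mul_pow, Real.sq_sqrt (by positivity)]
      norm_num
      nlinarith
    have h2 : 1 ≤ √(p.d * Λ) := by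
      rw [Real.one_le_sqrt]
      nlinarith
    unfold Params.β
    rw [mul_comm p.κ p.lam, Real.sqrt_mul hlam.le]
    calc p.κ * √(0.5 * p.d * p.logTerm + 0.5 * Real.log (2 * p.S / p.δ)) + p.B * (√p.lam * √p.κ)
        ≤ p.κ * (2 * √(p.d * Λ)) + p.B * (√p.lam * (p.κ * √(p.d * Λ))) := by
          gcongr
          calc √p.κ ≤ p.κ * 1 := by linarith
            _ ≤ _ := by gcongr
      _ = _ := by ring
  have hβ2 : p.β ^ 2 ≤ (2 + p.B * √p.lam) ^ 2 * p.κ ^ 2 * (p.d * Λ) := by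
    have h1 := pow_le_pow_left₀ hβ0 hβ 2
    rwa [mul_pow, mul_pow, Real.sq_sqrt (by positivity)] at h1
  have hR : 1 + p.S * √(32 * p.Lμ * p.κ * p.d * p.logTerm) ≤
      (1 + 8 * √p.Lμ) * Λ ^ 2 * √(p.κ * p.d) := by
    have h1 : √(32 * p.Lμ * p.κ * p.d * p.logTerm) ≤ 8 * √p.Lμ * √(p.κ * p.d) * Λ := by
      rw [Real.sqrt_le_left (by positivity), mul_pow, mul_pow, mul_pow, Real.sq_sqrt hLμ.le,
        Real.sq_sqrt (by positivity)]
      calc 32 * p.Lμ * p.κ * p.d * p.logTerm ≤ 32 * p.Lμ * p.κ * p.d * (2 * (Λ * Λ)) := by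
            gcongr
            nlinarith
        _ = _ := by ring
    have h2 : 1 ≤ √(p.κ * p.d) := by
      rw [Real.one_le_sqrt]
      nlinarith
    calc 1 + p.S * √(32 * p.Lμ * p.κ * p.d * p.logTerm)
        ≤ 1 * 1 + Λ * (8 * √p.Lμ * √(p.κ * p.d) * Λ) := by
          rw [one_mul]
          gcongr
      _ ≤ Λ ^ 2 * √(p.κ * p.d) + Λ * (8 * √p.Lμ * √(p.κ * p.d) * Λ) := by
          gcongr
          exact one_le_pow₀ hΛ1
      _ = _ := by ring
  have hα0 : 0 ≤ 2 * (√(6 * p.Lμ) + 3 * √(1 / (9 * p.lam)) + p.B * √p.lam) := by positivity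
  have hα : p.α ≤ 2 * (√(6 * p.Lμ) + 3 * √(1 / (9 * p.lam)) + p.B * √p.lam) * (p.κ * Λ) := by
    have h1 : √(2 * p.Lμ * p.κ ^ 2 * Real.log (4 * p.T * p.S * p.K / p.δ)) ≤
        √(6 * p.Lμ) * (p.κ * Λ) := by
      rw [Real.sqrt_le_left (by positivity), mul_pow, Real.sq_sqrt (by positivity)]
      calc 2 * p.Lμ * p.κ ^ 2 * Real.log (4 * p.T * p.S * p.K / p.δ)
          ≤ 2 * p.Lμ * p.κ ^ 2 * (3 * (Λ * Λ)) := by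
            gcongr
            nlinarith
        _ = _ := by ring
    have h2 : √(p.κ / (9 * p.lam)) * Real.log (4 * p.T * p.S * p.K / p.δ) ≤
        3 * √(1 / (9 * p.lam)) * (p.κ * Λ) := by
      rw [div_eq_mul_one_div, Real.sqrt_mul hκ0.le]
      calc √p.κ * √(1 / (9 * p.lam)) * Real.log (4 * p.T * p.S * p.K / p.δ)
          ≤ √p.κ * √(1 / (9 * p.lam)) * (3 * Λ) := by gcongr
        _ ≤ p.κ * √(1 / (9 * p.lam)) * (3 * Λ) := by gcongr
        _ = _ := by ring
    have h3 : p.B * √(p.κ * p.lam) ≤ p.B * √p.lam * (p.κ * Λ) := by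
      rw [mul_comm p.κ p.lam, Real.sqrt_mul hlam.le, mul_assoc]
      gcongr
      nlinarith
    unfold Params.α Params.α₁ Params.α₂
    linarith
  have hsq : √(2 * p.S * p.T * p.d * p.logTerm) ≤ 2 * Λ * √(p.d * p.T) := by
    rw [Real.sqrt_le_left (by positivity), mul_pow, Real.sq_sqrt (by positivity)]
    calc 2 * p.S * p.T * p.d * p.logTerm ≤ 2 * Λ * p.T * p.d * (2 * Λ) := by gcongr
      _ = _ := by ring
  -- The first term of the bound has four logarithms: one from ℓ, one from β² and two from S√ℓ. The
  -- second has two and the third none; both are raised to Λ⁴.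
  have hΛ4 : Λ ^ 2 ≤ Λ ^ 4 := pow_le_pow_right₀ hΛ1 (by norm_num)
  have hΛ4' : 1 ≤ Λ ^ 4 := one_le_pow₀ hΛ1
  set X := p.κ * √(p.d * p.T) with hX
  set Y := p.κ ^ (5 / 2 : ℝ) * (p.d : ℝ) ^ (5 / 2 : ℝ) with hY
  have hX0 : 0 ≤ X := by positivity
  have hY0 : 0 ≤ Y := by positivity
  have hYeq : Y = p.κ ^ 2 * p.d ^ 2 * √(p.κ * p.d) := by
    rw [hY, rpow_five_halves hκ0, rpow_five_halves hd0, Real.sqrt_mul hκ0.le]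
    ring
  have t1 : 16 * p.Lμ * p.d * p.logTerm * p.β ^ 2 *
      (1 + p.S * √(32 * p.Lμ * p.κ * p.d * p.logTerm)) ≤
      32 * p.Lμ * (2 + p.B * √p.lam) ^ 2 * (1 + 8 * √p.Lμ) * Λ ^ 4 * (X + Y) := by
    calc _ ≤ 16 * p.Lμ * p.d * (2 * Λ) * ((2 + p.B * √p.lam) ^ 2 * p.κ ^ 2 * (p.d * Λ)) *
          ((1 + 8 * √p.Lμ) * Λ ^ 2 * √(p.κ * p.d)) := by gcongr
      _ = 32 * p.Lμ * (2 + p.B * √p.lam) ^ 2 * (1 + 8 * √p.Lμ) * Λ ^ 4 * Y := by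
          rw [hYeq]
          ring
      _ ≤ _ := by
          gcongr
          linarith
  have t2 : 8 * p.Lμ * p.α * √(2 * p.S * p.T * p.d * p.logTerm) ≤
      32 * p.Lμ * (√(6 * p.Lμ) + 3 * √(1 / (9 * p.lam)) + p.B * √p.lam) * Λ ^ 4 * (X + Y) := by
    calc _ ≤ 8 * p.Lμ * (2 * (√(6 * p.Lμ) + 3 * √(1 / (9 * p.lam)) + p.B * √p.lam) * (p.κ * Λ)) *
          (2 * Λ * √(p.d * p.T)) := by gcongr
      _ = 32 * p.Lμ * (√(6 * p.Lμ) + 3 * √(1 / (9 * p.lam)) + p.B * √p.lam) * Λ ^ 2 * X := by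
          rw [hX]
          ring
      _ ≤ _ := by
          gcongr
          linarith
  have t3 : 2 * p.Lμ * √p.T ≤ 2 * p.Lμ * Λ ^ 4 * (X + Y) := by
    have h1 : √p.T ≤ X := by
      rw [hX, Real.sqrt_mul hd0.le]
      have h2 : 1 ≤ √(p.d : ℝ) := Real.one_le_sqrt.2 hd'
      calc √(p.T : ℝ) = 1 * (1 * √p.T) := by ring
        _ ≤ _ := by gcongr
    calc 2 * p.Lμ * √p.T = 2 * p.Lμ * 1 * √p.T := by ring
      _ ≤ 2 * p.Lμ * Λ ^ 4 * (X + Y) := by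
          gcongr
          linarith
  unfold Params.regretBound
  linarith

end Order

end SupSplitLog

end

theorem theorem1 :
    (∀ (p : SupSplitLog.Params),
      1 ≤ p.d → 4 ≤ p.T → 1 ≤ p.K → 0 < p.B → 0 < p.κ → 0 < p.Lμ → 1 / p.κ ≤ p.lam →
      0 < p.δ → p.δ < 1 →
      ∀ (tie : ℕ → Finset (Fin p.K) → Fin p.K),
      (∀ t (A : Finset (Fin p.K)), A.Nonempty → tie t A ∈ A) →
      ∀ {Ω : Type*} [MeasurableSpace Ω] (Pr : MeasureTheory.Measure Ω)
        [MeasureTheory.IsProbabilityMeasure Pr]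
        (x : ℕ → Ω → Fin p.K → SupSplitLog.Vec p.d) (r : ℕ → Ω → ℝ) (a : ℕ → Ω → Fin p.K)
        (θstar : SupSplitLog.Vec p.d),
      (∀ t, Measurable (x t)) → (∀ t, Measurable (r t)) →
      (∀ t ω, a t ω = SupSplitLog.action p tie (fun i => x i ω) (fun i => r i ω) t) →
      SupSplitLog.BernoulliRewards p x a r Pr θstar →
      SupSplitLog.BoundedFeatures p x Pr θstar →
      SupSplitLog.CurvatureBounds p x Pr →
      SupSplitLog.ExogenousContexts p x a r Pr →
      ENNReal.ofReal (1 - p.δ) ≤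
        Pr {ω | SupSplitLog.regret p θstar (fun t => x t ω) (fun t => a t ω) ≤ p.regretBound}) ∧
    (∃ n : ℕ, ∀ B lam Lμ : ℝ, 0 < B → 0 < lam → 0 < Lμ →
      ∃ C : ℝ, 0 < C ∧ ∀ (d T K : ℕ) (κ δ : ℝ),
        1 ≤ d → 4 ≤ T → 1 ≤ K → 1 ≤ κ → 1 / κ ≤ lam → 0 < δ → δ < 1 →
        (SupSplitLog.Params.mk d T K B κ lam δ Lμ).regretBound ≤
          C * Real.log (T * K / δ) ^ n *
            (κ * √(d * T) + κ ^ (5 / 2 : ℝ) * (d : ℝ) ^ (5 / 2 : ℝ))) := by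
  -- The exponent and the constant are those of `regretBound_le`; the three summands of C belong to
  -- the three terms of the regret bound.
  refine ⟨?_, 4, fun B lam Lμ hB hlam hLμ =>
    ⟨32 * Lμ * (2 + B * √lam) ^ 2 * (1 + 8 * √Lμ) +
      32 * Lμ * (√(6 * Lμ) + 3 * √(1 / (9 * lam)) + B * √lam) + 2 * Lμ, by positivity, ?_⟩⟩
  · intro p hd hT hK hB hκ _ hlam hδ hδ1 tie htie Ω _ Pr _ x r a θ hx hr ha hBR hBF hCB hEx
    have hlam0 : 0 < p.lam := lt_of_lt_of_le (by positivity) hlam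
    have h : SupSplitLog.Interaction p tie Pr x a r θ :=
      ⟨hB.le, hlam0, by omega, hx, hr, ha, hBR, hEx⟩
    refine h.le_prob_regret_le ?_
    filter_upwards [SupSplitLog.ae_admissible hd hT hK hB hκ hlam hδ hδ1 hBF hCB] with ω hω
    exact SupSplitLog.treeExp_regret_gt_le hω htie
  · intro d T K κ δ hd hT hK hκ hκlam hδ hδ1
    exact SupSplitLog.regretBound_le (p := ⟨d, T, K, B, κ, lam, δ, Lμ⟩) hd hT hK hB hκ hlam
      ((div_le_iff₀' (by linarith)).1 hκlam) hLμ hδ hδ1
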